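/- Let $\mathcal A$ be a finite-dimensional unital C*-algebra and let $\mathcal A^\infty$ be the quasilocal C*-algebra over $\mathbb Z^\nu$, i.e. the operator norm closure of the union of the local algebras $\mathcal A_\Lambda=\bigotimes_{\mathbf x\in\Lambda}\mathcal A$, $\Lambda\subset\mathbb Z^\nu$ finite, with the translation automorphisms $T(\mathbf x)$, $\mathbf x\in\mathbb Z^\nu$, which map $\mathcal A_\Lambda$ to $\mathcal A_{\Lambda+\mathbf x}$. For a subgroup $G\subseteq\mathbb Z^\nu$, a state of $\mathcal A^\infty$ is called $G$-ergodic if it is an extreme point of the convex set of states $\Psi$ with $\Psi\circ T(\mathbf x)=\Psi$ for all $\mathbf x\in G$. For $\mathbf n\in\mathbb N^\nu$ put $\Lambda(\mathbf n)=\prod_{j}\{0,\dots,n_j-1\}$. For a finite $\Lambda$ let $S(\Psi^{(\Lambda)})=-\operatorname{tr}D_\Lambda\log D_\Lambda$, where $D_\Lambda\in\mathcal A_\Lambda$ is the density operator of $\Psi|_{\mathcal A_\Lambda}$ with respect to the trace on $\mathcal A_\Lambda$ that equals $1$ on minimal projections. For an integer $l\ge1$ let $G_l=l\,\mathbb Z^\nu$,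 and for a $G_l$-invariant state $\Psi$ let $$s(\Psi,G_l)=\lim_{n_1,\dots,n_\nu\to\infty}\frac{1}{\#\Lambda(\mathbf n)}\,S\bigl(\Psi^{(\Lambda(l\mathbf n))}\bigr).$$ **Theorem.** Let $\Psi$ be a $\mathbb Z^\nu$-ergodic state on $\mathcal A^\infty$ and let $l>1$ be an integer. Then there are $\mathbf k=\mathbf k(l)\in\mathbb N^\nu$ and pairwise distinct $G_l$-ergodic states $\Psi_{\mathbf x}$, $\mathbf x\in\Lambda(\mathbf k)$, such that $$\Psi=\frac1{\#\Lambda(\mathbf k)}\sum_{\mathbf x\in\Lambda(\mathbf k)}\Psi_{\mathbf x},$$ and this is the only representation of $\Psi$ as a finite convex combination, with positive weights, of pairwise distinct $G_l$-ergodic states (up to the order of the summands). Moreover: 1. $k_j\le l$ and $k_j\mid l$ for all $j\in\{1,\dots,\nu\}$; 2. $\Psi_{\mathbf x}=\Psi_{\mathbf 0}\circ T(-\mathbf x)$ for all $\mathbf x\in\Lambda(\mathbf k)$; 3. the limits defining the mean entropies $s(\Psi,G_l)$ and $s(\Psi_{\mathbf x},G_l)$ exist, and $s(\Psi_{\mathbf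 x},G_l)=s(\Psi,G_l)$ for all $\mathbf x\in\Lambda(\mathbf k)$. -/

import Mathlib

namespace QuantumLattice
open scoped ComplexOrder MatrixOrder

/-- A finite-dimensional C*-algebra is a semisimple ring. -/
theorem isSemisimpleRing_of_finiteDimensional (A : Type*) [CStarAlgebra A]
    [FiniteDimensional ℂ A] : IsSemisimpleRing A := by
  have := IsArtinianRing.of_finite ℂ A
  rw [IsArtinianRing.isSemisimpleRing_iff_jacobson, eq_bot_iff]
  intro x hx
  obtain ⟨n, hn⟩ := IsSemiprimaryRing.isNilpotent (R := A)
  have hmem : star x * x ∈ Ring.jacobson A := Ideal.mul_mem_left _ _ hx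
  have hpow : (star x * x) ^ n = 0 := by
    have := Ideal.pow_mem_pow hmem n
    rw [hn] at this
    simpa using this
  have hsa : IsSelfAdjoint (star x * x) := IsSelfAdjoint.star_mul_self x
  have h0 : star x * x = 0 := by
    rw [← norm_eq_zero]
    have h1 := hsa.nnnorm_pow_two_pow n
    have h2 : (star x * x) ^ 2 ^ n = 0 :=
      pow_eq_zero_of_le (Nat.lt_two_pow_self).le hpow
    rw [h2, nnnorm_zero] at h1
    have := pow_eq_zero_iff (M₀ := NNReal) (a := ‖star x * x‖₊) (n := 2 ^ n) (by positivity)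
    simpa using this.1 h1.symm
  simpa using CStarRing.star_mul_self_eq_zero_iff x |>.1 h0

/-- Let `e` be an algebra isomorphism of a C*-algebra with a product of matrix algebras.
The sum of the traces of the blocks is a faithful positive functional. -/
theorem sum_trace_star_mul_self {A : Type*} [CStarAlgebra A] {r : ℕ} {d : Fin r → ℕ}
    (e : A ≃ₐ[ℂ] Π i, Matrix (Fin (d i)) (Fin (d i)) ℂ) (x : A) :
    0 ≤ ∑ i, (e (star x * x) i).trace ∧
      (∑ i, (e (star x * x) i).trace = 0 → x = 0) := by
  have hsa : IsSelfAdjoint (star x * x) := IsSelfAdjoint.star_mul_self x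
  have hspec : ∀ z ∈ spectrum ℂ (star x * x), 0 ≤ z := by
    intro z hz
    have hre := hsa.mem_spectrum_eq_re hz
    rw [hre] at hz ⊢
    have := spectrum_star_mul_self_nonneg (b := x) z.re
      ((spectrum.algebraMap_mem_iff ℂ).1 hz)
    exact_mod_cast this
  have hunion : spectrum ℂ (star x * x) = ⋃ i, spectrum ℂ (e (star x * x) i) := by
    rw [← Pi.spectrum_eq, AlgEquiv.spectrum_eq]
  have hroot : ∀ i, ∀ z ∈ (e (star x * x) i).charpoly.roots, 0 ≤ z := by
    intro i z hz
    apply hspec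
    rw [hunion, Set.mem_iUnion]
    exact ⟨i, Matrix.mem_spectrum_iff_isRoot_charpoly.2 (Polynomial.isRoot_of_mem_roots hz)⟩
  have htr : ∀ i, 0 ≤ (e (star x * x) i).trace := by
    intro i
    rw [Matrix.trace_eq_sum_roots_charpoly]
    exact Multiset.sum_nonneg (hroot i)
  refine ⟨Finset.sum_nonneg fun i _ => htr i, fun h => ?_⟩
  rw [Finset.sum_eq_zero_iff_of_nonneg fun i _ => htr i] at h
  have h0 : star x * x = 0 := by
    refine CFC.eq_zero_of_spectrum_subset_zero (R := ℂ) _ ?_ hsa.isStarNormal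
    rw [hunion]
    refine Set.iUnion_subset fun i z hz => ?_
    have h1 := h i (Finset.mem_univ i)
    rw [Matrix.trace_eq_sum_roots_charpoly] at h1
    have hz' : z ∈ (e (star x * x) i).charpoly.roots := by
      rw [Polynomial.mem_roots (Matrix.charpoly_monic _).ne_zero]
      exact Matrix.mem_spectrum_iff_isRoot_charpoly.1 hz
    have h2 := Multiset.single_le_sum (hroot i) z hz'
    rw [h1] at h2
    exact le_antisymm h2 (hroot i z hz')
  exact (CStarRing.star_mul_self_eq_zero_iff x).1 h0

/-- For an algebra isomorphism `e` of a C*-algebra with a product of matrix algebras, every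
block admits an invertible matrix intertwining the two involutions. -/
theorem exists_conj_star {A : Type*} [CStarAlgebra A] {r : ℕ} {d : Fin r → ℕ}
    [hd : ∀ i, NeZero (d i)]
    (e : A ≃ₐ[ℂ] Π i, Matrix (Fin (d i)) (Fin (d i)) ℂ) (i : Fin r) :
    ∃ S : (Matrix (Fin (d i)) (Fin (d i)) ℂ)ˣ, ∀ a : A,
      S.val * e (star a) i * S⁻¹.val =
        star (S.val * e a i * S⁻¹.val) := by
  classical
  let E : Fin (d i) → A := fun k => e.symm (Pi.single i (Matrix.single k 0 1))
  let τ : A →ₗ[ℂ] ℂ :=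
    { toFun := fun a => ∑ j, (e a j).trace
      map_add' := fun a b => by simp [Finset.sum_add_distrib]
      map_smul' := fun c a => by simp [Finset.mul_sum] }
  have hE : ∀ a k, a * E k = ∑ m, (e a i m k) • E m := by
    intro a k
    apply e.injective
    rw [map_mul, map_sum]
    simp only [map_smul, E, AlgEquiv.apply_symm_apply]
    funext j
    rw [Finset.sum_apply]
    by_cases hj : j = i
    · subst hj
      ext p q
      simp [Matrix.sum_apply, Matrix.single_apply, Matrix.mul_apply]
      by_cases hq : 0 = q <;> simp [hq]
    · simp [hj]
  let G : Matrix (Fin (d i)) (Fin (d i)) ℂ := Matrix.of fun j k => τ (star (E j) * E k)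
  have hG : ∀ v w : Fin (d i) → ℂ,
      star v ⬝ᵥ (G.mulVec w) = τ (star (∑ j, v j • E j) * ∑ k, w k • E k) := by
    intro v w
    simp only [star_sum, Finset.sum_mul, Finset.mul_sum, map_sum, dotProduct, Matrix.mulVec,
      star_smul, smul_mul_assoc, mul_smul_comm, map_smul, smul_eq_mul, G, Matrix.of_apply,
      Pi.star_apply]
    rw [Finset.sum_comm]
    refine Finset.sum_congr rfl fun j _ => Finset.sum_congr rfl fun k _ => ?_
    ring
  have hτ : ∀ x, 0 ≤ τ (star x * x) ∧ (τ (star x * x) = 0 → x = 0) :=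
    fun x => sum_trace_star_mul_self e x
  have hτs : ∀ x y, star (τ (star y * x)) = τ (star x * y) := by
    intro x y
    have him : ∀ z, (τ (star z * z)).im = 0 := fun z => ((Complex.le_def.1 (hτ z).1).2).symm
    have h1 := him (x + y)
    have h2 := him (x + Complex.I • y)
    simp only [star_add, star_smul, add_mul, mul_add, smul_mul_assoc, mul_smul_comm, map_add,
      map_smul, smul_eq_mul, Complex.add_im, him, Complex.mul_im, Complex.star_def,
      Complex.conj_I, Complex.neg_re, Complex.neg_im, Complex.I_re, Complex.I_im,
      Complex.mul_re] at h1 h2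
    apply Complex.ext
    · rw [Complex.star_def, Complex.conj_re]; linarith
    · rw [Complex.star_def, Complex.conj_im]; linarith
  have hGpos : G.PosDef := by
    refine Matrix.PosDef.of_dotProduct_mulVec_pos ?_ ?_
    · ext j k
      exact (hτs (E j) (E k))
    · intro v hv
      rw [hG]
      refine lt_of_le_of_ne (hτ _).1 fun h => hv ?_
      have h1 := (hτ _).2 h.symm
      have h2 := congrArg e h1
      rw [map_sum, map_zero] at h2
      simp only [map_smul, E, AlgEquiv.apply_symm_apply] at h2
      funext p
      have h3 := congrFun (congrFun (congrFun h2 i) p) 0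
      rw [Finset.sum_apply, Matrix.sum_apply] at h3
      simpa [Matrix.single_apply] using h3
  have hcomm : ∀ a, G * e a i = star (e (star a) i) * G := by
    intro a
    ext j k
    have h1 : (G * e a i) j k = τ (star (E j) * (a * E k)) := by
      rw [hE, Finset.mul_sum, map_sum, Matrix.mul_apply]
      refine Finset.sum_congr rfl fun m _ => ?_
      simp [G, mul_comm]
    have h2 : (star (e (star a) i) * G) j k = τ (star (star a * E j) * E k) := by
      rw [hE (star a) j, star_sum, Finset.sum_mul, map_sum, Matrix.mul_apply]
      refine Finset.sum_congr rfl fun m _ => ?_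
      simp [G, Matrix.star_apply]
    rw [h1, h2, star_mul, star_star, mul_assoc]
  obtain ⟨S, hS⟩ := CStarAlgebra.nonneg_iff_eq_star_mul_self.mp hGpos.posSemidef.nonneg
  have hSu : IsUnit S := by
    rw [Matrix.isUnit_iff_isUnit_det]
    have := hGpos.det_pos.ne'
    rw [hS, Matrix.det_mul] at this
    exact (right_ne_zero_of_mul this).isUnit
  obtain ⟨S, rfl⟩ := hSu
  refine ⟨S, fun a => ?_⟩
  have h := hcomm (star a)
  rw [star_star, hS] at h
  have hu : star S.val * star S⁻¹.val = 1 := by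
    rw [← star_mul, Units.inv_mul, star_one]
  have hu' : star S⁻¹.val * star S.val = 1 := by
    rw [← star_mul, Units.mul_inv, star_one]
  rw [star_mul, star_mul]
  calc S.val * e (star a) i * S⁻¹.val
      = star S⁻¹.val * (star S.val * S * e (star a) i) *
          S⁻¹.val := by
        simp only [← mul_assoc, hu', one_mul]
    _ = star S⁻¹.val * (star (e a i) * (star S.val * S)) *
          S⁻¹.val := by rw [h]
    _ = _ := by simp only [mul_assoc, Units.mul_inv, mul_one]

/-- The structure theorem: a finite-dimensional C*-algebra is *-isomorphic to a finite product of
full matrix algebras. -/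
theorem exists_starAlgEquiv_pi_matrix (A : Type*) [CStarAlgebra A] [FiniteDimensional ℂ A] :
    ∃ (r : ℕ) (d : Fin r → ℕ), (∀ i, NeZero (d i)) ∧
      Nonempty (A ≃⋆ₐ[ℂ] Π i, Matrix (Fin (d i)) (Fin (d i)) ℂ) := by
  have := isSemisimpleRing_of_finiteDimensional A
  obtain ⟨r, d, hd, ⟨e⟩⟩ := IsSemisimpleRing.exists_algEquiv_pi_matrix_of_isAlgClosed ℂ A
  refine ⟨r, d, hd, ?_⟩
  choose S hS using exists_conj_star e
  let f : A →⋆ₐ[ℂ] Π i, Matrix (Fin (d i)) (Fin (d i)) ℂ :=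
    { toFun := fun a i => (S i).val * e a i * (S i)⁻¹.val
      map_one' := by funext i; simp
      map_mul' := fun a b => by
        funext i
        simp only [map_mul, Pi.mul_apply, mul_assoc, Units.inv_mul_cancel_left]
      map_zero' := by funext i; simp
      map_add' := fun a b => by funext i; simp [mul_add, add_mul]
      commutes' := fun c => by
        funext i
        simp [Algebra.algebraMap_eq_smul_one]
      map_star' := fun a => by funext i; exact hS i a }
  refine ⟨StarAlgEquiv.ofBijective f ⟨?_, ?_⟩⟩
  · intro a b hab
    apply e.injective
    funext i
    have := congrFun hab i
    exact (S i).isUnit.mul_left_cancel ((S i)⁻¹.isUnit.mul_right_cancel this)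
  · intro y
    refine ⟨e.symm fun i => (S i)⁻¹.val * y i * (S i).val, ?_⟩
    funext i
    change (S i).val * e (e.symm _) i * _ = _
    rw [AlgEquiv.apply_symm_apply]
    simp only [mul_assoc, Units.mul_inv, mul_one, Units.mul_inv_cancel_left]

/-! ### Finite matrices acting on a tensor factor of a Hilbert space -/

section TensorFactor

variable {P R I : Type*} [Fintype P]

/-- For `I ≃ P × R` with `P` finite, so that `ℓ²(I) = ℂ^P ⊗ ℓ²(R)`: the action of the matrix
`M ⊗ 1` on functions on `I`. -/
def ampFun (e : I ≃ P × R) (M : Matrix P P ℂ) (f : I → ℂ) : I → ℂ :=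
  fun i => ∑ q, M (e i).1 q * f (e.symm (q, (e i).2))

theorem memℓp_ampFun (e : I ≃ P × R) (M : Matrix P P ℂ) (f : lp (fun _ : I => ℂ) 2) :
    Memℓp (E := fun _ : I => ℂ) (ampFun e M f) 2 := by
  have hterm : ∀ q ∈ (Finset.univ : Finset P), Memℓp (E := fun _ : I => ℂ)
      (fun i => M (e i).1 q * f (e.symm (q, (e i).2))) 2 := by
    intro q _
    apply memℓp_gen
    have hf : Summable fun i => ‖f i‖ ^ (2 : ENNReal).toReal :=
      (lp.memℓp f).summable (by norm_num)
    have hf' : Summable fun r => ‖f (e.symm (q, r))‖ ^ (2 : ENNReal).toReal := by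
      refine hf.comp_injective (i := fun r => e.symm (q, r)) fun r s h => ?_
      simpa using e.symm.injective h
    have hM : Summable fun p => ‖M p q‖ ^ (2 : ENNReal).toReal := summable_of_hasFiniteSupport (Set.toFinite _)
    have := hM.mul_of_nonneg hf' (fun _ => by positivity) (fun _ => by positivity)
    rw [← e.summable_iff] at this
    refine this.congr fun i => ?_
    simp [mul_pow]
  exact Memℓp.finsetSum Finset.univ hterm

/-- The bounded operator `M ⊗ 1` on `ℓ²(I) = ℂ^P ⊗ ℓ²(R)`. -/
noncomputable def ampCLM (e : I ≃ P × R) (M : Matrix P P ℂ) :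
    lp (fun _ : I => ℂ) 2 →L[ℂ] lp (fun _ : I => ℂ) 2 :=
  ContinuousLinearMap.ofSeqClosedGraph
    (g := { toFun := fun f => ⟨ampFun e M f, memℓp_ampFun e M f⟩
            map_add' := fun f g => by
              ext i
              change ∑ q, M (e i).1 q * (f (e.symm (q, (e i).2)) + g (e.symm (q, (e i).2))) =
                ∑ q, M (e i).1 q * f (e.symm (q, (e i).2)) +
                  ∑ q, M (e i).1 q * g (e.symm (q, (e i).2))
              simp only [mul_add, Finset.sum_add_distrib]
            map_smul' := fun c f => by
              ext i
              simp [ampFun, Finset.mul_sum, mul_left_comm] })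
    (by
      intro u x y hu hy
      ext i
      have h1 := ((lp.evalCLM ℂ (fun _ : I => ℂ) 2 i).continuous.tendsto y).comp hy
      refine tendsto_nhds_unique h1 ?_
      change Filter.Tendsto (fun n => ∑ q, M (e i).1 q * u n (e.symm (q, (e i).2))) _
        (nhds (∑ q, M (e i).1 q * x (e.symm (q, (e i).2))))
      refine tendsto_finsetSum _ fun q _ => Filter.Tendsto.const_mul _ ?_
      exact ((lp.evalCLM ℂ (fun _ : I => ℂ) 2 (e.symm (q, (e i).2))).continuous.tendsto x).comp hu)

@[simp] theorem ampCLM_apply (e : I ≃ P × R) (M : Matrix P P ℂ) (f : lp (fun _ : I => ℂ) 2)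
    (i : I) : ampCLM e M f i = ∑ q, M (e i).1 q * f (e.symm (q, (e i).2)) := rfl

theorem star_ampCLM [DecidableEq P] (e : I ≃ P × R) (M : Matrix P P ℂ) :
    ampCLM e (star M) = star (ampCLM e M) := by
  classical
  ext f i
  have h : ampCLM e M (lp.single 2 i 1) =
      ∑ p, M p (e i).1 • lp.single 2 (e.symm (p, (e i).2)) (1 : ℂ) := by
    ext j
    rw [ampCLM_apply, lp.coeFn_sum, Finset.sum_apply]
    obtain ⟨⟨p, s⟩, rfl⟩ := e.symm.surjective j
    obtain ⟨⟨q, r⟩, rfl⟩ := e.symm.surjective i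
    simp [lp.single_apply, Pi.single_apply]
    by_cases hs : s = r
    · simp [hs]
    · simp [hs]
  have h1 : star (ampCLM e M) f i =
      inner ℂ (lp.single 2 i (1 : ℂ)) (star (ampCLM e M) f) := by
    rw [lp.inner_single_left]; simp
  rw [h1, ContinuousLinearMap.star_eq_adjoint, ContinuousLinearMap.adjoint_inner_right, h,
    sum_inner, ampCLM_apply]
  refine Finset.sum_congr rfl fun p _ => ?_
  rw [inner_smul_left, lp.inner_single_left]
  simp [Matrix.star_apply]

/-- `M ↦ M ⊗ 1` as a *-homomorphism into the bounded operators on `ℓ²(I) = ℂ^P ⊗ ℓ²(R)`. -/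
noncomputable def amplification [DecidableEq P] (e : I ≃ P × R) :
    Matrix P P ℂ →⋆ₐ[ℂ] (lp (fun _ : I => ℂ) 2 →L[ℂ] lp (fun _ : I => ℂ) 2) where
  toFun := ampCLM e
  map_one' := by
    ext f i
    simp [Matrix.one_apply]
  map_mul' := fun M N => by
    ext f i
    simp [Matrix.mul_apply, Finset.sum_mul, Finset.mul_sum, mul_assoc]
    exact Finset.sum_comm
  map_zero' := by
    ext f i
    simp
  map_add' := fun M N => by
    ext f i
    simp [add_mul, Finset.sum_add_distrib]
  commutes' := fun c => by
    ext f i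
    simp [Algebra.algebraMap_eq_smul_one, Matrix.one_apply]
  map_star' := star_ampCLM e

/-- The unitary operator on `ℓ²(I)` induced by a permutation of `I`. -/
noncomputable def permUnitary (σ : Equiv.Perm I) :
    lp (fun _ : I => ℂ) 2 ≃ₗᵢ[ℂ] lp (fun _ : I => ℂ) 2 where
  toFun := fun f => ⟨fun i => f (σ i), memℓp_gen
    (σ.summable_iff.2 ((lp.memℓp f).summable (p := 2) (by norm_num)))⟩
  invFun := fun f => ⟨fun i => f (σ.symm i), memℓp_gen
    (σ.symm.summable_iff.2 ((lp.memℓp f).summable (p := 2) (by norm_num)))⟩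
  map_add' := fun f g => rfl
  map_smul' := fun c f => rfl
  left_inv := fun f => by ext i; exact congrArg f (σ.apply_symm_apply i)
  right_inv := fun f => by ext i; exact congrArg f (σ.symm_apply_apply i)
  norm_map' := fun f => by
    rw [lp.norm_eq_tsum_rpow (by norm_num), lp.norm_eq_tsum_rpow (by norm_num)]
    congr 1
    exact σ.tsum_eq fun i => ‖f i‖ ^ (2 : ENNReal).toReal

end TensorFactor

/-! ### The one-site algebra as an algebra of block-diagonal matrices -/

section OneSite

variable (A : Type*) [CStarAlgebra A] [FiniteDimensional ℂ A]

/-- The number of simple summands of `A`. -/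
noncomputable def numBlocks : ℕ := (exists_starAlgEquiv_pi_matrix A).choose

/-- The sizes of the simple summands of `A`. -/
noncomputable def blockSize : Fin (numBlocks A) → ℕ :=
  (exists_starAlgEquiv_pi_matrix A).choose_spec.choose

/-- A *-isomorphism of `A` with a finite product of full matrix algebras. -/
noncomputable def blockEquiv :
    A ≃⋆ₐ[ℂ] Π i, Matrix (Fin (blockSize A i)) (Fin (blockSize A i)) ℂ :=
  (exists_starAlgEquiv_pi_matrix A).choose_spec.choose_spec.2.some

/-- Row and column labels of the block-diagonal matrices representing `A`. -/
abbrev Idx : Type := Σ i : Fin (numBlocks A), Fin (blockSize A i)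

/-- The faithful representation of `A` by block-diagonal matrices in which each irreducible
representation of `A` occurs exactly once. The trace of matrices therefore restricts to the trace
of `A` that is `1` on each minimal projection. -/
noncomputable def rep (a : A) : Matrix (Idx A) (Idx A) ℂ :=
  Matrix.blockDiagonal' (blockEquiv A a)

end OneSite

/-! ### Local algebras and the quasilocal algebra -/

section Lattice

variable (A : Type*) [CStarAlgebra A] [FiniteDimensional ℂ A] {ν : ℕ}

/-- The elementary tensor `⨂_{x ∈ Λ} a x`, as a Kronecker product of matrices. -/
noncomputable def elementaryTensor {Λ : Finset (Fin ν → ℤ)} (a : Λ → A) :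
    Matrix (Λ → Idx A) (Λ → Idx A) ℂ :=
  Matrix.of fun c c' => ∏ x, rep A (a x) (c x) (c' x)

/-- The local algebra `A_Λ = ⨂_{x ∈ Λ} A`: the *-algebra of matrices generated by the elementary
tensors. -/
noncomputable def localAlgebra (Λ : Finset (Fin ν → ℤ)) :
    StarSubalgebra ℂ (Matrix (Λ → Idx A) (Λ → Idx A) ℂ) :=
  StarAlgebra.adjoin ℂ (Set.range (elementaryTensor A (Λ := Λ)))

variable (ν) in
/-- Assignments of a basis label to every site of the lattice `ℤ^ν`. -/
abbrev Config : Type := (Fin ν → ℤ) → Idx A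

variable (ν) in
/-- The Hilbert space `ℓ²` over all assignments; for every finite `Λ` it is the tensor product of
`ℂ^(Λ → Idx A)` with the `ℓ²` space over the assignments outside `Λ`. It serves to realise all
local algebras at once as algebras of bounded operators. -/
abbrev ConfigSpace : Type := lp (fun _ : Config A ν => ℂ) 2

/-- The embedding `M ↦ M ⊗ 1` of the matrices over the sites in `Λ` into the bounded operators. -/
noncomputable def localOp (Λ : Finset (Fin ν → ℤ)) :
    Matrix (Λ → Idx A) (Λ → Idx A) ℂ →⋆ₐ[ℂ] (ConfigSpace A ν →L[ℂ] ConfigSpace A ν) :=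
  amplification (Equiv.piEquivPiSubtypeProd (fun x => x ∈ Λ) fun _ => Idx A)

variable (ν) in
/-- The quasilocal C*-algebra `A^∞`: the operator norm closure of the union of the local algebras. -/
noncomputable def quasiLocalAlgebra :
    StarSubalgebra ℂ (ConfigSpace A ν →L[ℂ] ConfigSpace A ν) :=
  (⨆ Λ : Finset (Fin ν → ℤ), (localAlgebra A Λ).map (localOp A Λ)).topologicalClosure

variable (ν) in
/-- The quasilocal C*-algebra `A^∞` as a type. -/
abbrev QuasiLocal : Type := ↥(quasiLocalAlgebra A ν)

theorem localOp_mem (Λ : Finset (Fin ν → ℤ)) (M : localAlgebra A Λ) :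
    localOp A Λ M ∈ quasiLocalAlgebra A ν :=
  StarSubalgebra.le_topologicalClosure _
    (le_iSup (fun Λ : Finset (Fin ν → ℤ) => (localAlgebra A Λ).map (localOp A Λ)) Λ
      (StarSubalgebra.mem_map.2 ⟨M, M.2, rfl⟩))

/-- The inclusion of the local algebra `A_Λ` into `A^∞`. -/
noncomputable def localInclusion (Λ : Finset (Fin ν → ℤ)) :
    localAlgebra A Λ →⋆ₐ[ℂ] QuasiLocal A ν :=
  ((localOp A Λ).comp (localAlgebra A Λ).subtype).codRestrict (quasiLocalAlgebra A ν)
    (localOp_mem A Λ)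

/-- The permutation `c ↦ c(· + x)` of the assignments. -/
def shiftConfig (x : Fin ν → ℤ) : Equiv.Perm (Config A ν) where
  toFun c := fun z => c (z + x)
  invFun c := fun z => c (z - x)
  left_inv c := by funext z; simp
  right_inv c := by funext z; simp

/-- Conjugation with the unitary that translates the assignments by `x`. -/
noncomputable def conjShift (x : Fin ν → ℤ) :
    (ConfigSpace A ν →L[ℂ] ConfigSpace A ν) →⋆ₐ[ℂ] (ConfigSpace A ν →L[ℂ] ConfigSpace A ν) :=
  ((permUnitary (shiftConfig A x)).conjStarAlgEquiv).toStarAlgHom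

/-- The translate `Λ + x` of a finite subset of the lattice. -/
def translateSet (Λ : Finset (Fin ν → ℤ)) (x : Fin ν → ℤ) : Finset (Fin ν → ℤ) :=
  Λ.map (Equiv.addRight x).toEmbedding

theorem mem_translateSet {Λ : Finset (Fin ν → ℤ)} {x y : Fin ν → ℤ} :
    y ∈ translateSet Λ x ↔ y - x ∈ Λ := by
  simp [translateSet, sub_eq_add_neg]

/-- Conjugation with the shift by `x` moves `⨂_{z ∈ Λ} a z` to the sites of `Λ + x`. -/
theorem conjShift_elementaryTensor (x : Fin ν → ℤ) (Λ : Finset (Fin ν → ℤ)) (a : Λ → A) :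
    conjShift A x (localOp A Λ (elementaryTensor A a)) =
      localOp A (translateSet Λ x)
        (elementaryTensor A fun y => a ⟨y - x, mem_translateSet.1 y.2⟩) := by
  let eΛ : translateSet Λ x ≃ Λ :=
    (Equiv.subRight x).subtypeEquiv fun y => mem_translateSet
  ext f c
  change ∑ u : Λ → Idx A, _ = ∑ u : translateSet Λ x → Idx A, _
  refine Fintype.sum_equiv (Equiv.arrowCongr eΛ.symm (Equiv.refl _)) _ _ fun u => ?_
  congr 1
  · change ∏ z, _ = ∏ y, _
    refine (Fintype.prod_equiv eΛ _ _ fun y => ?_).symm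
    change rep A _ (c y) _ = rep A _ (c (y - x + x)) _
    rw [sub_add_cancel]
    rfl
  · change f _ = f _
    refine congrArg f (funext fun y => ?_)
    change (if h : y - x ∈ Λ then u ⟨y - x, h⟩ else c (y - x + x)) =
      (if h : y ∈ translateSet Λ x then u (eΛ ⟨y, h⟩) else c y)
    by_cases h : y ∈ translateSet Λ x
    · rw [dif_pos h, dif_pos (mem_translateSet.1 h)]
      rfl
    · rw [dif_neg h, dif_neg (mt mem_translateSet.2 h), sub_add_cancel]

theorem conjShift_mem (x : Fin ν → ℤ) (a : QuasiLocal A ν) :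
    conjShift A x a ∈ quasiLocalAlgebra A ν := by
  have hcont : Continuous (conjShift A (ν := ν) x) :=
    ((permUnitary (shiftConfig A x)).toContinuousLinearEquiv.conjContinuousAlgEquiv).continuous
  have hle : (quasiLocalAlgebra A ν).map (conjShift A x) ≤ quasiLocalAlgebra A ν := by
    refine (StarSubalgebra.map_topologicalClosure_le _ _ hcont).trans
      (StarSubalgebra.topologicalClosure_mono ?_)
    rw [StarSubalgebra.map_le_iff_le_comap]
    refine iSup_le fun Λ => ?_
    rw [StarSubalgebra.map_le_iff_le_comap]
    refine StarAlgebra.adjoin_le ?_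
    rintro _ ⟨a, rfl⟩
    change conjShift A x (localOp A Λ (elementaryTensor A a)) ∈
      ⨆ Λ : Finset (Fin ν → ℤ), (localAlgebra A Λ).map (localOp A Λ)
    rw [conjShift_elementaryTensor]
    exact (le_iSup (fun Λ : Finset (Fin ν → ℤ) => (localAlgebra A Λ).map (localOp A Λ))
      (translateSet Λ x)) (StarSubalgebra.mem_map.2
        ⟨_, StarAlgebra.subset_adjoin _ _ ⟨_, rfl⟩, rfl⟩)
  exact hle (StarSubalgebra.mem_map.2 ⟨a, a.2, rfl⟩)

/-- The translation `T(x)` of `A^∞`. -/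
noncomputable def translation (x : Fin ν → ℤ) : QuasiLocal A ν →⋆ₐ[ℂ] QuasiLocal A ν :=
  ((conjShift A x).comp (quasiLocalAlgebra A ν).subtype).codRestrict (quasiLocalAlgebra A ν)
    (conjShift_mem A x)

end Lattice

/-! ### States, invariance and ergodicity -/

section States

variable (A : Type*) [CStarAlgebra A] [FiniteDimensional ℂ A] (ν : ℕ)

/-- The states of `A^∞`: the normalised positive linear functionals. -/
def states : Set (QuasiLocal A ν →ₗ[ℂ] ℂ) :=
  {Ψ | (∀ a, 0 ≤ Ψ (star a * a)) ∧ Ψ 1 = 1}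

variable {A ν} in
/-- The functional `Ψ ∘ T(x)`. -/
noncomputable def translate (Ψ : QuasiLocal A ν →ₗ[ℂ] ℂ) (x : Fin ν → ℤ) :
    QuasiLocal A ν →ₗ[ℂ] ℂ :=
  Ψ ∘ₗ (translation A x).toAlgHom.toLinearMap

/-- The states of `A^∞` that are invariant under the translations in `G`. -/
def invariantStates (G : AddSubgroup (Fin ν → ℤ)) : Set (QuasiLocal A ν →ₗ[ℂ] ℂ) :=
  {Ψ | Ψ ∈ states A ν ∧ ∀ x ∈ G, translate Ψ x = Ψ}

/-- The `G`-ergodic states: the extreme points of the set of `G`-invariant states. -/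
def ergodicStates (G : AddSubgroup (Fin ν → ℤ)) : Set (QuasiLocal A ν →ₗ[ℂ] ℂ) :=
  (invariantStates A ν G).extremePoints ℝ

/-- The subgroup `G_l = l · ℤ^ν` of `ℤ^ν`. -/
def scaledLattice (l : ℕ) : AddSubgroup (Fin ν → ℤ) :=
  (nsmulAddMonoidHom l : (Fin ν → ℤ) →+ (Fin ν → ℤ)).range

variable {A ν} in
/-- `w` is a convex decomposition of `Ψ` into `G`-ergodic states: it assigns to finitely many
distinct `G`-ergodic states positive weights with sum `1`, and `Ψ` is the corresponding convex
combination. -/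
structure IsErgodicDecomposition (G : AddSubgroup (Fin ν → ℤ)) (Ψ : QuasiLocal A ν →ₗ[ℂ] ℂ)
    (w : (QuasiLocal A ν →ₗ[ℂ] ℂ) →₀ ℝ) : Prop where
  ergodic : ∀ Φ ∈ w.support, Φ ∈ ergodicStates A ν G
  pos : ∀ Φ ∈ w.support, 0 < w Φ
  sum_eq_one : ∑ Φ ∈ w.support, w Φ = 1
  sum_smul_eq : ∑ Φ ∈ w.support, w Φ • Φ = Ψ

end States

/-! ### Entropy -/

/-- The box `Λ(n)`, consisting of the points `x` of `ℤ^ν` with `0 ≤ x j < n j`. -/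
noncomputable def box {ν : ℕ} (n : Fin ν → ℕ) : Finset (Fin ν → ℤ) :=
  Fintype.piFinset fun j => Finset.Ico 0 (n j : ℤ)

/-- Every linear functional on a *-algebra of matrices is `a ↦ tr (D a)` for a unique element `D`
of that algebra. -/
theorem existsUnique_density {m : Type*} [Fintype m] [DecidableEq m]
    (B : StarSubalgebra ℂ (Matrix m m ℂ)) (φ : B →ₗ[ℂ] ℂ) :
    ∃! D : B, ∀ a : B, φ a = ((D : Matrix m m ℂ) * a).trace := by
  let L : B →ₗ[ℂ] Module.Dual ℂ B := LinearMap.mk₂ ℂ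
    (fun D a => ((D : Matrix m m ℂ) * (a : Matrix m m ℂ)).trace)
    (fun D D' a => by simp [add_mul]) (fun c D a => by simp)
    (fun D a a' => by simp [mul_add]) (fun c D a => by simp)
  have hinj : Function.Injective L := by
    rw [← LinearMap.ker_eq_bot, LinearMap.ker_eq_bot']
    intro D hD
    have h := LinearMap.congr_fun hD (star D)
    change ((D : Matrix m m ℂ) * star (D : Matrix m m ℂ)).trace = 0 at h
    rw [Matrix.star_eq_conjTranspose, Matrix.trace_mul_conjTranspose_self_eq_zero_iff] at h
    exact Subtype.ext h
  have hfin : FiniteDimensional ℂ B :=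
    FiniteDimensional.finiteDimensional_submodule (Subalgebra.toSubmodule B.toSubalgebra)
  have hsurj : Function.Surjective L :=
    (LinearMap.injective_iff_surjective_of_finrank_eq_finrank
      Subspace.dual_finrank_eq.symm).1 hinj
  obtain ⟨D, hD⟩ := hsurj φ
  refine ⟨D, fun a => by rw [← hD]; rfl, fun D' hD' => hinj ?_⟩
  rw [hD]
  ext a
  exact (hD' a).symm

section Entropy

variable {A : Type*} [CStarAlgebra A] [FiniteDimensional ℂ A] {ν : ℕ}

/-- The restriction `Ψ^(Λ)` of a functional `Ψ` on `A^∞` to the local algebra `A_Λ`. -/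
noncomputable def restrict (Ψ : QuasiLocal A ν →ₗ[ℂ] ℂ) (Λ : Finset (Fin ν → ℤ)) :
    localAlgebra A Λ →ₗ[ℂ] ℂ :=
  Ψ ∘ₗ (localInclusion A Λ).toAlgHom.toLinearMap

/-- The density operator `D_Λ ∈ A_Λ`, with `Ψ^(Λ)(a) = tr (D_Λ a)` for all `a ∈ A_Λ`. -/
noncomputable def densityOperator (Ψ : QuasiLocal A ν →ₗ[ℂ] ℂ) (Λ : Finset (Fin ν → ℤ)) :
    localAlgebra A Λ :=
  (existsUnique_density (localAlgebra A Λ) (restrict Ψ Λ)).choose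

/-- The von Neumann entropy `S(Ψ^(Λ)) = -tr (D_Λ log D_Λ)`. -/
noncomputable def entropy (Ψ : QuasiLocal A ν →ₗ[ℂ] ℂ) (Λ : Finset (Fin ν → ℤ)) : ℝ :=
  -((densityOperator Ψ Λ : Matrix (Λ → Idx A) (Λ → Idx A) ℂ) *
    cfc Real.log (densityOperator Ψ Λ : Matrix (Λ → Idx A) (Λ → Idx A) ℂ)).trace.re

/-- `S(Ψ^(l n)) / #Λ(n)`, where `Ψ^(l n)` is the restriction of `Ψ` to the box `Λ(l n)`. -/
noncomputable def entropyRate (Ψ : QuasiLocal A ν →ₗ[ℂ] ℂ) (l : ℕ) (n : Fin ν → ℕ) : ℝ :=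
  entropy Ψ (box fun j => l * n j) / (box n).card

/-- The mean entropy of `Ψ` with respect to `G_l` exists and equals `s`: `S(Ψ^(l n)) / #Λ(n)`
tends to `s` as all sides of the box `Λ(n)` tend to infinity. -/
def HasMeanEntropy (Ψ : QuasiLocal A ν →ₗ[ℂ] ℂ) (l : ℕ) (s : ℝ) : Prop :=
  Filter.Tendsto (entropyRate Ψ l) Filter.atTop (nhds s)

end Entropy
end QuantumLattice

namespace QuantumLattice

open scoped ComplexOrder Topology
open Filter

/-! ### Positive functionals -/

section PositiveFunctional

variable {B : Type*} [CStarAlgebra B] {φ θ : B →ₗ[ℂ] ℂ}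

/-! Call φ dominated by Ψ if `φ(a*a) ≤ c Ψ(a*a)` for all a, with some constant c. Extremality is
used in one form throughout: an invariant positive functional dominated by an extreme invariant
state is a multiple of that state (`eq_smul_of_dominated`).

Existence. Let φ be a state dominated by Ψ and invariant under a subgroup H of finite index. The sum
of its translates over the cosets of H is invariant under the whole group and still dominated, so Ψ
is the mean of these translates (`eq_average_of_dominated`). Hence c can always be taken to be the
index, and the dominated H-invariant states form a compact face of the H-invariant states; an
extreme point of it, for H = G_l, is a G_l-ergodic φ (`exists_extreme_dominated`). The averaging is
then repeated over the full stabilizer of φ, which contains G_l: now the translates are pairwise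
distinct, and the Hermite normal form gives a box of representatives whose sides divide l
(`exists_box_isTransversal`).

Uniqueness. For ν > 0 the translations are asymptotically abelian, so in a G_l-ergodic state θ the
means of a over large boxes converge to the scalar θ(a) in the seminorm `θ(x*x)^(1/2)`. Products of
factors "mean minus scalar" therefore separate finitely many ergodic states asymptotically, and
these states are linearly independent (`linearIndependent_extremePoints`). For ν = 0 the group is
trivial and extremality of Ψ itself suffices.

Entropy. The Gibbs variational principle gives subadditivity and translation covariance of the local
entropies, without partial traces. A Fekete argument gives the limit, together with the same upper
bound for boxes with an arbitrary corner (`IsLatticeSubadditive.exists_tendsto`), so all translates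
of φ have one mean entropy s. The entropy of a uniform mixture of N states lies between the mean of
their entropies and this mean plus log N; divided by the volume, log N disappears, so Ψ has mean
entropy s as well. -/

theorem star_apply_of_nonneg (hφ : ∀ a, 0 ≤ φ (star a * a)) (x y : B) :
    star (φ (star y * x)) = φ (star x * y) := by
  have him : ∀ z, (φ (star z * z)).im = 0 := fun z => ((Complex.le_def.1 (hφ z)).2).symm
  -- Polarization: reality of the form at x + y and at x + iy gives the two components of Hermitian
  -- symmetry.
  have h1 := him (x + y)
  have h2 := him (x + Complex.I • y)
  simp only [star_add, star_smul, add_mul, mul_add, smul_mul_assoc, mul_smul_comm, map_add,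
    map_smul, smul_eq_mul, Complex.add_im, him, Complex.mul_im, Complex.star_def,
    Complex.conj_I, Complex.neg_re, Complex.neg_im, Complex.I_re, Complex.I_im,
    Complex.mul_re] at h1 h2
  apply Complex.ext
  · rw [Complex.star_def, Complex.conj_re]; linarith
  · rw [Complex.star_def, Complex.conj_im]; linarith

/-- The sesquilinear form `⟨x, y⟩ = φ (x* y)` of a positive functional. -/
noncomputable abbrev gnsCore (hφ : ∀ a, 0 ≤ φ (star a * a)) : PreInnerProductSpace.Core ℂ B where
  inner x y := φ (star x * y)
  conj_inner_symm x y := star_apply_of_nonneg hφ x y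
  re_inner_nonneg x := (Complex.le_def.1 (hφ x)).1
  add_left x y z := by simp [add_mul]
  smul_left x y r := by simp

theorem norm_apply_star_mul_sq_le (hφ : ∀ a, 0 ≤ φ (star a * a)) (x y : B) :
    ‖φ (star x * y)‖ ^ 2 ≤ (φ (star x * x)).re * (φ (star y * y)).re := by
  have h := @InnerProductSpace.Core.inner_mul_inner_self_le ℂ B _ _ _ (gnsCore hφ) x y
  have h2 : ‖φ (star y * x)‖ = ‖φ (star x * y)‖ := by
    rw [← star_apply_of_nonneg hφ x y, norm_star]
  change ‖φ (star x * y)‖ * ‖φ (star y * x)‖ ≤ _ at h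
  rw [h2, ← sq] at h
  exact h

theorem exists_star_mul_self_eq_sub (a : B) :
    ∃ d : B, ((‖a‖ ^ 2 : ℝ) : ℂ) • (1 : B) - star a * a = star d * d := by
  let := CStarAlgebra.spectralOrder B
  have := CStarAlgebra.spectralOrderedRing B
  have h := CStarAlgebra.star_mul_le_algebraMap_norm_sq (a := a)
  rw [← sub_nonneg, CStarAlgebra.nonneg_iff_eq_star_mul_self] at h
  obtain ⟨d, hd⟩ := h
  refine ⟨d, ?_⟩
  rw [← hd, Algebra.algebraMap_eq_smul_one, Complex.coe_smul]

/-- `‖a‖² - a*a` has the form d*d, and φ is nonnegative at (db)*(db). -/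
theorem apply_star_mul_mul_le (hφ : ∀ a, 0 ≤ φ (star a * a)) (a b : B) :
    φ (star b * (star a * a) * b) ≤ ((‖a‖ ^ 2 : ℝ) : ℂ) * φ (star b * b) := by
  obtain ⟨d, hd⟩ := exists_star_mul_self_eq_sub a
  have h := hφ (d * b)
  have h2 : star (d * b) * (d * b) =
      ((‖a‖ ^ 2 : ℝ) : ℂ) • (star b * b) - star b * (star a * a) * b := by
    rw [star_mul, mul_assoc, ← mul_assoc (star d), ← hd, sub_mul, mul_sub]
    simp only [smul_mul_assoc, one_mul, mul_smul_comm, mul_assoc]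
  rw [h2, map_sub, map_smul, smul_eq_mul] at h
  exact sub_nonneg.1 h

theorem apply_star_mul_self_le (hφ : ∀ a, 0 ≤ φ (star a * a)) (a : B) :
    φ (star a * a) ≤ ((‖a‖ ^ 2 : ℝ) : ℂ) * φ 1 := by
  simpa using apply_star_mul_mul_le hφ a 1

theorem apply_one_nonneg (hφ : ∀ a, 0 ≤ φ (star a * a)) : 0 ≤ φ 1 := by
  simpa using hφ 1

/-- Cauchy-Schwarz against 1 gives `‖φ a‖² ≤ φ(1) φ(a*a) ≤ φ(1)² ‖a‖²`. -/
theorem norm_apply_le (hφ : ∀ a, 0 ≤ φ (star a * a)) (a : B) : ‖φ a‖ ≤ (φ 1).re * ‖a‖ := by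
  have h := norm_apply_star_mul_sq_le hφ 1 a
  rw [star_one, one_mul, one_mul] at h
  have h1 := (Complex.le_def.1 (apply_one_nonneg hφ)).1
  have h2 := (Complex.le_def.1 (apply_star_mul_self_le hφ a)).1
  rw [Complex.re_ofReal_mul] at h2
  rw [Complex.zero_re] at h1
  refine abs_le_of_sq_le_sq' ?_ (by positivity) |>.2
  nlinarith

theorem eq_zero_of_apply_one (hφ : ∀ a, 0 ≤ φ (star a * a)) (h : φ 1 = 0) : φ = 0 := by
  ext a
  have := norm_apply_le hφ a
  rw [h] at this
  simpa using this

end PositiveFunctional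

/-! ### Invariant states of a group action -/

section Action

variable {B : Type*} [CStarAlgebra B] {V : Type*} [AddCommGroup V]

/-- `τ` is an action of the group `V` by endomorphisms. -/
structure IsAction (τ : V → B →⋆ₐ[ℂ] B) : Prop where
  zero : ∀ a, τ 0 a = a
  add : ∀ x y a, τ (x + y) a = τ x (τ y a)

/-- The functional `φ ∘ τ x`. -/
noncomputable def shift (τ : V → B →⋆ₐ[ℂ] B) (φ : B →ₗ[ℂ] ℂ) (x : V) : B →ₗ[ℂ] ℂ :=
  φ ∘ₗ (τ x).toAlgHom.toLinearMap

/-- The states that are invariant under the elements of `H`. -/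
def invStates (τ : V → B →⋆ₐ[ℂ] B) (H : AddSubgroup V) : Set (B →ₗ[ℂ] ℂ) :=
  {φ | ((∀ a, 0 ≤ φ (star a * a)) ∧ φ 1 = 1) ∧ ∀ x ∈ H, shift τ φ x = φ}

variable {τ : V → B →⋆ₐ[ℂ] B} {H : AddSubgroup V} {φ θ Ψ : B →ₗ[ℂ] ℂ}

@[simp] theorem shift_apply (x : V) (a : B) : shift τ φ x a = φ (τ x a) := rfl

theorem shift_zero (hτ : IsAction τ) : shift τ φ 0 = φ := by
  ext a; simp [hτ.zero]

theorem shift_shift (hτ : IsAction τ) (x y : V) :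
    shift τ (shift τ φ x) y = shift τ φ (x + y) := by
  ext a; simp [hτ.add]

theorem shift_nonneg (hφ : ∀ a, 0 ≤ φ (star a * a)) (x : V) (a : B) :
    0 ≤ shift τ φ x (star a * a) := by
  rw [shift_apply, map_mul, map_star]
  exact hφ (τ x a)

theorem shift_mem_invStates (hτ : IsAction τ) (hφ : φ ∈ invStates τ H) (x : V) :
    shift τ φ x ∈ invStates τ H := by
  refine ⟨⟨shift_nonneg hφ.1.1 x, by simp [hφ.1.2]⟩, fun y hy => ?_⟩
  rw [shift_shift hτ, add_comm, ← shift_shift hτ, hφ.2 y hy]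

theorem shift_mem_extremePoints (hτ : IsAction τ) (hφ : φ ∈ (invStates τ H).extremePoints ℝ)
    (x : V) : shift τ φ x ∈ (invStates τ H).extremePoints ℝ := by
  refine ⟨shift_mem_invStates hτ hφ.1 x, fun ψ₁ h₁ ψ₂ h₂ hseg => ?_⟩
  have h := hφ.2 (shift_mem_invStates hτ h₁ (-x)) (shift_mem_invStates hτ h₂ (-x)) ?_
  · rw [← h, shift_shift hτ, neg_add_cancel, shift_zero hτ]
  · obtain ⟨s, t, hs, ht, hst, hseg⟩ := hseg
    refine ⟨s, t, hs, ht, hst, ?_⟩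
    have : shift τ (shift τ φ x) (-x) = φ := by
      rw [shift_shift hτ, add_neg_cancel, shift_zero hτ]
    rw [← this, ← hseg]
    rfl

/-- An invariant positive functional dominated by a multiple of an extreme invariant state is a
multiple of that state. -/
theorem eq_smul_of_dominated (hθ : θ ∈ (invStates τ H).extremePoints ℝ)
    (hφ : ∀ a, 0 ≤ φ (star a * a)) (hinv : ∀ x ∈ H, shift τ φ x = φ) {c : ℝ}
    (hc : ∀ a, φ (star a * a) ≤ (c : ℂ) * θ (star a * a)) : φ = φ 1 • θ := by
  obtain ⟨⟨⟨hpos, hone⟩, hθinv⟩, hext⟩ := hθ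
  obtain ⟨t, ht⟩ : ∃ t : ℝ, φ 1 = t :=
    ⟨(φ 1).re, Complex.ext rfl (by simpa using ((Complex.le_def.1 (apply_one_nonneg hφ)).2).symm)⟩
  have ht0 : 0 ≤ t := by simpa [ht] using apply_one_nonneg hφ
  rcases ht0.eq_or_lt with h0 | h0
  · rw [ht, ← h0, Complex.ofReal_zero, zero_smul]
    exact eq_zero_of_apply_one hφ (by rw [ht, ← h0, Complex.ofReal_zero])
  -- With this C, θ is the convex combination of φ/t and (Cθ - φ)/(C - t) with weights t/C and (C -
  -- t)/C. C ≥ c makes the second functional positive, C > t makes its weight positive.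
  set C : ℝ := max c t + 1 with hC
  have htC : t < C := by have := le_max_right c t; linarith
  have hC0 : 0 < C := h0.trans htC
  have hdom : ∀ a, φ (star a * a) ≤ (C : ℂ) * θ (star a * a) := fun a =>
    (hc a).trans (mul_le_mul_of_nonneg_right
      (by exact_mod_cast (by have := le_max_left c t; linarith : c ≤ C)) (hpos a))
  have hmem₁ : ((t⁻¹ : ℝ) : ℂ) • φ ∈ invStates τ H := by
    refine ⟨⟨fun a => ?_, ?_⟩, fun x hx => ?_⟩
    · exact mul_nonneg (by exact_mod_cast (inv_nonneg.2 ht0)) (hφ a)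
    · rw [LinearMap.smul_apply, ht, smul_eq_mul, ← Complex.ofReal_mul, inv_mul_cancel₀ h0.ne',
        Complex.ofReal_one]
    · conv_rhs => rw [← hinv x hx]
      rfl
  have hmem₂ : (((C - t)⁻¹ : ℝ) : ℂ) • ((C : ℂ) • θ - φ) ∈ invStates τ H := by
    refine ⟨⟨fun a => ?_, ?_⟩, fun x hx => ?_⟩
    · exact mul_nonneg (by exact_mod_cast (inv_nonneg.2 (sub_pos.2 htC).le))
        (sub_nonneg.2 (hdom a))
    · rw [LinearMap.smul_apply, LinearMap.sub_apply, LinearMap.smul_apply, ht, hone, smul_eq_mul,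
        smul_eq_mul, mul_one, ← Complex.ofReal_sub, ← Complex.ofReal_mul,
        inv_mul_cancel₀ (sub_pos.2 htC).ne', Complex.ofReal_one]
    · conv_rhs => rw [← hinv x hx, ← hθinv x hx]
      rfl
  have h := hext hmem₁ hmem₂ ⟨t / C, (C - t) / C, div_pos h0 hC0, div_pos (sub_pos.2 htC) hC0,
    by field_simp; ring, ?_⟩
  · rw [ht, ← h, smul_smul, ← Complex.ofReal_mul, mul_inv_cancel₀ h0.ne', Complex.ofReal_one,
      one_smul]
  · ext a
    have hCC : (C : ℂ) ≠ 0 := by exact_mod_cast hC0.ne'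
    have htt : (t : ℂ) ≠ 0 := by exact_mod_cast h0.ne'
    have hCt : (C : ℂ) - t ≠ 0 := by exact_mod_cast (sub_pos.2 htC).ne'
    simp only [LinearMap.add_apply, LinearMap.smul_apply, Complex.real_smul, smul_eq_mul,
      LinearMap.sub_apply]
    push_cast
    field_simp
    ring

/-- An extreme invariant state dominates multiples of no other invariant state. -/
theorem eq_of_dominated (hθ : θ ∈ (invStates τ H).extremePoints ℝ) (hφ : φ ∈ invStates τ H)
    {c : ℝ} (hc : ∀ a, φ (star a * a) ≤ (c : ℂ) * θ (star a * a)) : φ = θ := by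
  have h := eq_smul_of_dominated hθ hφ.1.1 hφ.2 hc
  rwa [hφ.1.2, one_smul] at h

/-! ### Decomposition of an ergodic state over a subgroup of finite index -/

/-- `S` meets every coset of `H` exactly once. -/
def IsTransversal (H : AddSubgroup V) (S : Finset V) : Prop :=
  ∀ y, ∃! x, x ∈ S ∧ y - x ∈ H

/-- Such an f is a function on the quotient by H, and adding y permutes the cosets; `g` picks the
representative in S. -/
theorem IsTransversal.sum_add {S : Finset V} (hS : IsTransversal H S) {M : Type*}
    [AddCommMonoid M] {f : V → M} (hf : ∀ x, ∀ h ∈ H, f (x + h) = f x) (y : V) :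
    ∑ x ∈ S, f (x + y) = ∑ x ∈ S, f x := by
  choose g hg hgu using hS
  refine Finset.sum_bij' (fun x _ => g (x + y)) (fun x _ => g (x - y))
    (fun x _ => (hg _).1) (fun x _ => (hg _).1) ?_ ?_ ?_
  · intro x hx
    refine (hgu _ x ⟨hx, ?_⟩).symm
    have := H.neg_mem (hg (x + y)).2
    convert this using 1
    abel
  · intro x hx
    refine (hgu _ x ⟨hx, ?_⟩).symm
    have := H.neg_mem (hg (x - y)).2
    convert this using 1
    abel
  · intro x hx
    have := hf (g (x + y)) _ (hg (x + y)).2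
    rw [← this]
    congr 1
    abel

theorem IsTransversal.card_pos {S : Finset V} (hS : IsTransversal H S) : 0 < S.card := by
  obtain ⟨x, hx, -⟩ := hS 0
  exact Finset.card_pos.2 ⟨x, hx.1⟩

theorem shift_add_of_mem (hτ : IsAction τ) (hinv : ∀ x ∈ H, shift τ φ x = φ) (x h : V)
    (hh : h ∈ H) : shift τ φ (-(x + h)) = shift τ φ (-x) := by
  rw [neg_add, add_comm, ← shift_shift hτ, hinv _ (H.neg_mem hh)]

/-- If `Ψ` is ergodic for the whole group and dominates a multiple of an `H`-invariant state `φ`,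
then `Ψ` is the mean of the translates of `φ` over the cosets of `H`. -/
theorem eq_average_of_dominated (hτ : IsAction τ) {S : Finset V} (hS : IsTransversal H S)
    (hΨ : Ψ ∈ (invStates τ ⊤).extremePoints ℝ) (hφ : φ ∈ invStates τ H) {c : ℝ}
    (hc : ∀ a, φ (star a * a) ≤ (c : ℂ) * Ψ (star a * a)) :
    Ψ = (S.card : ℝ)⁻¹ • ∑ x ∈ S, shift τ φ (-x) := by
  have hS0 : (S.card : ℂ) ≠ 0 := by exact_mod_cast hS.card_pos.ne'
  have hΨinv : ∀ x, shift τ Ψ x = Ψ := fun x => hΨ.1.2 x trivial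
  have h := eq_smul_of_dominated (φ := ∑ x ∈ S, shift τ φ (-x)) (c := S.card * c) hΨ ?_ ?_ ?_
  · have h1 : (∑ x ∈ S, shift τ φ (-x)) 1 = (S.card : ℂ) := by
      simp [LinearMap.sum_apply, hφ.1.2]
    rw [h1] at h
    rw [h]
    ext a
    simp only [LinearMap.smul_apply, Complex.real_smul, smul_eq_mul]
    push_cast
    field_simp
  · intro a
    rw [LinearMap.sum_apply]
    exact Finset.sum_nonneg fun x _ => shift_nonneg hφ.1.1 _ a
  · intro y _
    -- The functional φ ∘ τ(-x) depends only on the coset of x, so composing with τ y permutes the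
    -- summands, as a shift of x by -y.
    have h1 := hS.sum_add (f := fun x => shift τ φ (-x))
      (fun x h hh => shift_add_of_mem hτ hφ.2 x h hh) (-y)
    rw [← h1]
    have h2 : shift τ (∑ x ∈ S, shift τ φ (-x)) y = ∑ x ∈ S, shift τ (shift τ φ (-x)) y := by
      ext a
      simp [LinearMap.sum_apply]
    rw [h1, h2]
    rw [← h1]
    refine Finset.sum_congr rfl fun x _ => ?_
    rw [shift_shift hτ]
    congr 1
    abel
  · intro a
    rw [LinearMap.sum_apply]
    push_cast
    rw [mul_assoc, ← nsmul_eq_mul]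
    refine Finset.sum_le_card_nsmul _ _ _ fun x _ => ?_
    have h1 := hc (τ (-x) a)
    rw [← map_star, ← map_mul, ← shift_apply, ← shift_apply (φ := Ψ), hΨinv] at h1
    exact h1

/-- Ψ is the mean of the translates of φ, all of them positive, and the representative of the coset
of 0 contributes φ itself. Whatever c was, the index thus serves as a constant; this uniformity
makes the dominated states a closed face. -/
theorem dominated_card (hτ : IsAction τ) {S : Finset V} (hS : IsTransversal H S)
    (hΨ : Ψ ∈ (invStates τ ⊤).extremePoints ℝ) (hφ : φ ∈ invStates τ H) {c : ℝ}
    (hc : ∀ a, φ (star a * a) ≤ (c : ℂ) * Ψ (star a * a)) (a : B) :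
    φ (star a * a) ≤ ((S.card : ℝ) : ℂ) * Ψ (star a * a) := by
  have hS0 : (S.card : ℂ) ≠ 0 := by exact_mod_cast hS.card_pos.ne'
  have h : ((S.card : ℝ) : ℂ) * Ψ (star a * a) =
      ∑ x ∈ S, shift τ φ (-x) (star a * a) := by
    conv_lhs => rw [eq_average_of_dominated hτ hS hΨ hφ hc]
    rw [LinearMap.smul_apply, LinearMap.sum_apply, Complex.real_smul]
    push_cast
    rw [mul_inv_cancel_left₀ hS0]
  rw [h]
  obtain ⟨x, ⟨hx, hx0⟩, -⟩ := hS 0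
  have hφx : φ (star a * a) = shift τ φ (-x) (star a * a) := by
    rw [hφ.2 (-x) (by simpa using hx0)]
  rw [hφx]
  exact Finset.single_le_sum (f := fun x => shift τ φ (-x) (star a * a))
    (fun y _ => shift_nonneg hφ.1.1 (-y) a) hx

/-- The set of `H`-invariant states dominated by a multiple of `Ψ` is compact for the topology of
pointwise convergence. -/
theorem isCompact_dominated (τ : V → B →⋆ₐ[ℂ] B) (H : AddSubgroup V) (Ψ : B →ₗ[ℂ] ℂ) (c : ℝ) :
    IsCompact ((fun φ : B →ₗ[ℂ] ℂ => (φ : B → ℂ)) ''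
      {φ | φ ∈ invStates τ H ∧ ∀ a, φ (star a * a) ≤ (c : ℂ) * Ψ (star a * a)}) := by
  -- States are contractive, so they lie in a product of closed discs, compact by Tychonoff; every
  -- defining condition is closed under pointwise limits.
  have hK : IsCompact (Set.univ.pi fun a : B => Metric.closedBall (0 : ℂ) ‖a‖) :=
    isCompact_univ_pi fun a => isCompact_closedBall 0 ‖a‖
  refine hK.of_isClosed_subset ?_ ?_
  · have hset : ((fun φ : B →ₗ[ℂ] ℂ => (φ : B → ℂ)) ''
        {φ | φ ∈ invStates τ H ∧ ∀ a, φ (star a * a) ≤ (c : ℂ) * Ψ (star a * a)}) =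
        {f : B → ℂ | ((∀ a b, f (a + b) = f a + f b) ∧ (∀ (r : ℂ) a, f (r • a) = r • f a)) ∧
          (((∀ a, 0 ≤ f (star a * a)) ∧ f 1 = 1) ∧ ∀ x ∈ H, ∀ a, f (τ x a) = f a) ∧
          ∀ a, f (star a * a) ≤ (c : ℂ) * Ψ (star a * a)} := by
      ext f
      constructor
      · rintro ⟨φ, ⟨⟨h1, h2⟩, h3⟩, rfl⟩
        exact ⟨⟨map_add φ, map_smul φ⟩, ⟨h1, fun x hx a => LinearMap.congr_fun (h2 x hx) a⟩, h3⟩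
      · rintro ⟨⟨h1, h2⟩, ⟨h3, h4⟩, h5⟩
        exact ⟨⟨⟨f, h1⟩, h2⟩, ⟨⟨h3, fun x hx => LinearMap.ext (h4 x hx)⟩, h5⟩, rfl⟩
    rw [hset]
    simp only [Set.ofPred_and, Set.ofPred_forall]
    have hc (a : B) : Continuous fun f : B → ℂ => f a := continuous_apply a
    refine ((isClosed_iInter fun a => isClosed_iInter fun b =>
        isClosed_eq (hc _) ((hc _).add (hc _))).inter
      (isClosed_iInter fun r => isClosed_iInter fun a =>
        isClosed_eq (hc _) ((hc _).const_smul r))).inter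
      ((((isClosed_iInter fun a => isClosed_le continuous_const (hc _)).inter
        (isClosed_eq (hc _) continuous_const)).inter
        (isClosed_iInter fun x => isClosed_iInter fun _ => isClosed_iInter fun a =>
          isClosed_eq (hc _) (hc _))).inter
        (isClosed_iInter fun a => isClosed_le (hc _) continuous_const))
  · rintro _ ⟨φ, ⟨⟨⟨h1, h2⟩, -⟩, -⟩, rfl⟩ a -
    have := norm_apply_le h1 a
    simpa [h2] using this

/-- A state which is ergodic for the whole group dominates a multiple of an extreme `H`-invariant
state, for every subgroup `H` of finite index. -/
theorem exists_extreme_dominated (hτ : IsAction τ) {S : Finset V} (hS : IsTransversal H S)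
    (hΨ : Ψ ∈ (invStates τ ⊤).extremePoints ℝ) :
    ∃ φ ∈ (invStates τ H).extremePoints ℝ,
      ∀ a, φ (star a * a) ≤ ((S.card : ℝ) : ℂ) * Ψ (star a * a) := by
  have hΨH : Ψ ∈ invStates τ H := ⟨hΨ.1.1, fun x _ => hΨ.1.2 x trivial⟩
  have hcomp := isCompact_dominated τ H Ψ S.card
  obtain ⟨f, hf⟩ := hcomp.extremePoints_nonempty ⟨_, Ψ, ⟨hΨH,
    fun a => dominated_card hτ hS hΨ hΨH (c := 1) (fun a => by simp) a⟩, rfl⟩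
  obtain ⟨⟨φ, ⟨hφ, hdom⟩, rfl⟩, hext⟩ := hf
  refine ⟨φ, ⟨hφ, fun ψ₁ h₁ ψ₂ h₂ hseg => ?_⟩, hdom⟩
  -- The face property: a component of φ of weight s is dominated with constant card/s, and
  -- `dominated_card` restores card. So a point extreme among the dominated states is extreme among
  -- all invariant states.
  have key : ∀ ψ ∈ invStates τ H, ∀ ψ' ∈ invStates τ H, ∀ s t : ℝ, 0 < s → 0 < t →
      s • ψ + t • ψ' = φ → ∀ a, ψ (star a * a) ≤ ((S.card : ℝ) : ℂ) * Ψ (star a * a) := by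
    intro ψ hψ ψ' hψ' s t hs ht h
    refine dominated_card hτ hS hΨ hψ (c := s⁻¹ * S.card) fun a => ?_
    have h1 := hdom a
    rw [← h, LinearMap.add_apply, LinearMap.smul_apply, LinearMap.smul_apply, Complex.real_smul,
      Complex.real_smul] at h1
    have h2 : (s : ℂ) * ψ (star a * a) ≤ ((S.card : ℝ) : ℂ) * Ψ (star a * a) :=
      (le_add_of_nonneg_right
        (mul_nonneg (by exact_mod_cast ht.le) (hψ'.1.1 a))).trans h1
    have hs' : (s : ℂ) ≠ 0 := by exact_mod_cast hs.ne'
    have h3 := mul_le_mul_of_nonneg_left h2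
      (by exact_mod_cast (inv_nonneg.2 hs.le) : (0 : ℂ) ≤ ((s⁻¹ : ℝ) : ℂ))
    push_cast at h3 ⊢
    rwa [inv_mul_cancel_left₀ hs', ← mul_assoc] at h3
  obtain ⟨s, t, hs, ht, hst, hseg⟩ := hseg
  have h := hext (x₁ := ψ₁) ⟨ψ₁, ⟨h₁, key ψ₁ h₁ ψ₂ h₂ s t hs ht hseg⟩, rfl⟩
    (x₂ := ψ₂) ⟨ψ₂, ⟨h₂, key ψ₂ h₂ ψ₁ h₁ t s ht hs (by rw [add_comm]; exact hseg)⟩, rfl⟩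
    ⟨s, t, hs, ht, hst, by rw [← hseg]; rfl⟩
  exact DFunLike.coe_injective h

end Action

/-! ### Means over Følner sequences -/

section Mean

variable {B : Type*} [CStarAlgebra B] {V : Type*} [AddCommGroup V]

/-- A sequence of finite subsets of `H` whose cardinalities tend to infinity and which are
asymptotically invariant under the translations in `H`. -/
structure IsFolner (H : AddSubgroup V) (F : ℕ → Finset V) [DecidableEq V] : Prop where
  nonempty : ∀ n, (F n).Nonempty
  subset : ∀ n, ∀ x ∈ F n, x ∈ H
  card : Tendsto (fun n => (F n).card) atTop atTop
  sdiff : ∀ y ∈ H, Tendsto (fun n =>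
    ((((F n).map (Equiv.addRight y).toEmbedding) \ F n).card : ℝ) / (F n).card) atTop (𝓝 0)

/-- The mean of `τ x` over `x ∈ S`. -/
noncomputable def mean (τ : V → B →⋆ₐ[ℂ] B) (S : Finset V) : B →ₗ[ℂ] B :=
  (S.card : ℂ)⁻¹ • ∑ x ∈ S, (τ x).toAlgHom.toLinearMap

/-- The commutators of `τ x a` and `b` tend to `0` as `x` tends to infinity. -/
def IsAsymptoticallyAbelian (τ : V → B →⋆ₐ[ℂ] B) : Prop :=
  ∀ a b, Tendsto (fun x => ‖τ x a * b - b * τ x a‖) cofinite (𝓝 0)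

variable {τ : V → B →⋆ₐ[ℂ] B} {H : AddSubgroup V} {φ θ : B →ₗ[ℂ] ℂ} {S : Finset V}

theorem mean_apply (a : B) : mean τ S a = (S.card : ℂ)⁻¹ • ∑ x ∈ S, τ x a := by
  simp [mean]

theorem norm_action_le (x : V) (a : B) : ‖τ x a‖ ≤ ‖a‖ :=
  NonUnitalStarAlgHom.norm_apply_le (τ x) a

theorem norm_mean_le (a : B) : ‖mean τ S a‖ ≤ ‖a‖ := by
  rw [mean_apply, norm_smul, norm_inv, Complex.norm_natCast]
  rcases S.eq_empty_or_nonempty with rfl | hS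
  · simp
  have h : ‖∑ x ∈ S, τ x a‖ ≤ S.card • ‖a‖ := norm_sum_le_of_le _ (fun x _ => norm_action_le x a)
    |>.trans (by simp)
  have : (0 : ℝ) < S.card := by exact_mod_cast hS.card_pos
  rw [inv_mul_le_iff₀ this]
  simpa using h

theorem apply_mean (hinv : ∀ x ∈ H, shift τ φ x = φ) (hne : S.Nonempty) (hS : ∀ x ∈ S, x ∈ H)
    (a : B) : φ (mean τ S a) = φ a := by
  have h : ∀ x ∈ S, φ (τ x a) = φ a := fun x hx => LinearMap.congr_fun (hinv x (hS x hx)) a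
  rw [mean_apply, map_smul, map_sum, Finset.sum_congr rfl h]
  have : (S.card : ℂ) ≠ 0 := by exact_mod_cast hne.card_pos.ne'
  simp [this]

theorem action_mean (hτ : IsAction τ) (y : V) (a : B) :
    τ y (mean τ S a) = mean τ S (τ y a) := by
  simp only [mean_apply, map_smul, map_sum, ← hτ.add, add_comm]

theorem mean_one (hne : S.Nonempty) : mean τ S 1 = 1 := by
  have : (S.card : ℂ) ≠ 0 := by exact_mod_cast hne.card_pos.ne'
  simp [mean_apply, ← Nat.cast_smul_eq_nsmul ℂ, smul_smul, this]

theorem norm_apply_le_of_state (hφ : φ ∈ invStates τ H) (a : B) : ‖φ a‖ ≤ ‖a‖ := by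
  simpa [hφ.1.2] using norm_apply_le hφ.1.1 a

variable [DecidableEq V] {F : ℕ → Finset V}

/-- The two sums run over F n + y and F n. They differ only on the two set differences, which have
equal size, and this size is negligible by the Følner condition. -/
theorem tendsto_mean_action (hτ : IsAction τ) (hF : IsFolner H F) {y : V} (hy : y ∈ H) (a : B) :
    Tendsto (fun n => ‖mean τ (F n) (τ y a) - mean τ (F n) a‖) atTop (𝓝 0) := by
  have hlim := (hF.sdiff y hy).const_mul (2 * ‖a‖)
  rw [mul_zero] at hlim
  refine squeeze_zero (fun _ => norm_nonneg _) (fun n => ?_) hlim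
  set F' := (F n).map (Equiv.addRight y).toEmbedding with hF'
  have h1 : ∑ x ∈ F n, τ x (τ y a) = ∑ x ∈ F', τ x a := by
    simp [hF', hτ.add]
  have hcard : (F n \ F').card = (F' \ F n).card :=
    Finset.card_sdiff_comm (by simp [hF'])
  have hbound : ∀ T : Finset V, ‖∑ x ∈ T, τ x a‖ ≤ T.card * ‖a‖ := fun T =>
    (norm_sum_le_of_le _ fun x _ => norm_action_le x a).trans (by simp)
  have h2 : ‖∑ x ∈ F', τ x a - ∑ x ∈ F n, τ x a‖ ≤ 2 * ‖a‖ * (F' \ F n).card := by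
    rw [← Finset.sum_sdiff_sub_sum_sdiff]
    refine (norm_sub_le _ _).trans ((add_le_add (hbound _) (hbound _)).trans ?_)
    rw [hcard]
    linarith
  have hpos : (0 : ℝ) < (F n).card := by exact_mod_cast (hF.nonempty n).card_pos
  rw [mean_apply, mean_apply, ← smul_sub, norm_smul, norm_inv, Complex.norm_natCast, h1,
    inv_mul_le_iff₀ hpos]
  refine h2.trans (le_of_eq ?_)
  field_simp

/-- A Cesàro argument: outside a finite set T of group elements the commutators are below ε/2, and
the bounded contribution of T is diluted because the cardinality of F n tends to infinity. -/
theorem tendsto_commutator_mean (hab : IsAsymptoticallyAbelian τ) (hF : IsFolner H F) (a b : B) :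
    Tendsto (fun n => ‖mean τ (F n) a * b - b * mean τ (F n) a‖) atTop (𝓝 0) := by
  rw [Metric.tendsto_atTop]
  intro ε hε
  have h1 := (hab a b).eventually (gt_mem_nhds (half_pos hε))
  rw [eventually_cofinite] at h1
  set T : Finset V := h1.toFinset with hT
  have h2 : Tendsto (fun n => (T.card * (2 * ‖a‖ * ‖b‖) : ℝ) / (F n).card) atTop (𝓝 0) :=
    (tendsto_natCast_atTop_atTop.comp hF.card).const_div_atTop _
  obtain ⟨N, hN⟩ := eventually_atTop.1 (h2.eventually (gt_mem_nhds (half_pos hε)))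
  refine ⟨N, fun n hn => ?_⟩
  rw [Real.dist_eq, sub_zero, abs_of_nonneg (norm_nonneg _)]
  have hpos : (0 : ℝ) < (F n).card := by exact_mod_cast (hF.nonempty n).card_pos
  have h3 : mean τ (F n) a * b - b * mean τ (F n) a =
      ((F n).card : ℂ)⁻¹ • ∑ x ∈ F n, (τ x a * b - b * τ x a) := by
    rw [mean_apply, smul_mul_assoc, mul_smul_comm, ← smul_sub, Finset.sum_mul, Finset.mul_sum,
      Finset.sum_sub_distrib]
  have hle : ∀ x, ‖τ x a * b - b * τ x a‖ ≤ 2 * ‖a‖ * ‖b‖ := fun x => by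
    refine (norm_sub_le _ _).trans ?_
    have e1 := (norm_mul_le (τ x a) b).trans
      (mul_le_mul_of_nonneg_right (norm_action_le x a) (norm_nonneg b))
    have e2 := (norm_mul_le b (τ x a)).trans
      (mul_le_mul_of_nonneg_left (norm_action_le x a) (norm_nonneg b))
    linarith
  have h4 : ∑ x ∈ F n, ‖τ x a * b - b * τ x a‖ ≤
      T.card * (2 * ‖a‖ * ‖b‖) + (F n).card * (ε / 2) := by
    calc ∑ x ∈ F n, ‖τ x a * b - b * τ x a‖
        ≤ ∑ x ∈ F n, ((if x ∈ T then 2 * ‖a‖ * ‖b‖ else 0) + ε / 2) := by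
          refine Finset.sum_le_sum fun x _ => ?_
          split_ifs with hx
          · linarith [hle x]
          · have : ‖τ x a * b - b * τ x a‖ < ε / 2 := by simpa [hT] using hx
            linarith
      _ = ((F n).filter (· ∈ T)).card * (2 * ‖a‖ * ‖b‖) + (F n).card * (ε / 2) := by
          rw [Finset.sum_add_distrib, ← Finset.sum_filter]
          simp
      _ ≤ _ := by
          gcongr
          intro x hx
          exact (Finset.mem_filter.1 hx).2
  have h5 := hN n hn
  rw [div_lt_iff₀ hpos] at h5
  rw [h3, norm_smul, norm_inv, Complex.norm_natCast, inv_mul_lt_iff₀ hpos]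
  refine (norm_sum_le _ _).trans_lt (h4.trans_lt ?_)
  linarith

theorem tendsto_apply_of_norm_sub (hφ : φ ∈ invStates τ H) {u v : ℕ → B} {l : Filter ℕ}
    (h : Tendsto (fun n => ‖u n - v n‖) l (𝓝 0)) {z : ℂ}
    (hv : Tendsto (fun n => φ (v n)) l (𝓝 z)) : Tendsto (fun n => φ (u n)) l (𝓝 z) := by
  have h1 : Tendsto (fun n => φ (u n - v n)) l (𝓝 0) :=
    squeeze_zero_norm (fun n => norm_apply_le_of_state hφ _) h
  simpa using h1.add hv

/-- Extreme invariant states of an asymptotically abelian action are weakly mixing in the mean. -/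
theorem tendsto_apply_mul_mean (hτ : IsAction τ) (hab : IsAsymptoticallyAbelian τ)
    (hF : IsFolner H F) (hθ : θ ∈ (invStates τ H).extremePoints ℝ) (a b : B) :
    Tendsto (fun n => θ (b * mean τ (F n) a)) atTop (𝓝 (θ b * θ a)) := by
  let := CStarAlgebra.spectralOrder B
  have := CStarAlgebra.spectralOrderedRing B
  have hst := hθ.1
  -- Positive elements span the algebra and the claim is linear in a, so a = c*c may be assumed.
  have hspan : a ∈ Submodule.span ℂ {a : B | 0 ≤ a} := by
    rw [CStarAlgebra.span_nonneg]; exact Submodule.mem_top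
  induction hspan using Submodule.span_induction with
  | zero => simp
  | add x y _ _ hx hy => simpa [mul_add] using hx.add hy
  | smul r x _ hx => simpa [mul_left_comm] using hx.const_mul r
  | mem a ha' =>
    obtain ⟨c, ha⟩ := CStarAlgebra.nonneg_iff_eq_star_mul_self.1 (Set.mem_ofPred.1 ha')
    rw [tendsto_iff_ultrafilter]
    intro U hU
    -- Along an ultrafilter the bounded sequence has a limit for each b. These limits form a
    -- functional φ of b, to be identified as θ(a) θ by extremality of θ.
    have hex : ∀ b, ∃ z, Tendsto (fun n => θ (b * mean τ (F n) a)) U (𝓝 z) := by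
      intro b
      have hK := isCompact_closedBall (0 : ℂ) (‖b‖ * ‖a‖)
      obtain ⟨z, -, hz⟩ := hK.ultrafilter_le_nhds
        (U.map fun n => θ (b * mean τ (F n) a)) (by
          rw [le_principal_iff, Ultrafilter.mem_coe, Ultrafilter.mem_map]
          refine Filter.univ_mem' fun n => ?_
          simp only [Set.mem_preimage, mem_closedBall_zero_iff]
          refine (norm_apply_le_of_state hst _).trans ((norm_mul_le _ _).trans ?_)
          gcongr
          exact norm_mean_le a)
      exact ⟨z, hz⟩
    choose f hf using hex
    let φ : B →ₗ[ℂ] ℂ :=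
      { toFun := f
        map_add' := fun x y => tendsto_nhds_unique (hf (x + y))
          (by simpa [add_mul] using (hf x).add (hf y))
        map_smul' := fun r x => tendsto_nhds_unique (hf (r • x))
          (by simpa using (hf x).const_mul r) }
    -- Asymptotic commutativity moves the mean between b* and b, where positivity and the bound by
    -- ‖c‖² θ(b*b) can be read off term by term.
    have hconj : ∀ b, Tendsto (fun n => θ (star b * mean τ (F n) a * b)) U
        (𝓝 (φ (star b * b))) := by
      intro b
      refine tendsto_apply_of_norm_sub hst (v := fun n => star b * b * mean τ (F n) a) ?_ (hf _)
      have h1 := ((tendsto_commutator_mean hab hF a b).mono_left hU).const_mul ‖b‖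
      rw [mul_zero] at h1
      refine squeeze_zero (fun _ => norm_nonneg _) (fun n => ?_) h1
      rw [mul_assoc, mul_assoc, ← mul_sub]
      refine (norm_mul_le _ _).trans ?_
      rw [norm_star]
    have hterm : ∀ b n, star b * mean τ (F n) a * b =
        ((F n).card : ℂ)⁻¹ • ∑ x ∈ F n, star b * (star (τ x c) * τ x c) * b := by
      intro b n
      rw [mean_apply, mul_smul_comm, smul_mul_assoc, Finset.mul_sum, Finset.sum_mul]
      simp only [ha, map_mul, map_star]
    have hpos : ∀ b, 0 ≤ φ (star b * b) := by
      intro b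
      refine ge_of_tendsto (hconj b) (Eventually.of_forall fun n => ?_)
      rw [hterm, map_smul, map_sum, smul_eq_mul]
      refine mul_nonneg (by positivity) (Finset.sum_nonneg fun x _ => ?_)
      have := hst.1.1 (τ x c * b)
      rwa [star_mul, mul_assoc, ← mul_assoc (star (τ x c)), ← mul_assoc] at this
    have hle : ∀ b, φ (star b * b) ≤ ((‖c‖ ^ 2 : ℝ) : ℂ) * θ (star b * b) := by
      intro b
      refine le_of_tendsto (hconj b) (Eventually.of_forall fun n => ?_)
      have hn : ((F n).card : ℂ) ≠ 0 := by exact_mod_cast (hF.nonempty n).card_pos.ne'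
      rw [hterm, map_smul, map_sum, smul_eq_mul]
      have h1 : ∑ x ∈ F n, θ (star b * (star (τ x c) * τ x c) * b) ≤
          (F n).card • (((‖c‖ ^ 2 : ℝ) : ℂ) * θ (star b * b)) := by
        refine Finset.sum_le_card_nsmul _ _ _ fun x _ => ?_
        refine (apply_star_mul_mul_le hst.1.1 (τ x c) b).trans
          (mul_le_mul_of_nonneg_right ?_ (hst.1.1 b))
        have := norm_action_le (τ := τ) x c
        exact_mod_cast (by gcongr : ‖τ x c‖ ^ 2 ≤ ‖c‖ ^ 2)
      refine (mul_le_mul_of_nonneg_left h1 (by positivity)).trans (le_of_eq ?_)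
      rw [nsmul_eq_mul, inv_mul_cancel_left₀ hn]
    -- The Følner property replaces the mean of a by the mean of τ y a; then τ y factors out of the
    -- product and is absorbed by θ.
    have hinv : ∀ y ∈ H, shift τ φ y = φ := by
      intro y hy
      ext b
      refine tendsto_nhds_unique (hf (τ y b)) ?_
      refine tendsto_apply_of_norm_sub hst (v := fun n => τ y (b * mean τ (F n) a)) ?_ ?_
      · have h1 := ((tendsto_mean_action hτ hF hy a).mono_left hU).const_mul ‖b‖
        rw [mul_zero] at h1
        refine squeeze_zero (fun _ => norm_nonneg _) (fun n => ?_) h1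
        rw [map_mul (τ y) b, ← mul_sub, action_mean hτ]
        refine (norm_mul_le _ _).trans ?_
        rw [norm_sub_rev]
        gcongr
        exact norm_action_le y b
      · have h1 : ∀ n, θ (τ y (b * mean τ (F n) a)) = θ (b * mean τ (F n) a) := fun n =>
          LinearMap.congr_fun (hst.2 y hy) _
        simp only [h1]
        exact hf b
    have hφ := eq_smul_of_dominated hθ hpos hinv hle
    have h1 : φ 1 = θ a := by
      refine tendsto_nhds_unique (hf 1) ?_
      simp only [one_mul, apply_mean hst.2 (hF.nonempty _) (hF.subset _)]
      exact tendsto_const_nhds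
    have h2 : f b = θ b * θ a := by
      have := LinearMap.congr_fun hφ b
      rw [h1] at this
      exact this.trans (mul_comm _ _)
    rw [← h2]
    exact hf b

theorem two_re_apply_le (hφ : ∀ a, 0 ≤ φ (star a * a)) (x y : B) :
    2 * (φ (star x * y)).re ≤ (φ (star x * x)).re + (φ (star y * y)).re ∧
      (φ (star (x + y) * (x + y))).re =
        (φ (star x * x)).re + (φ (star y * y)).re + 2 * (φ (star x * y)).re := by
  have h1 : (φ (star y * x)).re = (φ (star x * y)).re := by
    rw [← star_apply_of_nonneg hφ x y]; simp
  have h2 := (Complex.le_def.1 (hφ (x - y))).1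
  simp only [star_sub, sub_mul, mul_sub, map_sub, Complex.sub_re, Complex.zero_re] at h2
  simp only [star_add, add_mul, mul_add, map_add, Complex.add_re]
  constructor <;> linarith

/-- An average of isometries is a contraction. Indeed `⟨m, m⟩` is the average of `Re ⟨m, τ x a⟩`,
and each term is at most half of `⟨m, m⟩ + ⟨a, a⟩`. -/
theorem re_apply_mean_le (hφ : φ ∈ invStates τ H) (hne : S.Nonempty) (hS : ∀ x ∈ S, x ∈ H)
    (a : B) : (φ (star (mean τ S a) * mean τ S a)).re ≤ (φ (star a * a)).re := by
  set m := mean τ S a with hm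
  have hpos : (0 : ℝ) < S.card := by exact_mod_cast hne.card_pos
  have h1 : (φ (star m * m)).re = (S.card : ℝ)⁻¹ * ∑ x ∈ S, (φ (star m * τ x a)).re := by
    conv_lhs => rw [hm, mean_apply, mul_smul_comm, map_smul, ← mean_apply, ← hm, Finset.mul_sum,
      map_sum, smul_eq_mul]
    have : ((S.card : ℂ))⁻¹ = (((S.card : ℝ)⁻¹ : ℝ) : ℂ) := by push_cast; rfl
    rw [this, Complex.re_ofReal_mul, Complex.re_sum]
  have h2 : ∑ x ∈ S, (φ (star m * τ x a)).re ≤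
      S.card • (((φ (star m * m)).re + (φ (star a * a)).re) / 2) := by
    refine Finset.sum_le_card_nsmul _ _ _ fun x hx => ?_
    have h3 := (two_re_apply_le hφ.1.1 m (τ x a)).1
    have h4 : φ (star (τ x a) * τ x a) = φ (star a * a) := by
      rw [← map_star, ← map_mul]
      exact LinearMap.congr_fun (hφ.2 x (hS x hx)) _
    rw [h4] at h3
    linarith
  have h3 := h1.le.trans (mul_le_mul_of_nonneg_left h2 (by positivity))
  rw [nsmul_eq_mul, inv_mul_cancel_left₀ hpos.ne'] at h3
  linarith

/-- The mean ergodic theorem for extreme invariant states of an asymptotically abelian action. -/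
theorem tendsto_apply_mean_sq (hτ : IsAction τ) (hab : IsAsymptoticallyAbelian τ)
    (hF : IsFolner H F) (hθ : θ ∈ (invStates τ H).extremePoints ℝ) {a : B} (ha : θ a = 0) :
    Tendsto (fun n => (θ (star (mean τ (F n) a) * mean τ (F n) a)).re) atTop (𝓝 0) := by
  have hst := hθ.1
  set q : B → ℝ := fun b => (θ (star b * b)).re with hq
  have hq0 : ∀ b, 0 ≤ q b := fun b => (Complex.le_def.1 (hst.1.1 b)).1
  -- As in von Neumann's ergodic theorem, the seminorm is minimized over the convex hull K of the
  -- orbit. Both the means and the condition θ = 0 are compatible with K.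
  set K : Set B := convexHull ℝ ((fun x => τ x a) '' (H : Set V)) with hK
  have hKconv : Convex ℝ K := convex_convexHull ℝ _
  have hKτ : ∀ y ∈ H, ∀ b ∈ K, τ y b ∈ K := by
    intro y hy b hb
    have hconv : Convex ℝ {b | τ y b ∈ K} := by
      intro u hu v hv s t hs ht hst
      have := hKconv hu hv hs ht hst
      simpa only [Set.mem_ofPred_eq, map_add, ← Complex.coe_smul, map_smul] using this
    refine convexHull_min ?_ hconv hb
    rintro _ ⟨x, hx, rfl⟩
    exact subset_convexHull ℝ _ ⟨y + x, H.add_mem hy hx, hτ.add y x a⟩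
  have hKmean : ∀ n, ∀ b ∈ K, mean τ (F n) b ∈ K := by
    intro n b hb
    have hn : ((F n).card : ℝ) ≠ 0 := by exact_mod_cast (hF.nonempty n).card_pos.ne'
    have := hKconv.sum_mem (t := F n) (w := fun _ => ((F n).card : ℝ)⁻¹) (z := fun x => τ x b)
      (fun _ _ => by positivity) (by simp [hn]) (fun x hx => hKτ x (hF.subset n x hx) b hb)
    rw [mean_apply, Finset.smul_sum]
    convert this using 2 with x
    rw [← Complex.coe_smul]
    push_cast
    rfl
  have hK0 : ∀ b ∈ K, θ b = 0 := by
    intro b hb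
    have hconv : Convex ℝ {b | θ b = 0} := by
      intro u hu v hv s t _ _ _
      simp only [Set.mem_ofPred_eq] at hu hv
      simp only [Set.mem_ofPred_eq, map_add, ← Complex.coe_smul, map_smul, hu, hv, smul_zero,
        add_zero]
    refine convexHull_min ?_ hconv hb
    rintro _ ⟨x, hx, rfl⟩
    exact (LinearMap.congr_fun (hst.2 x hx) a).trans ha
  have hKa : a ∈ K := subset_convexHull ℝ _ ⟨0, H.zero_mem, hτ.zero a⟩
  have hbdd : BddBelow (q '' K) := ⟨0, by rintro _ ⟨b, -, rfl⟩; exact hq0 b⟩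
  have hinf : sInf (q '' K) ≤ 0 := by
    refine le_of_forall_pos_le_add fun ε hε => ?_
    obtain ⟨_, ⟨b, hb, rfl⟩, hbε⟩ :=
      exists_lt_of_csInf_lt ((Set.nonempty_of_mem hKa).image q)
        (lt_add_of_pos_right (sInf (q '' K)) hε)
    -- The midpoint of b and its mean again lies in K, and weak mixing kills the cross term θ(b* M_n
    -- b). So 4 inf q ≤ 2 q(b) < 2 inf q + 2ε, which forces inf q ≤ ε.
    have hlim : Tendsto (fun n => 2 * q b + 2 * (θ (star b * mean τ (F n) b)).re) atTop
        (𝓝 (2 * q b + 2 * 0)) := by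
      refine ((Tendsto.const_mul _ ?_)).const_add _
      have h1 := tendsto_apply_mul_mean hτ hab hF hθ b (star b)
      rw [hK0 b hb, mul_zero] at h1
      exact (Complex.continuous_re.tendsto 0).comp h1
    have h4 : 4 * sInf (q '' K) ≤ 2 * q b + 2 * 0 := by
      refine ge_of_tendsto hlim (Eventually.of_forall fun n => ?_)
      set m := mean τ (F n) b with hm
      have h1 : ((1 / 2 : ℝ) • b + (1 / 2 : ℝ) • m) ∈ K :=
        hKconv hb (hKmean n b hb) (by norm_num) (by norm_num) (by norm_num)
      have h2 := csInf_le hbdd ⟨_, h1, rfl⟩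
      have h3 : q ((1 / 2 : ℝ) • b + (1 / 2 : ℝ) • m) = (1 / 4) * q (b + m) := by
        have e1 : ((1 / 2 : ℝ) • b + (1 / 2 : ℝ) • m) = ((1 / 2 : ℝ) : ℂ) • (b + m) := by
          rw [Complex.coe_smul, smul_add]
        simp only [hq, e1, star_smul, smul_mul_assoc, mul_smul_comm, map_smul, smul_eq_mul]
        rw [Complex.star_def, Complex.conj_ofReal, Complex.re_ofReal_mul, Complex.re_ofReal_mul]
        ring
      have h5 := (two_re_apply_le hst.1.1 b m).2
      have h6 : q m ≤ q b := re_apply_mean_le hst (hF.nonempty n) (hF.subset n) b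
      simp only [hq] at h2 h3 h6 ⊢
      linarith
    linarith
  rw [Metric.tendsto_atTop]
  intro ε hε
  obtain ⟨_, ⟨b, hb, rfl⟩, hbε⟩ :=
    exists_lt_of_csInf_lt ((Set.nonempty_of_mem hKa).image q)
      (lt_of_le_of_lt hinf (by positivity : (0 : ℝ) < ε / 4))
  -- Every b in K has asymptotically the same means as a: this holds on the orbit and passes to
  -- convex combinations. Then q(M_n a) is at most 2‖M_n a - M_n b‖² + 2 q(b), each part being below
  -- ε/2.
  have hclose : Tendsto (fun n => ‖mean τ (F n) b - mean τ (F n) a‖) atTop (𝓝 0) := by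
    have hconv : Convex ℝ
        {b | Tendsto (fun n => ‖mean τ (F n) b - mean τ (F n) a‖) atTop (𝓝 0)} := by
      intro u hu v hv s t hs ht hst
      have h1 := (hu.const_mul s).add (hv.const_mul t)
      rw [mul_zero, mul_zero, add_zero] at h1
      refine squeeze_zero (fun _ => norm_nonneg _) (fun n => ?_) h1
      have h2 : mean τ (F n) (s • u + t • v) - mean τ (F n) a =
          s • (mean τ (F n) u - mean τ (F n) a) + t • (mean τ (F n) v - mean τ (F n) a) := by
        conv_lhs => rw [← one_smul ℝ (mean τ (F n) a), ← hst]
        rw [map_add, ← Complex.coe_smul, ← Complex.coe_smul t, map_smul, map_smul,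
          Complex.coe_smul, Complex.coe_smul, add_smul, smul_sub, smul_sub]
        abel
      rw [h2]
      refine (norm_add_le _ _).trans ?_
      rw [norm_smul, norm_smul, Real.norm_of_nonneg hs, Real.norm_of_nonneg ht]
    refine convexHull_min ?_ hconv hb
    rintro _ ⟨x, hx, rfl⟩
    exact tendsto_mean_action hτ hF hx a
  have hsq := (hclose.pow 2).const_mul 2
  rw [zero_pow two_ne_zero, mul_zero] at hsq
  obtain ⟨N, hN⟩ := eventually_atTop.1 (hsq.eventually (gt_mem_nhds (half_pos hε)))
  refine ⟨N, fun n hn => ?_⟩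
  rw [Real.dist_eq, sub_zero, abs_of_nonneg (hq0 _)]
  have h1 := hN n hn
  set u := mean τ (F n) b
  set v := mean τ (F n) a
  have h2 : q (v - u) ≤ ‖u - v‖ ^ 2 := by
    have h3 := (Complex.le_def.1 (apply_star_mul_self_le hst.1.1 (v - u))).1
    rw [hst.1.2, mul_one, Complex.ofReal_re, norm_sub_rev] at h3
    exact h3
  have h4 : q u ≤ q b := re_apply_mean_le hst (hF.nonempty n) (hF.subset n) b
  have h5 := two_re_apply_le hst.1.1 (v - u) u
  rw [sub_add_cancel] at h5
  simp only [hq] at hbε h2 h4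
  linarith [h5.1, h5.2]

/-- Products of factors `M_n a - z`, where `M_n` is the mean over `F n`. -/
noncomputable def meanProd (τ : V → B →⋆ₐ[ℂ] B) (S : Finset V) : List (B × ℂ) → B
  | [] => 1
  | (a, z) :: L => meanProd τ S L * (mean τ S a - z • 1)

theorem exists_norm_meanProd_le (τ : V → B →⋆ₐ[ℂ] B) (L : List (B × ℂ)) :
    ∃ C : ℝ, 0 ≤ C ∧ ∀ S : Finset V, ‖meanProd τ S L‖ ≤ C := by
  induction L with
  | nil => exact ⟨‖(1 : B)‖, norm_nonneg _, fun S => le_rfl⟩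
  | cons p L ih =>
    obtain ⟨C, hC, h⟩ := ih
    refine ⟨C * (‖p.1‖ + ‖p.2 • (1 : B)‖), by positivity, fun S => ?_⟩
    refine (norm_mul_le _ _).trans ?_
    gcongr
    · exact h S
    · refine (norm_sub_le _ _).trans ?_
      gcongr
      exact norm_mean_le _

/-- By Cauchy-Schwarz and `tendsto_apply_mean_sq`, the mean in the last factor may be replaced by
the scalar θ(a): the factors to its left are bounded in norm uniformly in n. This peels off one
factor at a time. -/
theorem tendsto_apply_meanProd (hτ : IsAction τ) (hab : IsAsymptoticallyAbelian τ)
    (hF : IsFolner H F) (hθ : θ ∈ (invStates τ H).extremePoints ℝ) (L : List (B × ℂ)) :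
    Tendsto (fun n => θ (meanProd τ (F n) L)) atTop (𝓝 (L.map fun p => θ p.1 - p.2).prod) := by
  have hst := hθ.1
  induction L with
  | nil => simp [meanProd, hst.1.2]
  | cons p L ih =>
    obtain ⟨a, z⟩ := p
    obtain ⟨C, hC, hL⟩ := exists_norm_meanProd_le τ L
    set a₀ := a - θ a • (1 : B) with ha₀
    have h0 : θ a₀ = 0 := by simp [ha₀, hst.1.2]
    have h1 := tendsto_apply_mean_sq hτ hab hF hθ h0
    have h2 : Tendsto (fun n => θ (meanProd τ (F n) L * mean τ (F n) a₀)) atTop (𝓝 0) := by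
      have h3 := (Real.continuous_sqrt.tendsto 0).comp (h1.const_mul (C ^ 2) |>.trans (by simp))
      rw [Real.sqrt_zero] at h3
      refine squeeze_zero_norm (fun n => ?_) h3
      refine Real.le_sqrt_of_sq_le ?_
      have h4 := norm_apply_star_mul_sq_le hst.1.1 (star (meanProd τ (F n) L)) (mean τ (F n) a₀)
      rw [star_star] at h4
      refine h4.trans ?_
      have h5 := (Complex.le_def.1
        (apply_star_mul_self_le hst.1.1 (star (meanProd τ (F n) L)))).1
      rw [hst.1.2, mul_one, Complex.ofReal_re, norm_star, star_star] at h5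
      have h6 : 0 ≤ (θ (star (mean τ (F n) a₀) * mean τ (F n) a₀)).re :=
        (Complex.le_def.1 (hst.1.1 _)).1
      have h7 := hL (F n)
      exact mul_le_mul_of_nonneg_right (h5.trans (by gcongr)) h6
    have h3 := h2.add (ih.const_mul (θ a - z))
    rw [zero_add] at h3
    simp only [List.map_cons, List.prod_cons]
    refine h3.congr fun n => ?_
    have h4 : mean τ (F n) a₀ = mean τ (F n) a - θ a • 1 := by
      rw [ha₀, map_sub, map_smul, mean_one (hF.nonempty n)]
    simp only [meanProd, h4, mul_sub, mul_smul_comm, mul_one, map_sub, map_smul, smul_eq_mul]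
    ring

/-- The extreme invariant states of an asymptotically abelian action are linearly independent. -/
theorem linearIndependent_extremePoints (hτ : IsAction τ) (hab : IsAsymptoticallyAbelian τ)
    (hF : IsFolner H F) : LinearIndependent ℝ
      (Subtype.val : ((invStates τ H).extremePoints ℝ) → (B →ₗ[ℂ] ℂ)) := by
  rw [linearIndependent_iff']
  intro s g hg i hi
  have hsep : ∀ j : (invStates τ H).extremePoints ℝ, ∃ a, j ≠ i → i.1 a ≠ j.1 a := by
    intro j
    by_contra! h
    have hij : i.1 = j.1 := LinearMap.ext fun a => (h a).2
    exact (h 0).1 (Subtype.ext hij.symm)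
  choose a ha using hsep
  classical
  -- One factor for each j ≠ i, with a_j separating i from j and the scalar j(a_j). In the limit the
  -- product vanishes in every state j ≠ i of the relation and not in i, which isolates the
  -- coefficient of i.
  set L : List (B × ℂ) := (s.erase i).toList.map fun j => (a j, j.1 (a j)) with hL
  have hlim : Tendsto (fun n => ∑ j ∈ s, (g j : ℂ) * j.1 (meanProd τ (F n) L)) atTop
      (𝓝 (∑ j ∈ s, (g j : ℂ) * (L.map fun p => j.1 p.1 - p.2).prod)) :=
    tendsto_finsetSum _ fun j _ =>
      (tendsto_apply_meanProd hτ hab hF j.2 L).const_mul _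
  have hzero : ∀ n, ∑ j ∈ s, (g j : ℂ) * j.1 (meanProd τ (F n) L) = 0 := by
    intro n
    have := LinearMap.congr_fun hg (meanProd τ (F n) L)
    simpa [LinearMap.sum_apply] using this
  simp only [hzero] at hlim
  have h0 := tendsto_nhds_unique hlim tendsto_const_nhds
  rw [Finset.sum_eq_single_of_mem i hi] at h0
  · rcases mul_eq_zero.1 h0 with h | h
    · exact_mod_cast h
    · rw [List.prod_eq_zero_iff] at h
      simp only [hL, List.map_map, List.mem_map, Finset.mem_toList, Finset.mem_erase,
        Function.comp_apply] at h
      obtain ⟨j, ⟨hj, -⟩, h⟩ := h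
      exact absurd (sub_eq_zero.1 h) (ha j hj)
  · intro j hj hji
    rw [mul_eq_zero, List.prod_eq_zero_iff]
    right
    simp only [hL, List.map_map, List.mem_map, Finset.mem_toList, Finset.mem_erase,
      Function.comp_apply]
    exact ⟨j, ⟨hji, hj⟩, sub_self _⟩

end Mean

/-! ### Boxes in `ℤ^ν` -/

section Boxes

variable {ν : ℕ}

theorem mem_box {n : Fin ν → ℕ} {x : Fin ν → ℤ} : x ∈ box n ↔ ∀ j, 0 ≤ x j ∧ x j < n j := by
  simp [box, Fintype.mem_piFinset]

theorem card_box (n : Fin ν → ℕ) : (box n).card = ∏ j, n j := by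
  simp [box, Fintype.card_piFinset]

/-- A subgroup of `ℤ^ν` containing `l ℤ^ν` has a box as a transversal, whose side lengths are the
diagonal entries of the Hermite normal form of the subgroup. -/
theorem exists_box_isTransversal {l : ℕ} (hl : 0 < l) : ∀ {ν : ℕ} (H : AddSubgroup (Fin ν → ℤ)),
    (∀ x : Fin ν → ℤ, l • x ∈ H) → ∃ k : Fin ν → ℕ, (∀ j, k j ∣ l) ∧ IsTransversal H (box k)
  | 0, H, _ => by
    refine ⟨fun _ => 0, fun j => j.elim0, fun y => ⟨y, ⟨mem_box.2 fun j => j.elim0, ?_⟩,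
      fun z _ => Subsingleton.elim _ _⟩⟩
    rw [sub_self]
    exact H.zero_mem
  | ν + 1, H, hH => by
    -- H is an extension of its projection to the first coordinate by its slice at first coordinate
    -- 0. The induction handles the slice.
    let ι : (Fin ν → ℤ) →+ (Fin (ν + 1) → ℤ) :=
      { toFun := fun z => Fin.cons 0 z
        map_zero' := by
          funext j
          refine Fin.cases ?_ (fun j => ?_) j <;> simp
        map_add' := fun y z => by
          funext j
          refine Fin.cases ?_ (fun j => ?_) j <;> simp }
    have hι0 : ∀ z, ι z 0 = 0 := fun z => rfl
    have hιs : ∀ z j, ι z (Fin.succ j) = z j := fun z j => rfl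
    obtain ⟨k', hk', htr⟩ := exists_box_isTransversal hl (H.comap ι) (fun x => by
      rw [AddSubgroup.mem_comap, map_nsmul]
      exact hH _)
    obtain ⟨g, hg⟩ := Int.subgroup_cyclic (H.map (Pi.evalAddMonoidHom (fun _ => ℤ) 0))
    have hmem : ∀ t : ℤ, (∃ h ∈ H, h 0 = t) ↔ ((g.natAbs : ℕ) : ℤ) ∣ t := by
      intro t
      have : t ∈ H.map (Pi.evalAddMonoidHom (fun _ => ℤ) 0) ↔ g ∣ t := by
        rw [hg, ← AddSubgroup.zmultiples_eq_closure, Int.mem_zmultiples_iff]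
      rw [Int.natAbs_dvd, ← this]
      rfl
    set k₀ := g.natAbs with hk₀
    have hk₀l : k₀ ∣ l := by
      -- The vector (l, …, l) lies in H, so the generator of the projection divides l.
      have := (hmem l).1 ⟨l • (fun _ => 1), hH _, by simp⟩
      exact_mod_cast this
    have hk₀pos : 0 < k₀ := Nat.pos_of_dvd_of_pos hk₀l hl
    refine ⟨Fin.cons k₀ k', fun j => Fin.cases (by simpa using hk₀l)
      (fun j => by simpa using hk' j) j, fun y => ?_⟩
    -- Subtracting h reduces the first coordinate of y modulo k₀; the remaining coordinates are then
    -- reduced within the slice.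
    obtain ⟨h, hh, hh0⟩ := (hmem (y 0 - y 0 % k₀)).2 (Int.dvd_self_sub_emod)
    obtain ⟨x', ⟨hx', hxH⟩, huniq⟩ := htr (fun j => y j.succ - h j.succ)
    rw [AddSubgroup.mem_comap] at hxH
    rw [mem_box] at hx'
    refine ⟨Fin.cons (y 0 % k₀) x', ⟨mem_box.2 fun j => ?_, ?_⟩, ?_⟩
    · refine Fin.cases ?_ (fun j => ?_) j
      · simp only [Fin.cons_zero]
        exact ⟨Int.emod_nonneg _ (by exact_mod_cast hk₀pos.ne'),
          Int.emod_lt_of_pos _ (by exact_mod_cast hk₀pos)⟩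
      · simpa using hx' j
    · convert H.add_mem hh hxH using 1
      funext j
      refine Fin.cases ?_ (fun j => ?_) j
      · simp [hι0, hh0]
      · simp only [hιs, Pi.sub_apply, Pi.add_apply, Fin.cons_succ]
        ring
    · rintro x ⟨hx, hyx⟩
      rw [mem_box] at hx
      have h0 : x 0 = y 0 % k₀ := by
        have h1 := (hmem (y 0 - x 0)).1 ⟨_, hyx, rfl⟩
        have h2 := hx 0
        rw [Fin.cons_zero] at h2
        rw [← Int.emod_eq_of_lt h2.1 h2.2]
        exact (Int.modEq_iff_dvd.2 h1)
      have hs : (fun j : Fin ν => x j.succ) = x' := by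
        refine huniq _ ⟨mem_box.2 fun j => by simpa using hx j.succ, ?_⟩
        rw [AddSubgroup.mem_comap]
        convert H.sub_mem hyx hh using 1
        funext j
        refine Fin.cases ?_ (fun j => ?_) j
        · simp [hι0, hh0, h0]
        · simp only [hιs, Pi.sub_apply]
          ring
      funext j
      refine Fin.cases ?_ (fun j => ?_) j
      · simpa using h0
      · simpa using congrFun hs j

theorem tendsto_natSub_div (c : ℕ) :
    Tendsto (fun n : ℕ => ((n + 1 - c : ℕ) : ℝ) / (n + 1)) atTop (𝓝 1) := by
  have h1 : Tendsto (fun n : ℕ => 1 - (c : ℝ) / ((n : ℝ) + 1)) atTop (𝓝 (1 - 0)) :=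
    (tendsto_const_nhds.div_atTop
      (tendsto_natCast_atTop_atTop.atTop_add tendsto_const_nhds)).const_sub 1
  rw [sub_zero] at h1
  refine h1.congr' ?_
  filter_upwards [eventually_ge_atTop c] with n hn
  have : (0 : ℝ) < n + 1 := by positivity
  rw [Nat.cast_sub (by omega)]
  push_cast
  field_simp

/-- The box and its translate share a box with sides n + 1 - |v_j|. Truncated subtraction gives side
0 when the shift is too large. -/
theorem card_translate_sdiff_box_le (v : Fin ν → ℤ) (n : ℕ) :
    (((translateSet (box fun _ : Fin ν => n + 1) v) \ box fun _ => n + 1).card : ℝ) /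
      (box fun _ : Fin ν => n + 1).card ≤
      1 - ∏ j, ((n + 1 - (v j).natAbs : ℕ) : ℝ) / (n + 1) := by
  set S := box fun _ : Fin ν => n + 1 with hS
  set T := translateSet S v with hT
  have hTc : T.card = S.card := by simp [hT, translateSet]
  have hSc : (S.card : ℝ) = (n + 1) ^ ν := by simp [hS, card_box]
  have hpos : (0 : ℝ) < S.card := by rw [hSc]; positivity
  have hsub : (Fintype.piFinset fun j =>
      Finset.Ico (max 0 (v j)) (min ((n : ℤ) + 1) (n + 1 + v j))) ⊆ T ∩ S := by
    intro x hx
    rw [Fintype.mem_piFinset] at hx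
    rw [Finset.mem_inter, hT, mem_translateSet, hS, mem_box, mem_box]
    simp only [Finset.mem_Ico] at hx
    refine ⟨fun j => ?_, fun j => ?_⟩
    · have := hx j
      simp only [Pi.sub_apply]
      push_cast
      omega
    · have := hx j
      push_cast
      omega
  have hcard := Finset.card_le_card hsub
  rw [Fintype.card_piFinset] at hcard
  have h2 : ∏ j, (n + 1 - (v j).natAbs) ≤ (T ∩ S).card := by
    refine le_trans (le_of_eq (Finset.prod_congr rfl fun j _ => ?_)) hcard
    rw [Int.card_Ico]
    omega
  have h3 : ((T \ S).card : ℝ) = S.card - (T ∩ S).card := by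
    have := Finset.card_sdiff_add_card_inter T S
    rw [hTc] at this
    rw [← this]
    push_cast
    ring
  have h4 : (∏ j, ((n + 1 - (v j).natAbs : ℕ) : ℝ)) ≤ (T ∩ S).card := by exact_mod_cast h2
  rw [h3, sub_div, div_self hpos.ne', Finset.prod_div_distrib]
  simp only [Finset.prod_const, Finset.card_univ, Fintype.card_fin]
  rw [← hSc]
  gcongr

/-- The boxes of side `n`, scaled by `l`, form a Følner sequence of `l ℤ^ν`. -/
theorem isFolner_scaledBox {l : ℕ} (hl : 0 < l) (hν : 0 < ν) :
    IsFolner (scaledLattice ν l)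
      (fun n => (box fun _ : Fin ν => n + 1).image fun x => l • x) := by
  have hinj : Function.Injective fun x : Fin ν → ℤ => l • x := by
    intro x y h
    funext j
    have := congrFun h j
    simpa [hl.ne'] using this
  have hcard : ∀ n : ℕ, ((box fun _ : Fin ν => n + 1).image fun x => l • x).card =
      (n + 1) ^ ν := fun n => by
    rw [Finset.card_image_of_injective _ hinj, card_box]
    simp
  -- The side n + 1 keeps each set nonempty, and ν > 0 makes (n + 1)^ν tend to infinity.
  refine ⟨fun n => ?_, fun n x hx => ?_, ?_, ?_⟩
  · rw [← Finset.card_pos, hcard]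
    positivity
  · obtain ⟨y, -, rfl⟩ := Finset.mem_image.1 hx
    exact ⟨y, rfl⟩
  · simp only [hcard]
    exact (tendsto_pow_atTop hν.ne').comp (tendsto_add_atTop_nat 1)
  · rintro _ ⟨v, rfl⟩
    have hlim : Tendsto (fun n : ℕ => 1 - ∏ j, ((n + 1 - (v j).natAbs : ℕ) : ℝ) / (n + 1)) atTop
        (𝓝 (1 - ∏ _j : Fin ν, 1)) :=
      (tendsto_finsetProd _ fun j _ => tendsto_natSub_div (v j).natAbs).const_sub 1
    rw [Finset.prod_const_one, sub_self] at hlim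
    refine squeeze_zero (fun n => by positivity) (fun n => ?_) hlim
    refine le_trans ?_ (card_translate_sdiff_box_le v n)
    rw [Finset.card_image_of_injective _ hinj]
    refine div_le_div_of_nonneg_right (Nat.cast_le.2 ?_) (Nat.cast_nonneg _)
    rw [← Finset.card_image_of_injective (translateSet (box fun _ : Fin ν => n + 1) v \ _) hinj]
    refine Finset.card_le_card fun x hx => ?_
    simp only [Finset.mem_sdiff, Finset.mem_map, Finset.mem_image] at hx
    obtain ⟨⟨_, ⟨b, hb, rfl⟩, rfl⟩, hx⟩ := hx
    refine Finset.mem_image.2 ⟨b + v, Finset.mem_sdiff.2 ⟨mem_translateSet.2 (by simpa using hb),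
      fun hbv => hx ⟨b + v, hbv, ?_⟩⟩, ?_⟩ <;> simp [nsmulAddMonoidHom]

end Boxes

/-! ### Elements that commute with almost all translates. -/

section FarCommutant

variable {E V : Type*} [Ring E] [StarRing E] [Algebra ℂ E] [StarModule ℂ E]

/-- The elements whose images under `T x` commute with `b` and `b*` up to finitely many `x`. -/
def farCommutant (T : V → E →⋆ₐ[ℂ] E) (b : E) :
    StarSubalgebra ℂ (E) where
  carrier := {a | ∀ᶠ x in cofinite, Commute (T x a) b ∧ Commute (T x a) (star b)}
  mul_mem' h₁ h₂ := Set.mem_ofPred.2 <| (Set.mem_ofPred.1 h₁).mp <|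
    (Set.mem_ofPred.1 h₂).mono fun x h₂ h₁ => by
      rw [map_mul]
      exact ⟨h₁.1.mul_left h₂.1, h₁.2.mul_left h₂.2⟩
  one_mem' := Set.mem_ofPred.2 <| Eventually.of_forall fun x => by
    rw [map_one]
    exact ⟨Commute.one_left _, Commute.one_left _⟩
  zero_mem' := Set.mem_ofPred.2 <| Eventually.of_forall fun x => by
    rw [map_zero]
    exact ⟨Commute.zero_left _, Commute.zero_left _⟩
  add_mem' h₁ h₂ := Set.mem_ofPred.2 <| (Set.mem_ofPred.1 h₁).mp <|
    (Set.mem_ofPred.1 h₂).mono fun x h₂ h₁ => by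
      rw [map_add]
      exact ⟨h₁.1.add_left h₂.1, h₁.2.add_left h₂.2⟩
  algebraMap_mem' r := Set.mem_ofPred.2 <| Eventually.of_forall fun x => by
    rw [AlgHomClass.commutes]
    exact ⟨Algebra.commutes r b, Algebra.commutes r _⟩
  star_mem' h := Set.mem_ofPred.2 <| (Set.mem_ofPred.1 h).mono fun x h => by
    rw [map_star]
    exact ⟨commute_star_comm.2 h.2, h.1.star_star⟩

/-- The elements `b` such that `b` and `b*` commute with `T x a` up to finitely many `x`. -/
def farCommutant' (T : V → E →⋆ₐ[ℂ] E) (a : E) :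
    StarSubalgebra ℂ (E) where
  carrier := {b | ∀ᶠ x in cofinite, Commute (T x a) b ∧ Commute (T x a) (star b)}
  mul_mem' h₁ h₂ := Set.mem_ofPred.2 <| (Set.mem_ofPred.1 h₁).mp <|
    (Set.mem_ofPred.1 h₂).mono fun x h₂ h₁ => by
      rw [star_mul]
      exact ⟨h₁.1.mul_right h₂.1, h₂.2.mul_right h₁.2⟩
  one_mem' := Set.mem_ofPred.2 <| Eventually.of_forall fun x => by
    rw [star_one]
    exact ⟨Commute.one_right _, Commute.one_right _⟩
  zero_mem' := Set.mem_ofPred.2 <| Eventually.of_forall fun x => by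
    rw [star_zero]
    exact ⟨Commute.zero_right _, Commute.zero_right _⟩
  add_mem' h₁ h₂ := Set.mem_ofPred.2 <| (Set.mem_ofPred.1 h₁).mp <|
    (Set.mem_ofPred.1 h₂).mono fun x h₂ h₁ => by
      rw [star_add]
      exact ⟨h₁.1.add_right h₂.1, h₁.2.add_right h₂.2⟩
  algebraMap_mem' r := Set.mem_ofPred.2 <| Eventually.of_forall fun x => by
    rw [← algebraMap_star_comm]
    exact ⟨(Algebra.commutes r _).symm, (Algebra.commutes _ _).symm⟩
  star_mem' h := Set.mem_ofPred.2 <| (Set.mem_ofPred.1 h).mono fun x h => by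
    rw [star_star]
    exact ⟨h.2, h.1⟩

end FarCommutant

/-! ### The translations as an asymptotically abelian action -/

section Translations

variable {A : Type*} [CStarAlgebra A] [FiniteDimensional ℂ A] {ν : ℕ}

/-- As an instance, closedness makes the quasilocal algebra a C*-algebra, so that the abstract
results above apply to it. -/
theorem isClosed_quasiLocalAlgebra :
    IsClosed ((quasiLocalAlgebra A ν : StarSubalgebra ℂ (ConfigSpace A ν →L[ℂ] ConfigSpace A ν)) :
      Set (ConfigSpace A ν →L[ℂ] ConfigSpace A ν)) := by
  unfold quasiLocalAlgebra
  exact StarSubalgebra.isClosed_topologicalClosure _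

attribute [local instance] isClosed_quasiLocalAlgebra

theorem isAction_translation : IsAction (translation A (ν := ν)) := by
  refine ⟨fun a => ?_, fun x y a => ?_⟩
  · apply Subtype.ext
    ext f c
    have h1 : (permUnitary (shiftConfig A (0 : Fin ν → ℤ))).symm f = f := by
      ext c
      change f _ = f c
      refine congrArg f (funext fun z => ?_)
      change c (z - 0) = c z
      rw [sub_zero]
    refine (congrArg (fun g => a.1 g (shiftConfig A 0 c)) h1).trans ?_
    refine congrArg (a.1 f) (funext fun z => ?_)
    change c (z + 0) = c z
    rw [add_zero]
  · apply Subtype.ext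
    ext f c
    have h1 : (permUnitary (shiftConfig A (x + y))).symm f =
        (permUnitary (shiftConfig A y)).symm ((permUnitary (shiftConfig A x)).symm f) := by
      ext c
      change f _ = f _
      refine congrArg f (funext fun z => ?_)
      change c (z - (x + y)) = c (z - x - y)
      rw [sub_sub]
    refine (congrArg (fun g => a.1 g (shiftConfig A (x + y) c)) h1).trans ?_
    refine congrArg (a.1 _) (funext fun z => ?_)
    change c (z + (x + y)) = c (z + y + x)
    rw [add_assoc, add_comm y x]

/-- The assignment which is `u` on `Λ` and `c` elsewhere. -/
def glue {Λ : Finset (Fin ν → ℤ)} (u : Λ → Idx A) (c : Config A ν) : Config A ν :=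
  fun x => if h : x ∈ Λ then u ⟨x, h⟩ else c x

theorem localOp_apply (Λ : Finset (Fin ν → ℤ)) (M : Matrix (Λ → Idx A) (Λ → Idx A) ℂ)
    (f : ConfigSpace A ν) (c : Config A ν) :
    localOp A Λ M f c = ∑ u : Λ → Idx A, M (fun x => c x) u * f (glue u c) := rfl

/-- Each operator reads and alters labels in its own set only, and gluing on disjoint sets commutes.
-/
theorem commute_localOp {Λ₁ Λ₂ : Finset (Fin ν → ℤ)} (h : Disjoint Λ₁ Λ₂)
    (M : Matrix (Λ₁ → Idx A) (Λ₁ → Idx A) ℂ) (N : Matrix (Λ₂ → Idx A) (Λ₂ → Idx A) ℂ) :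
    Commute (localOp A Λ₁ M) (localOp A Λ₂ N) := by
  have h12 : ∀ x ∈ Λ₁, x ∉ Λ₂ := fun x h1 h2 => Finset.disjoint_left.1 h h1 h2
  ext f c
  change localOp A Λ₁ M (localOp A Λ₂ N f) c = localOp A Λ₂ N (localOp A Λ₁ M f) c
  simp only [localOp_apply, Finset.mul_sum]
  rw [Finset.sum_comm]
  refine Finset.sum_congr rfl fun w _ => Finset.sum_congr rfl fun u _ => ?_
  have h1 : (fun x : Λ₂ => glue u c x) = fun x : Λ₂ => c x := by
    funext x
    exact dif_neg fun hx => h12 _ hx x.2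
  have h2 : (fun x : Λ₁ => glue w c x) = fun x : Λ₁ => c x := by
    funext x
    exact dif_neg (h12 _ x.2)
  have h3 : glue w (glue u c) = glue u (glue w c) := by
    funext x
    unfold glue
    by_cases hx : x ∈ Λ₁
    · rw [dif_neg (h12 x hx), dif_pos hx, dif_pos hx]
    · rw [dif_neg hx, dif_neg hx]
  rw [h1, h2, h3]
  ring

variable (A ν) in
/-- The union of the local algebras. -/
noncomputable def localElements : StarSubalgebra ℂ (ConfigSpace A ν →L[ℂ] ConfigSpace A ν) :=
  ⨆ Λ : Finset (Fin ν → ℤ), (localAlgebra A Λ).map (localOp A Λ)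

/-- The set Λ₁ + x meets Λ only for x in the finite difference set Λ - Λ₁. Elementary tensors
suffice because the far commutant is a *-subalgebra. -/
theorem localElements_le_farCommutant (Λ : Finset (Fin ν → ℤ))
    (N : Matrix (Λ → Idx A) (Λ → Idx A) ℂ) :
    localElements A ν ≤ farCommutant (conjShift A) (localOp A Λ N) := by
  refine iSup_le fun Λ₁ => ?_
  rw [StarSubalgebra.map_le_iff_le_comap]
  refine StarAlgebra.adjoin_le ?_
  rintro _ ⟨a, rfl⟩
  have hfin : {x : Fin ν → ℤ | ¬ Disjoint (translateSet Λ₁ x) Λ}.Finite := by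
    refine (Finset.finite_toSet (Finset.image₂ (fun y z => z - y) Λ₁ Λ)).subset fun x hx => ?_
    obtain ⟨z, h1, h2⟩ := Finset.not_disjoint_iff.1 (Set.mem_ofPred.1 hx)
    refine Finset.mem_coe.2 (Finset.mem_image₂.2 ⟨z - x, mem_translateSet.1 h1, z, h2, ?_⟩)
    abel
  change ∀ᶠ x in cofinite, _
  have hev : ∀ᶠ x in cofinite, Disjoint (translateSet Λ₁ x) Λ := by
    rw [eventually_cofinite]
    exact hfin
  filter_upwards [hev] with x hx
  change Commute (conjShift A x (localOp A Λ₁ (elementaryTensor A a))) _ ∧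
    Commute (conjShift A x (localOp A Λ₁ (elementaryTensor A a))) _
  rw [conjShift_elementaryTensor, ← map_star]
  exact ⟨commute_localOp hx _ _, commute_localOp hx _ _⟩

/-- The passage to all local elements takes two stages: first a is general and b lives on one finite
set, then a is fixed and b varies in the *-subalgebra `farCommutant'`. -/
theorem eventually_commute_of_mem_localElements {a b : ConfigSpace A ν →L[ℂ] ConfigSpace A ν}
    (ha : a ∈ localElements A ν) (hb : b ∈ localElements A ν) :
    ∀ᶠ x in cofinite, Commute (conjShift A x a) b := by
  have hle : localElements A ν ≤ farCommutant' (conjShift A) a := by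
    refine iSup_le fun Λ => ?_
    rintro _ ⟨N, -, rfl⟩
    exact localElements_le_farCommutant Λ N ha
  have h := hle hb
  change ∀ᶠ x in cofinite, _ at h
  exact h.mono fun x hx => hx.1

theorem exists_localElements_near (a : QuasiLocal A ν) {ε : ℝ} (hε : 0 < ε) :
    ∃ a' : QuasiLocal A ν, (a' : ConfigSpace A ν →L[ℂ] ConfigSpace A ν) ∈ localElements A ν ∧
      ‖a - a'‖ < ε := by
  have ha : (a : ConfigSpace A ν →L[ℂ] ConfigSpace A ν) ∈
      closure ((localElements A ν : StarSubalgebra ℂ _) : Set _) := a.2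
  obtain ⟨a', ha', hd⟩ := Metric.mem_closure_iff.1 ha ε hε
  refine ⟨⟨a', subset_closure ha'⟩, ha', ?_⟩
  rwa [dist_eq_norm] at hd

theorem isAsymptoticallyAbelian_translation :
    IsAsymptoticallyAbelian (translation A (ν := ν)) := by
  intro a b
  rw [Metric.tendsto_nhds]
  intro ε hε
  -- The error is at most 2‖a - a'‖‖b‖ + 2‖a'‖‖b - b'‖, so b' is chosen after a'. The summands 1
  -- keep the denominators positive.
  obtain ⟨a', ha', hda⟩ := exists_localElements_near a
    (by positivity : 0 < ε / (4 * (‖b‖ + 1)))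
  obtain ⟨b', hb', hdb⟩ := exists_localElements_near b
    (by positivity : 0 < ε / (4 * (‖a'‖ + 1)))
  filter_upwards [eventually_commute_of_mem_localElements ha' hb'] with x hx
  have hcomm : translation A x a' * b' = b' * translation A x a' := Subtype.ext hx
  set T := translation A x
  have hdecomp : T a * b - b * T a =
      (T (a - a') * b - b * T (a - a')) + (T a' * (b - b') - (b - b') * T a') := by
    simp only [map_sub, mul_sub, sub_mul, hcomm]
    abel
  have hle : ∀ u v : QuasiLocal A ν, ‖T u * v - v * T u‖ ≤ 2 * (‖u‖ * ‖v‖) := fun u v => by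
    have hT : ‖T u‖ ≤ ‖u‖ := norm_action_le x u
    refine (norm_sub_le _ _).trans ?_
    have e1 := (norm_mul_le (T u) v).trans (mul_le_mul_of_nonneg_right hT (norm_nonneg v))
    have e2 := (norm_mul_le v (T u)).trans (mul_le_mul_of_nonneg_left hT (norm_nonneg v))
    linarith
  rw [Real.dist_eq, sub_zero, abs_of_nonneg (norm_nonneg _), hdecomp]
  refine (norm_add_le _ _).trans_lt ?_
  have h1 := hle (a - a') b
  have h2 : ‖T a' * (b - b') - (b - b') * T a'‖ ≤ 2 * (‖a'‖ * ‖b - b'‖) := hle a' (b - b')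
  rw [lt_div_iff₀ (by positivity)] at hda hdb
  have e1 := norm_nonneg (a - a')
  have e2 := norm_nonneg (b - b')
  linarith

end Translations

/-! ### Entropy of density matrices -/

section MatrixEntropy

open scoped MatrixOrder

variable {m : Type*} [Fintype m] [DecidableEq m]

/-- The von Neumann entropy of a matrix. -/
noncomputable def vonNeumannEntropy (D : Matrix m m ℂ) : ℝ :=
  -(D * cfc Real.log D).trace.re

theorem continuousOn_spectrum (D : Matrix m m ℂ) (f : ℝ → ℝ) : ContinuousOn f (spectrum ℝ D) :=
  D.finite_real_spectrum.continuousOn f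

/-- The trace of a product of functions of two Hermitian matrices, in terms of the eigenvalues and
the overlaps of the eigenvectors. -/
theorem exists_trace_cfc_mul_cfc {a b : Matrix m m ℂ} (ha : a.IsHermitian) (hb : b.IsHermitian) :
    ∃ c : m → m → ℝ, (∀ i j, 0 ≤ c i j) ∧ ∀ f g : ℝ → ℝ, (cfc f a * cfc g b).trace.re =
      ∑ i, ∑ j, f (ha.eigenvalues i) * g (hb.eigenvalues j) * c i j := by
  set U : Matrix m m ℂ := ha.eigenvectorUnitary.1
  set W : Matrix m m ℂ := hb.eigenvectorUnitary.1
  refine ⟨fun i j => Complex.normSq ((star U * W) i j), fun i j => Complex.normSq_nonneg _,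
    fun f g => ?_⟩
  have h1 : cfc f a = U * Matrix.diagonal (fun i => (f (ha.eigenvalues i) : ℂ)) * star U := by
    rw [ha.cfc_eq, Matrix.IsHermitian.cfc, Unitary.conjStarAlgAut_apply]
    rfl
  have h2 : cfc g b = W * Matrix.diagonal (fun i => (g (hb.eigenvalues i) : ℂ)) * star W := by
    rw [hb.cfc_eq, Matrix.IsHermitian.cfc, Unitary.conjStarAlgAut_apply]
    rfl
  have h3 : (cfc f a * cfc g b).trace =
      (Matrix.diagonal (fun i => (f (ha.eigenvalues i) : ℂ)) * (star U * W) *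
        (Matrix.diagonal (fun i => (g (hb.eigenvalues i) : ℂ)) * star (star U * W))).trace := by
    rw [h1, h2, star_mul, star_star]
    simp only [mul_assoc]
    rw [Matrix.trace_mul_comm U]
    simp only [mul_assoc]
  rw [h3, Matrix.trace, Complex.re_sum]
  refine Finset.sum_congr rfl fun i _ => ?_
  rw [Matrix.diag_apply, Matrix.mul_apply, Complex.re_sum]
  refine Finset.sum_congr rfl fun j _ => ?_
  rw [Matrix.diagonal_mul, Matrix.diagonal_mul, Matrix.star_apply]
  have h4 : ∀ z : ℂ, (f (ha.eigenvalues i) : ℂ) * z * ((g (hb.eigenvalues j) : ℂ) * star z) =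
      ((f (ha.eigenvalues i) * g (hb.eigenvalues j) * Complex.normSq z : ℝ) : ℂ) := by
    intro z
    push_cast
    rw [← Complex.mul_conj, Complex.star_def]
    ring
  rw [h4, Complex.ofReal_re]

theorem trace_re_cfc {a : Matrix m m ℂ} (ha : a.IsHermitian) (f : ℝ → ℝ) :
    (cfc f a).trace.re = ∑ i, f (ha.eigenvalues i) := by
  rw [ha.cfc_eq, Matrix.IsHermitian.cfc, Unitary.conjStarAlgAut_apply, Matrix.trace_mul_cycle]
  simp [Matrix.trace]

theorem mul_cfc_eq {D : Matrix m m ℂ} (hD : D.IsHermitian) (f : ℝ → ℝ) :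
    D * cfc f D = cfc (fun x => x * f x) D := by
  have h1 : cfc (fun x : ℝ => x) D = D := cfc_id' ℝ D hD.isSelfAdjoint
  rw [cfc_mul (fun x : ℝ => x) f D (continuousOn_spectrum D _) (continuousOn_spectrum D _), h1]

theorem trace_re_mul_cfc {D : Matrix m m ℂ} (hD : D.IsHermitian) (f : ℝ → ℝ) :
    (D * cfc f D).trace.re = ∑ i, hD.eigenvalues i * f (hD.eigenvalues i) := by
  rw [mul_cfc_eq hD, trace_re_cfc hD]

theorem vonNeumannEntropy_eq_sum {D : Matrix m m ℂ} (hD : D.IsHermitian) :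
    vonNeumannEntropy D = ∑ i, Real.negMulLog (hD.eigenvalues i) := by
  rw [vonNeumannEntropy, trace_re_mul_cfc hD, ← Finset.sum_neg_distrib]
  simp [Real.negMulLog]

theorem sum_eigenvalues {D : Matrix m m ℂ} (hD : D.IsHermitian) :
    ∑ i, hD.eigenvalues i = D.trace.re := by
  rw [← trace_re_cfc hD (fun x => x), cfc_id' ℝ D hD.isSelfAdjoint]

theorem trace_re_cfc_exp_pos [Nonempty m] {c : Matrix m m ℂ} (hc : c.IsHermitian) :
    0 < (cfc Real.exp c).trace.re := by
  rw [trace_re_cfc hc]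
  exact Finset.sum_pos (fun _ _ => Real.exp_pos _) Finset.univ_nonempty

theorem nonempty_of_trace_eq_one {D : Matrix m m ℂ} (h : D.trace = 1) : Nonempty m := by
  by_contra hm
  rw [not_nonempty_iff] at hm
  simp [Matrix.trace] at h

/-- Half of the Gibbs variational principle: a consequence of Klein's inequality. -/
theorem vonNeumannEntropy_le {D c : Matrix m m ℂ} (hD : D.PosSemidef) (htr : D.trace = 1)
    (hc : c.IsHermitian) :
    vonNeumannEntropy D ≤ -(D * c).trace.re + Real.log (cfc Real.exp c).trace.re := by
  have := nonempty_of_trace_eq_one htr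
  have ht := trace_re_cfc_exp_pos hc
  set t := (cfc Real.exp c).trace.re with htdef
  set s := Real.log t with hs
  obtain ⟨w, hw, htrace⟩ := exists_trace_cfc_mul_cfc hD.1 hc
  have e0 : cfc (fun x : ℝ => x) D = D := cfc_id' ℝ D hD.1.isSelfAdjoint
  have e0' : cfc (fun x : ℝ => x) c = c := cfc_id' ℝ c hc.isSelfAdjoint
  have e1 : cfc (fun _ : ℝ => (1 : ℝ)) D = 1 := cfc_const_one ℝ D hD.1.isSelfAdjoint
  have e1' : cfc (fun _ : ℝ => (1 : ℝ)) c = 1 := cfc_const_one ℝ c hc.isSelfAdjoint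
  have h1 := htrace (fun x => x * Real.log x) (fun _ => 1)
  have h2 := htrace (fun x => x) (fun x => x)
  have h3 := htrace (fun _ => 1) Real.exp
  have h4 := htrace (fun x => x) (fun _ => 1)
  rw [e1', mul_one, ← mul_cfc_eq hD.1] at h1
  rw [e0, e0'] at h2
  rw [e1, one_mul, ← htdef] at h3
  rw [e0, e1', mul_one] at h4
  have hexp : Real.exp (-s) * t = 1 := by
    rw [hs, Real.exp_neg, Real.exp_log ht, inv_mul_cancel₀ ht.ne']
  -- Klein's inequality for scalars, from e^u ≥ 1 + u at u = y - s - log x. Summed with the overlaps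
  -- as weights it becomes the claim; s = log tr e^c normalizes e^(c - s) to trace 1.
  have key : ∀ x y : ℝ, 0 ≤ x →
      0 ≤ x * Real.log x - x * y + s * x + Real.exp (-s) * Real.exp y - x := by
    intro x y hx
    rcases hx.eq_or_lt with rfl | hx
    · simp; positivity
    · have h5 := Real.add_one_le_exp (y - s - Real.log x)
      have h6 : Real.exp (y - s - Real.log x) * x = Real.exp (-s) * Real.exp y := by
        rw [Real.exp_sub, Real.exp_log hx, div_mul_cancel₀ _ hx.ne', ← Real.exp_add]
        congr 1
        ring
      have h7 := mul_le_mul_of_nonneg_right h5 hx.le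
      rw [h6] at h7
      linarith
  have hsum : 0 ≤ ∑ i, ∑ j, (hD.1.eigenvalues i * Real.log (hD.1.eigenvalues i) -
      hD.1.eigenvalues i * hc.eigenvalues j + s * hD.1.eigenvalues i +
      Real.exp (-s) * Real.exp (hc.eigenvalues j) - hD.1.eigenvalues i) * w i j :=
    Finset.sum_nonneg fun i _ => Finset.sum_nonneg fun j _ =>
      mul_nonneg (key _ _ (hD.eigenvalues_nonneg i)) (hw i j)
  have hexpand : ∑ i, ∑ j, (hD.1.eigenvalues i * Real.log (hD.1.eigenvalues i) -
      hD.1.eigenvalues i * hc.eigenvalues j + s * hD.1.eigenvalues i +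
      Real.exp (-s) * Real.exp (hc.eigenvalues j) - hD.1.eigenvalues i) * w i j =
      (D * cfc Real.log D).trace.re - (D * c).trace.re + s * D.trace.re + Real.exp (-s) * t -
        D.trace.re := by
    rw [h1, h2, h3, h4]
    simp only [Finset.mul_sum, ← Finset.sum_sub_distrib, ← Finset.sum_add_distrib]
    refine Finset.sum_congr rfl fun i _ => Finset.sum_congr rfl fun j _ => ?_
    ring
  rw [hexpand, hexp, htr, Complex.one_re] at hsum
  rw [vonNeumannEntropy]
  linarith

/-- The exponential undoes the logarithm, leaving log(1 + ε dim) ≤ ε dim. The shift by ε is there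
because D may be singular. -/
theorem log_trace_exp_log_add_le {D : Matrix m m ℂ} (hD : D.PosSemidef) (htr : D.trace = 1)
    {ε : ℝ} (hε : 0 < ε) :
    Real.log (cfc Real.exp (cfc (fun x => Real.log (x + ε)) D)).trace.re ≤
      ε * Fintype.card m := by
  have h1 : cfc Real.exp (cfc (fun x => Real.log (x + ε)) D) = cfc (fun x => x + ε) D := by
    rw [← cfc_comp' Real.exp (fun x => Real.log (x + ε)) D
      (Real.continuous_exp.continuousOn) (continuousOn_spectrum D _) hD.1.isSelfAdjoint]
    refine cfc_congr fun x hx => ?_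
    have : 0 ≤ x := by
      rw [hD.1.spectrum_real_eq_range_eigenvalues] at hx
      obtain ⟨i, rfl⟩ := hx
      exact hD.eigenvalues_nonneg i
    exact Real.exp_log (by positivity)
  rw [h1, trace_re_cfc hD.1, Finset.sum_add_distrib, sum_eigenvalues, htr]
  simp only [Finset.sum_const, Finset.card_univ, nsmul_eq_mul, Complex.one_re]
  have h2 := Real.log_le_sub_one_of_pos (by positivity : (0 : ℝ) < 1 + Fintype.card m * ε)
  linarith

theorem isHermitian_cfc (D : Matrix m m ℂ) (f : ℝ → ℝ) : (cfc f D).IsHermitian :=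
  cfc_predicate (R := ℝ) f D

/-- The infimum in the Gibbs variational principle is approached by elements of any algebra that
contains the density matrix. -/
theorem exists_le_vonNeumannEntropy_add (B : StarSubalgebra ℂ (Matrix m m ℂ)) {D : Matrix m m ℂ}
    (hDB : D ∈ B) (hD : D.PosSemidef) (htr : D.trace = 1) {δ : ℝ} (hδ : 0 < δ) :
    ∃ c ∈ B, c.IsHermitian ∧
      -(D * c).trace.re + Real.log (cfc Real.exp c).trace.re ≤ vonNeumannEntropy D + δ := by
  -- The optimizer would be log D; its regularization log(D + ε) costs at most ε dim ≤ δ and stays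
  -- in B by functional calculus.
  set ε : ℝ := δ / (Fintype.card m + 1) with hε
  have hε0 : 0 < ε := by positivity
  have hclosed : IsClosed (B : Set (Matrix m m ℂ)) :=
    Submodule.closed_of_finiteDimensional (Subalgebra.toSubmodule B.toSubalgebra)
  refine ⟨cfc (fun x => Real.log (x + ε)) D, cfc_mem _ hDB, isHermitian_cfc _ _, ?_⟩
  have h1 := log_trace_exp_log_add_le hD htr hε0
  have h2 : ε * Fintype.card m ≤ δ := by
    rw [hε, div_mul_eq_mul_div, div_le_iff₀ (by positivity)]
    nlinarith
  have h3 : -(D * cfc (fun x => Real.log (x + ε)) D).trace.re ≤ vonNeumannEntropy D := by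
    rw [vonNeumannEntropy, neg_le_neg_iff, trace_re_mul_cfc hD.1, trace_re_mul_cfc hD.1]
    refine Finset.sum_le_sum fun i _ => ?_
    rcases (hD.eigenvalues_nonneg i).eq_or_lt with h | h
    · rw [← h]; simp
    · exact mul_le_mul_of_nonneg_left (Real.log_le_log h (by linarith)) h.le
  linarith

theorem vonNeumannEntropy_nonneg {D : Matrix m m ℂ} (hD : D.PosSemidef) (htr : D.trace = 1) :
    0 ≤ vonNeumannEntropy D := by
  rw [vonNeumannEntropy_eq_sum hD.1]
  refine Finset.sum_nonneg fun i _ => Real.negMulLog_nonneg (hD.eigenvalues_nonneg i) ?_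
  have h := Finset.single_le_sum (fun j _ => hD.eigenvalues_nonneg j) (Finset.mem_univ i)
  rwa [sum_eigenvalues hD.1, htr] at h

theorem vonNeumannEntropy_le_log_card {D : Matrix m m ℂ} (hD : D.PosSemidef) (htr : D.trace = 1) :
    vonNeumannEntropy D ≤ Real.log (Fintype.card m) := by
  have h := vonNeumannEntropy_le hD htr (c := 0) Matrix.isHermitian_zero
  have h1 : cfc Real.exp (0 : Matrix m m ℂ) = 1 := by
    rw [cfc_apply_zero, Real.exp_zero, map_one]
  rw [h1] at h
  simpa using h

theorem trace_re_mul_le_of_le {D x y : Matrix m m ℂ} (hD : D.PosSemidef) (hxy : x ≤ y) :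
    (D * x).trace.re ≤ (D * y).trace.re := by
  obtain ⟨S, hS⟩ := CStarAlgebra.nonneg_iff_eq_star_mul_self.mp hD.nonneg
  have h1 : (S * (y - x) * star S).PosSemidef :=
    (Matrix.le_iff.1 hxy).mul_mul_conjTranspose_same S
  have h2 := (Complex.le_def.1 h1.trace_nonneg).1
  have h3 : (S * (y - x) * star S).trace = (D * y).trace - (D * x).trace := by
    rw [← Matrix.trace_sub, ← mul_sub, hS, Matrix.trace_mul_comm, ← mul_assoc,
      mul_assoc]
  rw [h3, Complex.sub_re, Complex.zero_re] at h2
  linarith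

theorem cfc_log_add_eq {D : Matrix m m ℂ} (hD : D.IsHermitian) {p : ℝ} (ε : ℝ) :
    cfc (fun x => Real.log (p * x + ε)) D = cfc Real.log (p • D + algebraMap ℝ _ ε) := by
  have h1 : cfc (fun x : ℝ => p * x + ε) D = p • D + algebraMap ℝ _ ε := by
    rw [cfc_add_const ε (fun x : ℝ => p * x) D (continuousOn_spectrum D _) hD.isSelfAdjoint,
      cfc_const_mul p (fun x : ℝ => x) D (continuousOn_spectrum D _), cfc_id' ℝ D hD.isSelfAdjoint]
  rw [← h1]
  exact cfc_comp' Real.log (fun x : ℝ => p * x + ε) D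
    ((D.finite_real_spectrum.image _).continuousOn _) (continuousOn_spectrum D _) hD.isSelfAdjoint

-- Operator monotonicity of the logarithm, with ε providing strict positivity. The operator norm is
-- opened for this statement alone; `cfc_log_mono` is its form free of a choice of norm.
open scoped Matrix.Norms.L2Operator in
theorem cfc_log_mono_aux {x y : Matrix m m ℂ} (hx : 0 ≤ x) (hxy : x ≤ y) {ε : ℝ} (hε : 0 < ε) :
    CFC.log (x + algebraMap ℝ _ ε) ≤ CFC.log (y + algebraMap ℝ _ ε) := by
  refine CFC.log_le_log (by gcongr) ?_
  have h5 : IsStrictlyPositive (algebraMap ℝ (Matrix m m ℂ) ε) := by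
    refine IsStrictlyPositive.iff_of_unital.2 ⟨?_, ?_⟩
    · exact algebraMap_nonneg _ hε.le
    · exact (IsUnit.mk0 ε hε.ne').map (algebraMap ℝ (Matrix m m ℂ))
  exact IsStrictlyPositive.nonneg_add hx h5

theorem cfc_log_mono {x y : Matrix m m ℂ} (hx : 0 ≤ x) (hxy : x ≤ y) {ε : ℝ} (hε : 0 < ε) :
    cfc Real.log (x + algebraMap ℝ _ ε) ≤ cfc Real.log (y + algebraMap ℝ _ ε) :=
  cfc_log_mono_aux hx hxy hε

/-- The entropy of a uniform mixture of `N` states exceeds the mean entropy by at most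
`log N`. -/
theorem vonNeumannEntropy_average_le {ι : Type*} {s : Finset ι} (hs : s.Nonempty)
    {ρ : ι → Matrix m m ℂ} (hρ : ∀ i ∈ s, (ρ i).PosSemidef) (htr : ∀ i ∈ s, (ρ i).trace = 1)
    {σ : Matrix m m ℂ} (hσ : σ = (s.card : ℝ)⁻¹ • ∑ i ∈ s, ρ i) :
    vonNeumannEntropy σ ≤
      (s.card : ℝ)⁻¹ * ∑ i ∈ s, vonNeumannEntropy (ρ i) + Real.log s.card := by
  have hcard : (0 : ℝ) < s.card := by exact_mod_cast hs.card_pos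
  set p : ℝ := (s.card : ℝ)⁻¹ with hp
  have hp0 : 0 < p := inv_pos.2 hcard
  have hσpos : σ.PosSemidef := by
    rw [hσ]
    exact (Matrix.posSemidef_sum s hρ).smul hp0.le
  have hσtr : σ.trace = 1 := by
    rw [hσ, Matrix.trace_smul, Matrix.trace_sum, Finset.sum_congr rfl htr, hp]
    have : (s.card : ℂ) ≠ 0 := by exact_mod_cast hcard.ne'
    simp [this]
  -- Since ρ_i/N ≤ σ, operator monotonicity bounds log(σ + ε) below by log(ρ_i/N + ε). Paired with
  -- ρ_i, this costs log N against the entropy of ρ_i.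
  have hle : ∀ i ∈ s, p • ρ i ≤ σ := by
    intro i hi
    rw [hσ, Finset.smul_sum]
    exact Finset.single_le_sum (f := fun i => p • ρ i)
      (fun j hj => ((hρ j hj).smul hp0.le).nonneg) hi
  have hmain : ∀ ε : ℝ, 0 < ε → vonNeumannEntropy σ ≤
      p * ∑ i ∈ s, vonNeumannEntropy (ρ i) + Real.log s.card + ε * Fintype.card m := by
    intro ε hε
    have h1 := vonNeumannEntropy_le hσpos hσtr
      (isHermitian_cfc σ (fun x => Real.log (x + ε)))
    have h2 := log_trace_exp_log_add_le hσpos hσtr hε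
    set X := cfc (fun x => Real.log (x + ε)) σ with hX
    have hX' : X = cfc Real.log (σ + algebraMap ℝ _ ε) := by
      have := cfc_log_add_eq hσpos.1 (p := 1) ε
      simpa using this
    have h3 : ∀ i ∈ s, -(ρ i * X).trace.re ≤ vonNeumannEntropy (ρ i) + Real.log s.card := by
      intro i hi
      have hmono : cfc (fun x => Real.log (p * x + ε)) (ρ i) ≤ X := by
        rw [cfc_log_add_eq (hρ i hi).1, hX']
        exact cfc_log_mono ((hρ i hi).smul hp0.le).nonneg (hle i hi) hε
      have h4 := trace_re_mul_le_of_le (hρ i hi) hmono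
      rw [trace_re_mul_cfc (hρ i hi).1] at h4
      rw [vonNeumannEntropy, trace_re_mul_cfc (hρ i hi).1]
      have h6 : ∑ j, (hρ i hi).1.eigenvalues j * Real.log ((hρ i hi).1.eigenvalues j) -
          Real.log s.card ≤ ∑ j, (hρ i hi).1.eigenvalues j *
            Real.log (p * (hρ i hi).1.eigenvalues j + ε) := by
        have h7 : Real.log s.card = ∑ j, (hρ i hi).1.eigenvalues j * Real.log s.card := by
          rw [← Finset.sum_mul, sum_eigenvalues, htr i hi, Complex.one_re, one_mul]
        rw [h7, ← Finset.sum_sub_distrib]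
        refine Finset.sum_le_sum fun j _ => ?_
        rcases ((hρ i hi).eigenvalues_nonneg j).eq_or_lt with h | h
        · rw [← h]; simp
        · rw [← mul_sub]
          refine mul_le_mul_of_nonneg_left ?_ h.le
          rw [← Real.log_div h.ne' hcard.ne']
          refine Real.log_le_log (by positivity) ?_
          rw [div_eq_inv_mul, ← hp]
          linarith
      linarith
    have h8 : -(σ * X).trace.re = p * ∑ i ∈ s, -(ρ i * X).trace.re := by
      rw [hσ, smul_mul_assoc, Finset.sum_mul, Matrix.trace_smul, Matrix.trace_sum,
        Complex.smul_re, Complex.re_sum, Finset.sum_neg_distrib, smul_eq_mul, mul_neg]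
    have h9 : p * ∑ i ∈ s, -(ρ i * X).trace.re ≤
        p * ∑ i ∈ s, vonNeumannEntropy (ρ i) + Real.log s.card := by
      have h10 := mul_le_mul_of_nonneg_left (Finset.sum_le_sum h3) hp0.le
      rw [Finset.sum_add_distrib, mul_add, Finset.sum_const, nsmul_eq_mul, ← mul_assoc p s.card,
        hp, inv_mul_cancel₀ hcard.ne', one_mul] at h10
      rw [hp]
      exact h10
    linarith
  refine le_of_forall_pos_le_add fun δ hδ => ?_
  refine (hmain (δ / (Fintype.card m + 1)) (by positivity)).trans ?_
  have : δ / (Fintype.card m + 1 : ℝ) * Fintype.card m ≤ δ := by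
    rw [div_mul_eq_mul_div, div_le_iff₀ (by positivity)]
    nlinarith
  linarith

open scoped Matrix.Norms.L2Operator in
theorem cfc_exp_eq_normedSpace_exp_aux {a : Matrix m m ℂ} (ha : a.IsHermitian) :
    cfc Real.exp a = NormedSpace.exp a :=
  CFC.real_exp_eq_normedSpace_exp ha

theorem cfc_exp_eq_normedSpace_exp {a : Matrix m m ℂ} (ha : a.IsHermitian) :
    cfc Real.exp a = NormedSpace.exp a :=
  cfc_exp_eq_normedSpace_exp_aux ha

theorem cfc_exp_add {a b : Matrix m m ℂ} (ha : a.IsHermitian) (hb : b.IsHermitian)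
    (hab : Commute a b) : cfc Real.exp (a + b) = cfc Real.exp a * cfc Real.exp b := by
  rw [cfc_exp_eq_normedSpace_exp ha, cfc_exp_eq_normedSpace_exp hb,
    cfc_exp_eq_normedSpace_exp (ha.add hb), Matrix.exp_add_of_commute a b hab]

/-- The density matrix of a positive functional on a *-algebra of matrices is positive. -/
theorem posSemidef_of_trace_nonneg (B : StarSubalgebra ℂ (Matrix m m ℂ)) {D : Matrix m m ℂ}
    (hDB : D ∈ B) (h : ∀ a ∈ B, 0 ≤ (D * (star a * a)).trace) : D.PosSemidef := by
  have hclosed : IsClosed (B : Set (Matrix m m ℂ)) :=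
    Submodule.closed_of_finiteDimensional (Subalgebra.toSubmodule B.toSubalgebra)
  have hconj : ∀ a ∈ B, (D * star a).trace = star (D * a).trace := by
    intro a ha
    have him : ∀ b ∈ B, (D * (star b * b)).trace.im = 0 := fun b hb =>
      ((Complex.le_def.1 (h b hb)).2).symm
    have h1 := him (a + 1) (add_mem ha (one_mem B))
    have h2 := him (a + Complex.I • 1) (add_mem ha (SMulMemClass.smul_mem _ (one_mem B)))
    have h3 := him 1 (one_mem B)
    have h4 := him a ha
    simp only [star_add, star_one, star_smul, mul_add, add_mul, mul_one, one_mul,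
      Matrix.trace_add, Complex.add_im, smul_mul_assoc, mul_smul_comm, Matrix.trace_smul,
      smul_eq_mul, Complex.star_def, Complex.conj_I, Complex.mul_im, Complex.neg_re,
      Complex.neg_im, Complex.I_re, Complex.I_im, Complex.mul_re] at h1 h2 h3 h4
    apply Complex.ext
    · rw [Complex.star_def, Complex.conj_re]; linarith
    · rw [Complex.star_def, Complex.conj_im]; linarith
  have hherm : D.IsHermitian := by
    -- D - D* lies in B and is orthogonal to B for the trace form, hence zero.
    have h1 : ∀ a ∈ B, ((D - star D) * a).trace = 0 := by
      intro a ha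
      have h2 : (star D * a).trace = star (D * star a).trace := by
        rw [← Matrix.trace_conjTranspose, ← Matrix.star_eq_conjTranspose, star_mul, star_star,
          Matrix.trace_mul_comm]
      rw [sub_mul, Matrix.trace_sub, h2, hconj a ha, star_star, sub_self]
    have h2 := h1 (star (D - star D)) (star_mem (sub_mem hDB (star_mem hDB)))
    rw [Matrix.star_eq_conjTranspose (D - star D),
      Matrix.trace_mul_conjTranspose_self_eq_zero_iff] at h2
    exact (sub_eq_zero.1 h2).symm
  rw [hherm.posSemidef_iff_eigenvalues_nonneg]
  -- The test element is the negative part of D, which belongs to B: tr(D g(D)²) is the sum of λ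
  -- g(λ)², negative as soon as one eigenvalue is.
  set g : ℝ → ℝ := fun x => max (-x) 0 with hg
  have ha : cfc g D ∈ B := cfc_mem g hDB
  have h1 := (Complex.le_def.1 (h _ ha)).1
  have h2 : star (cfc g D) = cfc g D := isHermitian_cfc D g
  rw [h2, ← cfc_mul g g D (continuousOn_spectrum D _) (continuousOn_spectrum D _),
    trace_re_mul_cfc hherm, Complex.zero_re] at h1
  intro i
  by_contra! hi
  rw [Pi.zero_apply] at hi
  refine absurd h1 (not_le.2 ?_)
  have hle : ∀ x : ℝ, x * (g x * g x) ≤ 0 := by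
    intro x
    rcases le_total 0 x with hx | hx
    · simp [hg, hx]
    · exact mul_nonpos_of_nonpos_of_nonneg hx (mul_self_nonneg _)
  refine Finset.sum_neg' (fun j _ => hle _) ⟨i, Finset.mem_univ i, ?_⟩
  have : g (hherm.eigenvalues i) = -hherm.eigenvalues i := max_eq_left (by linarith)
  rw [this]
  exact mul_neg_of_neg_of_pos hi (by nlinarith)

end MatrixEntropy

/-! ### Concavity of the entropy. -/

section MatrixAverage

variable {m : Type*} [Fintype m] [DecidableEq m]

/-- The entropy is concave. -/
theorem le_vonNeumannEntropy_average {ι : Type*} {s : Finset ι} (hs : s.Nonempty)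
    {ρ : ι → Matrix m m ℂ} (hρ : ∀ i ∈ s, (ρ i).PosSemidef) (htr : ∀ i ∈ s, (ρ i).trace = 1)
    {σ : Matrix m m ℂ} (hσ : σ = (s.card : ℝ)⁻¹ • ∑ i ∈ s, ρ i) (hσpos : σ.PosSemidef)
    (hσtr : σ.trace = 1) :
    (s.card : ℝ)⁻¹ * ∑ i ∈ s, vonNeumannEntropy (ρ i) ≤ vonNeumannEntropy σ := by
  have hcard : (0 : ℝ) < s.card := by exact_mod_cast hs.card_pos
  refine le_of_forall_pos_le_add fun δ hδ => ?_
  -- The Gibbs functional is affine in the state for fixed c, so a c nearly optimal for the mixture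
  -- can be used for every component.
  obtain ⟨c, -, hc, hle⟩ := exists_le_vonNeumannEntropy_add ⊤ StarSubalgebra.mem_top hσpos hσtr hδ
  refine le_trans ?_ hle
  have h1 : ∑ i ∈ s, vonNeumannEntropy (ρ i) ≤
      ∑ i ∈ s, (-(ρ i * c).trace.re + Real.log (cfc Real.exp c).trace.re) :=
    Finset.sum_le_sum fun i hi => vonNeumannEntropy_le (hρ i hi) (htr i hi) hc
  have h2 : -(σ * c).trace.re = (s.card : ℝ)⁻¹ * ∑ i ∈ s, -(ρ i * c).trace.re := by
    rw [hσ, smul_mul_assoc, Finset.sum_mul, Matrix.trace_smul, Matrix.trace_sum,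
      Complex.smul_re, Complex.re_sum, Finset.sum_neg_distrib, smul_eq_mul, mul_neg]
  have h3 := mul_le_mul_of_nonneg_left h1 (inv_nonneg.2 hcard.le)
  rw [Finset.sum_add_distrib, mul_add, ← h2, Finset.sum_const, nsmul_eq_mul,
    inv_mul_cancel_left₀ hcard.ne'] at h3
  exact h3

end MatrixAverage

/-! ### Inclusions of local algebras -/

section LocalEmbedding

variable {A : Type*} [CStarAlgebra A] [FiniteDimensional ℂ A] {ν : ℕ}

theorem mem_localAlgebra_of_map {Λ₁ Λ : Finset (Fin ν → ℤ)}
    (j : Matrix (Λ₁ → Idx A) (Λ₁ → Idx A) ℂ →⋆ₐ[ℂ] Matrix (Λ → Idx A) (Λ → Idx A) ℂ)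
    (hj : ∀ a : Λ₁ → A, ∃ b : Λ → A, j (elementaryTensor A a) = elementaryTensor A b)
    {M : Matrix (Λ₁ → Idx A) (Λ₁ → Idx A) ℂ} (hM : M ∈ localAlgebra A Λ₁) :
    j M ∈ localAlgebra A Λ := by
  have hle : localAlgebra A Λ₁ ≤ (localAlgebra A Λ).comap j := by
    refine StarAlgebra.adjoin_le ?_
    rintro _ ⟨a, rfl⟩
    obtain ⟨b, hb⟩ := hj a
    rw [SetLike.mem_coe, StarSubalgebra.mem_comap, hb]
    exact StarAlgebra.subset_adjoin _ _ ⟨b, rfl⟩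
  exact hle hM

theorem rep_one : rep A 1 = 1 := by
  rw [rep, map_one]
  exact Matrix.blockDiagonal'_one

theorem elementaryTensor_one {Λ : Finset (Fin ν → ℤ)} :
    elementaryTensor A (fun _ : Λ => (1 : A)) = 1 := by
  ext c c'
  simp only [elementaryTensor, Matrix.of_apply, rep_one, Matrix.one_apply]
  by_cases h : c = c'
  · simp [h]
  · rw [if_neg h]
    obtain ⟨x, hx⟩ := Function.ne_iff.1 h
    exact Finset.prod_eq_zero (Finset.mem_univ x) (if_neg hx)

/-! ### Disjoint unions of sites as tensor products. -/

section Union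

variable {Λ₁ Λ₂ : Finset (Fin ν → ℤ)}

/-- The splitting of the assignments on a disjoint union. -/
def splitUnion (A : Type*) [CStarAlgebra A] [FiniteDimensional ℂ A] (h : Disjoint Λ₁ Λ₂) :
    (↥(Λ₁ ∪ Λ₂) → Idx A) ≃ (Λ₁ → Idx A) × (Λ₂ → Idx A) :=
  (Equiv.arrowCongr (Equiv.Finset.union Λ₁ Λ₂ h).symm (Equiv.refl (Idx A))).trans
    (Equiv.sumArrowEquivProdArrow _ _ _)

theorem splitUnion_fst (h : Disjoint Λ₁ Λ₂) (c : ↥(Λ₁ ∪ Λ₂) → Idx A) (x : Λ₁) :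
    (splitUnion A h c).1 x = c ⟨x, Finset.mem_union_left _ x.2⟩ := rfl

theorem splitUnion_snd (h : Disjoint Λ₁ Λ₂) (c : ↥(Λ₁ ∪ Λ₂) → Idx A) (x : Λ₂) :
    (splitUnion A h c).2 x = c ⟨x, Finset.mem_union_right _ x.2⟩ := rfl

theorem prod_union_coe (h : Disjoint Λ₁ Λ₂) (f : ↥(Λ₁ ∪ Λ₂) → ℂ) :
    ∏ x, f x = (∏ x : Λ₁, f ⟨x, Finset.mem_union_left _ x.2⟩) *
      ∏ x : Λ₂, f ⟨x, Finset.mem_union_right _ x.2⟩ := by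
  rw [← (Equiv.Finset.union Λ₁ Λ₂ h).prod_comp, Fintype.prod_sum_type]
  rfl

open scoped Kronecker

/-- `M ⊗ N` as a matrix over the sites of a disjoint union. -/
noncomputable def tensorUnion (h : Disjoint Λ₁ Λ₂) (M : Matrix (Λ₁ → Idx A) (Λ₁ → Idx A) ℂ)
    (N : Matrix (Λ₂ → Idx A) (Λ₂ → Idx A) ℂ) :
    Matrix (↥(Λ₁ ∪ Λ₂) → Idx A) (↥(Λ₁ ∪ Λ₂) → Idx A) ℂ :=
  (M ⊗ₖ N).submatrix (splitUnion A h) (splitUnion A h)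

theorem tensorUnion_mul (h : Disjoint Λ₁ Λ₂) (M M' : Matrix (Λ₁ → Idx A) (Λ₁ → Idx A) ℂ)
    (N N' : Matrix (Λ₂ → Idx A) (Λ₂ → Idx A) ℂ) :
    tensorUnion h M N * tensorUnion h M' N' = tensorUnion h (M * M') (N * N') := by
  rw [tensorUnion, tensorUnion, tensorUnion, Matrix.submatrix_mul_equiv, Matrix.mul_kronecker_mul]

theorem trace_tensorUnion (h : Disjoint Λ₁ Λ₂) (M : Matrix (Λ₁ → Idx A) (Λ₁ → Idx A) ℂ)
    (N : Matrix (Λ₂ → Idx A) (Λ₂ → Idx A) ℂ) :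
    (tensorUnion h M N).trace = M.trace * N.trace := by
  rw [← Matrix.trace_kronecker, Matrix.trace, Matrix.trace,
    ← (splitUnion A h).sum_comp]
  rfl

theorem tensorUnion_elementaryTensor (h : Disjoint Λ₁ Λ₂) (a : ↥(Λ₁ ∪ Λ₂) → A) :
    tensorUnion h (elementaryTensor A fun x => a ⟨x, Finset.mem_union_left _ x.2⟩)
      (elementaryTensor A fun x => a ⟨x, Finset.mem_union_right _ x.2⟩) =
      elementaryTensor A a := by
  ext c c'
  exact (prod_union_coe h fun x => rep A (a x) (c x) (c' x)).symm

theorem star_tensorUnion (h : Disjoint Λ₁ Λ₂) (M : Matrix (Λ₁ → Idx A) (Λ₁ → Idx A) ℂ)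
    (N : Matrix (Λ₂ → Idx A) (Λ₂ → Idx A) ℂ) :
    star (tensorUnion h M N) = tensorUnion h (star M) (star N) := by
  ext c c'
  simp [tensorUnion, Matrix.star_apply, Matrix.kroneckerMap_apply]

theorem tensorUnion_one (h : Disjoint Λ₁ Λ₂) :
    tensorUnion h (1 : Matrix (Λ₁ → Idx A) (Λ₁ → Idx A) ℂ) 1 = 1 := by
  rw [tensorUnion, Matrix.one_kronecker_one, Matrix.submatrix_one_equiv]

/-- The inclusion `M ↦ M ⊗ 1`. -/
noncomputable def inclLeft (A : Type*) [CStarAlgebra A] [FiniteDimensional ℂ A]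
    (h : Disjoint Λ₁ Λ₂) : Matrix (Λ₁ → Idx A) (Λ₁ → Idx A) ℂ →⋆ₐ[ℂ]
      Matrix (↥(Λ₁ ∪ Λ₂) → Idx A) (↥(Λ₁ ∪ Λ₂) → Idx A) ℂ where
  toFun M := tensorUnion h M 1
  map_one' := tensorUnion_one h
  map_mul' M N := by rw [tensorUnion_mul, mul_one]
  map_zero' := by rw [tensorUnion, Matrix.zero_kronecker]; rfl
  map_add' M N := by rw [tensorUnion, Matrix.add_kronecker]; rfl
  commutes' r := by
    rw [Algebra.algebraMap_eq_smul_one, Algebra.algebraMap_eq_smul_one, ← tensorUnion_one h,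
      tensorUnion, Matrix.smul_kronecker]
    rfl
  map_star' M := by rw [star_tensorUnion, star_one]

/-- The inclusion `N ↦ 1 ⊗ N`. -/
noncomputable def inclRight (A : Type*) [CStarAlgebra A] [FiniteDimensional ℂ A]
    (h : Disjoint Λ₁ Λ₂) : Matrix (Λ₂ → Idx A) (Λ₂ → Idx A) ℂ →⋆ₐ[ℂ]
      Matrix (↥(Λ₁ ∪ Λ₂) → Idx A) (↥(Λ₁ ∪ Λ₂) → Idx A) ℂ where
  toFun N := tensorUnion h 1 N
  map_one' := tensorUnion_one h
  map_mul' M N := by rw [tensorUnion_mul, mul_one]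
  map_zero' := by rw [tensorUnion, Matrix.kronecker_zero]; rfl
  map_add' M N := by rw [tensorUnion, Matrix.kronecker_add]; rfl
  commutes' r := by
    rw [Algebra.algebraMap_eq_smul_one, Algebra.algebraMap_eq_smul_one, ← tensorUnion_one h,
      tensorUnion, Matrix.kronecker_smul]
    rfl
  map_star' M := by rw [star_tensorUnion, star_one]

theorem inclLeft_apply (h : Disjoint Λ₁ Λ₂) (M : Matrix (Λ₁ → Idx A) (Λ₁ → Idx A) ℂ) :
    inclLeft A h M = tensorUnion h M 1 := rfl

theorem inclRight_apply (h : Disjoint Λ₁ Λ₂) (N : Matrix (Λ₂ → Idx A) (Λ₂ → Idx A) ℂ) :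
    inclRight A h N = tensorUnion h 1 N := rfl

theorem inclLeft_mem (h : Disjoint Λ₁ Λ₂) {M : Matrix (Λ₁ → Idx A) (Λ₁ → Idx A) ℂ}
    (hM : M ∈ localAlgebra A Λ₁) : inclLeft A h M ∈ localAlgebra A (Λ₁ ∪ Λ₂) := by
  refine mem_localAlgebra_of_map _ (fun a => ?_) hM
  refine ⟨fun x => if hx : x.1 ∈ Λ₁ then a ⟨x, hx⟩ else 1, ?_⟩
  rw [← tensorUnion_elementaryTensor h, inclLeft_apply]
  congr 1
  · congr 1
    funext x
    rw [dif_pos x.2]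
  · rw [← elementaryTensor_one]
    congr 1
    funext x
    rw [dif_neg (Finset.disjoint_right.1 h x.2)]

theorem inclRight_mem (h : Disjoint Λ₁ Λ₂) {N : Matrix (Λ₂ → Idx A) (Λ₂ → Idx A) ℂ}
    (hN : N ∈ localAlgebra A Λ₂) : inclRight A h N ∈ localAlgebra A (Λ₁ ∪ Λ₂) := by
  refine mem_localAlgebra_of_map _ (fun a => ?_) hN
  refine ⟨fun x => if hx : x.1 ∈ Λ₂ then a ⟨x, hx⟩ else 1, ?_⟩
  rw [← tensorUnion_elementaryTensor h, inclRight_apply]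
  congr 1
  · rw [← elementaryTensor_one]
    congr 1
    funext x
    rw [dif_neg (Finset.disjoint_left.1 h x.2)]
  · congr 1
    funext x
    rw [dif_pos x.2]

theorem localOp_inclLeft (h : Disjoint Λ₁ Λ₂) (M : Matrix (Λ₁ → Idx A) (Λ₁ → Idx A) ℂ) :
    localOp A (Λ₁ ∪ Λ₂) (inclLeft A h M) = localOp A Λ₁ M := by
  ext f c
  rw [localOp_apply, localOp_apply, ← (splitUnion A h).symm.sum_comp, Fintype.sum_prod_type]
  refine Finset.sum_congr rfl fun u _ => ?_
  -- The factor 1 on Λ₂ leaves only the labels that c already has there.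
  rw [Finset.sum_eq_single (fun x : Λ₂ => c x)]
  · have h1 : glue ((splitUnion A h).symm (u, fun x : Λ₂ => c x)) c = glue u c := by
      funext x
      unfold glue
      by_cases hx : x ∈ Λ₁
      · rw [dif_pos hx, dif_pos (Finset.mem_union_left _ hx)]
        have := splitUnion_fst h ((splitUnion A h).symm (u, fun x : Λ₂ => c x)) ⟨x, hx⟩
        rw [Equiv.apply_symm_apply] at this
        exact this.symm
      · rw [dif_neg hx]
        by_cases hx2 : x ∈ Λ₂
        · rw [dif_pos (Finset.mem_union_right _ hx2)]
          have := splitUnion_snd h ((splitUnion A h).symm (u, fun x : Λ₂ => c x)) ⟨x, hx2⟩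
          rw [Equiv.apply_symm_apply] at this
          exact this.symm
        · rw [dif_neg (by simp [hx, hx2])]
    rw [h1, inclLeft_apply, tensorUnion, Matrix.submatrix_apply, Equiv.apply_symm_apply,
      Matrix.kroneckerMap_apply]
    congr 1
    have h2 : (splitUnion A h fun x => c x).2 = fun x : Λ₂ => c x := rfl
    rw [h2, Matrix.one_apply_eq, mul_one]
    rfl
  · intro v _ hv
    rw [inclLeft_apply, tensorUnion, Matrix.submatrix_apply, Equiv.apply_symm_apply,
      Matrix.kroneckerMap_apply]
    have h2 : (splitUnion A h fun x => c x).2 = fun x : Λ₂ => c x := rfl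
    rw [h2, Matrix.one_apply_ne (Ne.symm hv), mul_zero, zero_mul]
  · intro hn
    exact absurd (Finset.mem_univ _) hn

theorem localOp_inclRight (h : Disjoint Λ₁ Λ₂) (N : Matrix (Λ₂ → Idx A) (Λ₂ → Idx A) ℂ) :
    localOp A (Λ₁ ∪ Λ₂) (inclRight A h N) = localOp A Λ₂ N := by
  ext f c
  rw [localOp_apply, localOp_apply, ← (splitUnion A h).symm.sum_comp, Fintype.sum_prod_type,
    Finset.sum_comm]
  refine Finset.sum_congr rfl fun v _ => ?_
  rw [Finset.sum_eq_single (fun x : Λ₁ => c x)]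
  · have h1 : glue ((splitUnion A h).symm (fun x : Λ₁ => c x, v)) c = glue v c := by
      funext x
      unfold glue
      by_cases hx : x ∈ Λ₂
      · rw [dif_pos hx, dif_pos (Finset.mem_union_right _ hx)]
        have := splitUnion_snd h ((splitUnion A h).symm (fun x : Λ₁ => c x, v)) ⟨x, hx⟩
        rw [Equiv.apply_symm_apply] at this
        exact this.symm
      · rw [dif_neg hx]
        by_cases hx2 : x ∈ Λ₁
        · rw [dif_pos (Finset.mem_union_left _ hx2)]
          have := splitUnion_fst h ((splitUnion A h).symm (fun x : Λ₁ => c x, v)) ⟨x, hx2⟩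
          rw [Equiv.apply_symm_apply] at this
          exact this.symm
        · rw [dif_neg (by simp [hx, hx2])]
    rw [h1, inclRight_apply, tensorUnion, Matrix.submatrix_apply, Equiv.apply_symm_apply,
      Matrix.kroneckerMap_apply]
    congr 1
    have h2 : (splitUnion A h fun x => c x).1 = fun x : Λ₁ => c x := rfl
    rw [h2, Matrix.one_apply_eq, one_mul]
    rfl
  · intro v _ hv
    rw [inclRight_apply, tensorUnion, Matrix.submatrix_apply, Equiv.apply_symm_apply,
      Matrix.kroneckerMap_apply]
    have h2 : (splitUnion A h fun x => c x).1 = fun x : Λ₁ => c x := rfl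
    rw [h2, Matrix.one_apply_ne (Ne.symm hv), zero_mul, zero_mul]
  · intro hn
    exact absurd (Finset.mem_univ _) hn

/-- c₁ ⊗ 1 and 1 ⊗ c₂ commute, so the exponential of the sum is the tensor product of the
exponentials. -/
theorem trace_exp_inclLeft_add_inclRight (h : Disjoint Λ₁ Λ₂)
    {c₁ : Matrix (Λ₁ → Idx A) (Λ₁ → Idx A) ℂ} {c₂ : Matrix (Λ₂ → Idx A) (Λ₂ → Idx A) ℂ}
    (h₁ : c₁.IsHermitian) (h₂ : c₂.IsHermitian) :
    (cfc Real.exp (inclLeft A h c₁ + inclRight A h c₂)).trace =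
      (cfc Real.exp c₁).trace * (cfc Real.exp c₂).trace := by
  have hc : Continuous (inclLeft A h) :=
    (inclLeft A h).toAlgHom.toLinearMap.continuous_of_finiteDimensional
  have hc' : Continuous (inclRight A h) :=
    (inclRight A h).toAlgHom.toLinearMap.continuous_of_finiteDimensional
  have h1 : (inclLeft A h c₁).IsHermitian := h₁.isSelfAdjoint.map (inclLeft A h)
  have h2 : (inclRight A h c₂).IsHermitian := h₂.isSelfAdjoint.map (inclRight A h)
  rw [cfc_exp_add h1 h2]
  · rw [← StarAlgHomClass.map_cfc (inclLeft A h) Real.exp c₁ (continuousOn_spectrum c₁ _) hc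
        h₁.isSelfAdjoint h1.isSelfAdjoint,
      ← StarAlgHomClass.map_cfc (inclRight A h) Real.exp c₂ (continuousOn_spectrum c₂ _) hc'
        h₂.isSelfAdjoint h2.isSelfAdjoint, inclLeft_apply, inclRight_apply, tensorUnion_mul,
      mul_one, one_mul, trace_tensorUnion]
  · change _ * _ = _ * _
    rw [inclLeft_apply, inclRight_apply, tensorUnion_mul, tensorUnion_mul, mul_one, one_mul,
      mul_one, one_mul]

end Union

/-! ### Transport of local matrices under translation. -/

section Translate

variable (Λ : Finset (Fin ν → ℤ)) (x : Fin ν → ℤ)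

/-- The bijection between the assignments on `Λ + x` and on `Λ`. -/
def relabelEquiv (A : Type*) [CStarAlgebra A] [FiniteDimensional ℂ A] :
    (translateSet Λ x → Idx A) ≃ (Λ → Idx A) :=
  Equiv.arrowCongr ((Equiv.subRight x).subtypeEquiv fun _ => mem_translateSet) (Equiv.refl _)

/-- The transport of matrices from the sites of `Λ` to those of `Λ + x`. -/
noncomputable def relabel (A : Type*) [CStarAlgebra A] [FiniteDimensional ℂ A] :
    Matrix (Λ → Idx A) (Λ → Idx A) ℂ →⋆ₐ[ℂ]
      Matrix (translateSet Λ x → Idx A) (translateSet Λ x → Idx A) ℂ where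
  toFun M := M.submatrix (relabelEquiv Λ x A) (relabelEquiv Λ x A)
  map_one' := Matrix.submatrix_one_equiv _
  map_mul' M N := (Matrix.submatrix_mul_equiv M N _ _ _).symm
  map_zero' := rfl
  map_add' M N := rfl
  commutes' r := by
    rw [Algebra.algebraMap_eq_smul_one, Algebra.algebraMap_eq_smul_one,
      ← Matrix.submatrix_one_equiv (relabelEquiv Λ x A)]
    rfl
  map_star' M := rfl

theorem relabel_apply (M : Matrix (Λ → Idx A) (Λ → Idx A) ℂ) :
    relabel Λ x A M = M.submatrix (relabelEquiv Λ x A) (relabelEquiv Λ x A) := rfl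

theorem trace_relabel (M : Matrix (Λ → Idx A) (Λ → Idx A) ℂ) :
    (relabel Λ x A M).trace = M.trace := by
  rw [Matrix.trace, Matrix.trace, ← (relabelEquiv Λ x A).sum_comp]
  rfl

theorem relabel_mem {M : Matrix (Λ → Idx A) (Λ → Idx A) ℂ} (hM : M ∈ localAlgebra A Λ) :
    relabel Λ x A M ∈ localAlgebra A (translateSet Λ x) := by
  refine mem_localAlgebra_of_map _ (fun a => ?_) hM
  refine ⟨fun y => a ⟨y - x, mem_translateSet.1 y.2⟩, ?_⟩
  ext c c'
  change ∏ z, _ = ∏ y, _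
  refine (Fintype.prod_equiv ((Equiv.subRight x).subtypeEquiv fun _ => mem_translateSet)
    _ _ fun y => ?_).symm
  change rep A _ (c y) (c' y) = rep A _ (c _) (c' _)
  congr 2
  all_goals
    first
      | rfl
      | exact (((Equiv.subRight x).subtypeEquiv
          fun _ => mem_translateSet).symm_apply_apply y).symm

theorem conjShift_localOp (M : Matrix (Λ → Idx A) (Λ → Idx A) ℂ) :
    conjShift A x (localOp A Λ M) = localOp A (translateSet Λ x) (relabel Λ x A M) := by
  ext f c
  change ∑ u : Λ → Idx A, _ = ∑ u : translateSet Λ x → Idx A, _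
  refine Fintype.sum_equiv (relabelEquiv Λ x A).symm _ _ fun u => ?_
  congr 1
  · rw [relabel_apply, Matrix.submatrix_apply, Equiv.apply_symm_apply]
    rfl
  · change f _ = f _
    refine congrArg f (funext fun y => ?_)
    change (if h : y - x ∈ Λ then u ⟨y - x, h⟩ else c (y - x + x)) =
      (if h : y ∈ translateSet Λ x then
        u ((Equiv.subRight x).subtypeEquiv (fun _ => mem_translateSet) ⟨y, h⟩) else c y)
    by_cases h : y ∈ translateSet Λ x
    · rw [dif_pos h, dif_pos (mem_translateSet.1 h)]
      rfl
    · rw [dif_neg h, dif_neg (mt mem_translateSet.2 h), sub_add_cancel]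

end Translate

end LocalEmbedding

/-! ### The entropy of the restrictions of a state -/

section LocalEntropy

variable {A : Type*} [CStarAlgebra A] [FiniteDimensional ℂ A] {ν : ℕ}
  {Ψ : QuasiLocal A ν →ₗ[ℂ] ℂ} {Λ Λ₁ Λ₂ : Finset (Fin ν → ℤ)}

/-- The density operator as a matrix. -/
noncomputable abbrev densityMatrix (Ψ : QuasiLocal A ν →ₗ[ℂ] ℂ) (Λ : Finset (Fin ν → ℤ)) :
    Matrix (Λ → Idx A) (Λ → Idx A) ℂ := densityOperator Ψ Λ

theorem entropy_eq (Ψ : QuasiLocal A ν →ₗ[ℂ] ℂ) (Λ : Finset (Fin ν → ℤ)) :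
    entropy Ψ Λ = vonNeumannEntropy (densityMatrix Ψ Λ) := rfl

theorem trace_densityMatrix_mul (Ψ : QuasiLocal A ν →ₗ[ℂ] ℂ) {M : Matrix (Λ → Idx A) (Λ → Idx A) ℂ}
    (hM : M ∈ localAlgebra A Λ) :
    (densityMatrix Ψ Λ * M).trace = Ψ (localInclusion A Λ ⟨M, hM⟩) :=
  ((existsUnique_density (localAlgebra A Λ) (restrict Ψ Λ)).choose_spec.1 ⟨M, hM⟩).symm

theorem trace_densityMatrix (hΨ : Ψ ∈ states A ν) : (densityMatrix Ψ Λ).trace = 1 := by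
  have h := trace_densityMatrix_mul (Λ := Λ) Ψ (one_mem (localAlgebra A Λ))
  rw [mul_one] at h
  rw [h]
  exact (congrArg Ψ (map_one (localInclusion A Λ))).trans hΨ.2

theorem posSemidef_densityMatrix (hΨ : Ψ ∈ states A ν) : (densityMatrix Ψ Λ).PosSemidef := by
  refine posSemidef_of_trace_nonneg (localAlgebra A Λ) (densityOperator Ψ Λ).2 fun a ha => ?_
  rw [trace_densityMatrix_mul Ψ (mul_mem (star_mem ha) ha)]
  have h : localInclusion A Λ ⟨star a * a, mul_mem (star_mem ha) ha⟩ =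
      star (localInclusion A Λ ⟨a, ha⟩) * localInclusion A Λ ⟨a, ha⟩ := by
    rw [← map_star, ← map_mul]
    rfl
  rw [h]
  exact hΨ.1 _

theorem entropy_nonneg (hΨ : Ψ ∈ states A ν) : 0 ≤ entropy Ψ Λ :=
  vonNeumannEntropy_nonneg (posSemidef_densityMatrix hΨ) (trace_densityMatrix hΨ)

theorem entropy_le_card_mul (hΨ : Ψ ∈ states A ν) :
    entropy Ψ Λ ≤ Λ.card * Real.log (Fintype.card (Idx A)) := by
  have h := vonNeumannEntropy_le_log_card (posSemidef_densityMatrix (Λ := Λ) hΨ)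
    (trace_densityMatrix hΨ)
  rw [Fintype.card_fun, Nat.cast_pow, Real.log_pow, Fintype.card_coe] at h
  exact h

/-- Take c₁, c₂ nearly optimal on the two parts and test the union with c₁ ⊗ 1 + 1 ⊗ c₂:
expectations and logarithms of partition functions add. The c_i are taken in the local algebras,
where pairing with the density operator computes Ψ. -/
theorem entropy_union_le (hΨ : Ψ ∈ states A ν) (h : Disjoint Λ₁ Λ₂) :
    entropy Ψ (Λ₁ ∪ Λ₂) ≤ entropy Ψ Λ₁ + entropy Ψ Λ₂ := by
  refine le_of_forall_pos_le_add fun δ hδ => ?_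
  obtain ⟨c₁, hm₁, hc₁, h₁⟩ := exists_le_vonNeumannEntropy_add (localAlgebra A Λ₁)
    (densityOperator Ψ Λ₁).2 (posSemidef_densityMatrix hΨ) (trace_densityMatrix hΨ) (half_pos hδ)
  obtain ⟨c₂, hm₂, hc₂, h₂⟩ := exists_le_vonNeumannEntropy_add (localAlgebra A Λ₂)
    (densityOperator Ψ Λ₂).2 (posSemidef_densityMatrix hΨ) (trace_densityMatrix hΨ) (half_pos hδ)
  have hl := inclLeft_mem h hm₁
  have hr := inclRight_mem h hm₂
  have h1 : (inclLeft A h c₁).IsHermitian := hc₁.isSelfAdjoint.map (inclLeft A h)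
  have h2 : (inclRight A h c₂).IsHermitian := hc₂.isSelfAdjoint.map (inclRight A h)
  have hle := vonNeumannEntropy_le (posSemidef_densityMatrix (Λ := Λ₁ ∪ Λ₂) hΨ)
    (trace_densityMatrix hΨ) (h1.add h2)
  have hne₁ := nonempty_of_trace_eq_one (trace_densityMatrix (Λ := Λ₁) hΨ)
  have hne₂ := nonempty_of_trace_eq_one (trace_densityMatrix (Λ := Λ₂) hΨ)
  have hp₁ := trace_re_cfc_exp_pos hc₁
  have hp₂ := trace_re_cfc_exp_pos hc₂
  -- The partition functions are real, so the real part of their product is the product of their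
  -- real parts.
  have him : ∀ {m : Type _} [Fintype m] [DecidableEq m] {c : Matrix m m ℂ},
      c.IsHermitian → (cfc Real.exp c).trace.im = 0 := by
    intro m _ _ c hc
    have h3 := (isHermitian_cfc c Real.exp)
    have h4 : star (cfc Real.exp c).trace = (cfc Real.exp c).trace := by
      rw [← Matrix.trace_conjTranspose, h3.eq]
    have h5 := congrArg Complex.im h4
    rw [Complex.star_def, Complex.conj_im] at h5
    linarith
  rw [mul_add, Matrix.trace_add, Complex.add_re, trace_exp_inclLeft_add_inclRight h hc₁ hc₂,
    Complex.mul_re, him hc₁, zero_mul, sub_zero, Real.log_mul hp₁.ne' hp₂.ne',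
    trace_densityMatrix_mul Ψ hl, trace_densityMatrix_mul Ψ hr] at hle
  have e1 : localInclusion A (Λ₁ ∪ Λ₂) ⟨_, hl⟩ = localInclusion A Λ₁ ⟨c₁, hm₁⟩ :=
    Subtype.ext (localOp_inclLeft h c₁)
  have e2 : localInclusion A (Λ₁ ∪ Λ₂) ⟨_, hr⟩ = localInclusion A Λ₂ ⟨c₂, hm₂⟩ :=
    Subtype.ext (localOp_inclRight h c₂)
  rw [e1, e2] at hle
  have f1 := trace_densityMatrix_mul Ψ hm₁
  have f2 := trace_densityMatrix_mul Ψ hm₂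
  change (((densityOperator Ψ Λ₁ : localAlgebra A Λ₁) : Matrix _ _ ℂ) * c₁).trace = _ at f1
  change (((densityOperator Ψ Λ₂ : localAlgebra A Λ₂) : Matrix _ _ ℂ) * c₂).trace = _ at f2
  rw [f1] at h₁
  rw [f2] at h₂
  rw [entropy_eq, entropy_eq, entropy_eq]
  linarith

theorem translate_apply (Ψ : QuasiLocal A ν →ₗ[ℂ] ℂ) (x : Fin ν → ℤ) (a : QuasiLocal A ν) :
    translate Ψ x a = Ψ (translation A x a) := rfl

theorem translate_zero (Ψ : QuasiLocal A ν →ₗ[ℂ] ℂ) : translate Ψ 0 = Ψ := by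
  have := isClosed_quasiLocalAlgebra (A := A) (ν := ν)
  exact shift_zero isAction_translation

theorem translate_translate (Ψ : QuasiLocal A ν →ₗ[ℂ] ℂ) (x y : Fin ν → ℤ) :
    translate (translate Ψ x) y = translate Ψ (x + y) := by
  have := isClosed_quasiLocalAlgebra (A := A) (ν := ν)
  exact shift_shift isAction_translation x y

theorem translate_translate_neg (Ψ : QuasiLocal A ν →ₗ[ℂ] ℂ) (x : Fin ν → ℤ) :
    translate (translate Ψ x) (-x) = Ψ := by
  rw [translate_translate, add_neg_cancel, QuantumLattice.translate_zero]

theorem translate_mem_states (hΨ : Ψ ∈ states A ν) (x : Fin ν → ℤ) :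
    translate Ψ x ∈ states A ν := by
  refine ⟨fun a => ?_, ?_⟩
  · rw [translate_apply, map_mul, map_star]
    exact hΨ.1 _
  · rw [translate_apply, map_one]
    exact hΨ.2

/-- A nearly optimal c on Λ, relabelled, is tested on Λ + x. The reverse inequality is this one for
the translated state and -x. -/
theorem entropy_translateSet_le (hΨ : Ψ ∈ states A ν) (x : Fin ν → ℤ) :
    entropy Ψ (translateSet Λ x) ≤ entropy (translate Ψ x) Λ := by
  have hΨ' := translate_mem_states hΨ x
  refine le_of_forall_pos_le_add fun δ hδ => ?_
  obtain ⟨c, hm, hc, h⟩ := exists_le_vonNeumannEntropy_add (localAlgebra A Λ)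
    (densityOperator (translate Ψ x) Λ).2 (posSemidef_densityMatrix hΨ')
    (trace_densityMatrix hΨ') hδ
  have hcont : Continuous (relabel Λ x A) :=
    (relabel Λ x A).toAlgHom.toLinearMap.continuous_of_finiteDimensional
  have h1 : (relabel Λ x A c).IsHermitian := hc.isSelfAdjoint.map (relabel Λ x A)
  have hle := vonNeumannEntropy_le (posSemidef_densityMatrix (Λ := translateSet Λ x) hΨ)
    (trace_densityMatrix hΨ) h1
  rw [← StarAlgHomClass.map_cfc (relabel Λ x A) Real.exp c (continuousOn_spectrum c _) hcont
    hc.isSelfAdjoint h1.isSelfAdjoint, trace_relabel,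
    trace_densityMatrix_mul Ψ (relabel_mem Λ x hm)] at hle
  have f1 := trace_densityMatrix_mul (translate Ψ x) hm
  change (((densityOperator (translate Ψ x) Λ : localAlgebra A Λ) : Matrix _ _ ℂ) * c).trace =
    Ψ (translation A x (localInclusion A Λ ⟨c, hm⟩)) at f1
  have e1 : translation A x (localInclusion A Λ ⟨c, hm⟩) =
      localInclusion A (translateSet Λ x) ⟨_, relabel_mem Λ x hm⟩ :=
    Subtype.ext (conjShift_localOp Λ x c)
  rw [f1, e1] at h
  rw [entropy_eq, entropy_eq]
  linarith

theorem entropy_translateSet (hΨ : Ψ ∈ states A ν) (x : Fin ν → ℤ) :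
    entropy Ψ (translateSet Λ x) = entropy (translate Ψ x) Λ := by
  refine le_antisymm (entropy_translateSet_le hΨ x) ?_
  have h := entropy_translateSet_le (Λ := translateSet Λ x) (translate_mem_states hΨ x) (-x)
  have h1 : translateSet (translateSet Λ x) (-x) = Λ := by
    ext y
    simp [mem_translateSet]
  rwa [h1, translate_translate_neg] at h

/-- The same combination of density operators represents Ψ, and the density operator is unique. -/
theorem densityMatrix_average {ι : Type*} {s : Finset ι} {Φ : ι → QuasiLocal A ν →ₗ[ℂ] ℂ} {r : ℝ}
    (h : Ψ = r • ∑ i ∈ s, Φ i) :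
    densityMatrix Ψ Λ = r • ∑ i ∈ s, densityMatrix (Φ i) Λ := by
  set D : localAlgebra A Λ := (r : ℂ) • ∑ i ∈ s, densityOperator (Φ i) Λ with hD
  have hDm : (D : Matrix (Λ → Idx A) (Λ → Idx A) ℂ) = r • ∑ i ∈ s, densityMatrix (Φ i) Λ := by
    rw [hD]
    simp
  have h1 : D = densityOperator Ψ Λ := by
    refine (existsUnique_density (localAlgebra A Λ) (restrict Ψ Λ)).choose_spec.2 D fun a => ?_
    rw [hDm, smul_mul_assoc, Finset.sum_mul, Matrix.trace_smul, Matrix.trace_sum,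
      Finset.sum_congr rfl fun i _ => trace_densityMatrix_mul (Φ i) a.2]
    have h2 := LinearMap.congr_fun h (localInclusion A Λ a)
    rw [LinearMap.smul_apply, LinearMap.sum_apply] at h2
    exact h2
  rw [← hDm, h1]

theorem entropy_average_bounds {ι : Type*} {s : Finset ι} (hs : s.Nonempty)
    {Φ : ι → QuasiLocal A ν →ₗ[ℂ] ℂ} (hΦ : ∀ i ∈ s, Φ i ∈ states A ν) (hΨ : Ψ ∈ states A ν)
    (h : Ψ = (s.card : ℝ)⁻¹ • ∑ i ∈ s, Φ i) :
    (s.card : ℝ)⁻¹ * ∑ i ∈ s, entropy (Φ i) Λ ≤ entropy Ψ Λ ∧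
      entropy Ψ Λ ≤ (s.card : ℝ)⁻¹ * ∑ i ∈ s, entropy (Φ i) Λ + Real.log s.card :=
  ⟨le_vonNeumannEntropy_average hs (fun i hi => posSemidef_densityMatrix (hΦ i hi))
      (fun i hi => trace_densityMatrix (hΦ i hi)) (densityMatrix_average h)
      (posSemidef_densityMatrix hΨ) (trace_densityMatrix hΨ),
    vonNeumannEntropy_average_le hs (fun i hi => posSemidef_densityMatrix (hΦ i hi))
      (fun i hi => trace_densityMatrix (hΦ i hi)) (densityMatrix_average h)⟩

end LocalEntropy

/-! ### Means of subadditive functions of finite subsets of `ℤ^ν` -/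

section Fekete

variable {ν : ℕ}

/-- A nonnegative subadditive function of finite subsets of the lattice, invariant under the
translations in `l ℤ^ν` and bounded by a multiple of the cardinality. -/
structure IsLatticeSubadditive (l : ℕ) (C : ℝ) (F : Finset (Fin ν → ℤ) → ℝ) : Prop where
  union_le : ∀ Λ₁ Λ₂, Disjoint Λ₁ Λ₂ → F (Λ₁ ∪ Λ₂) ≤ F Λ₁ + F Λ₂
  nonneg : ∀ Λ, 0 ≤ F Λ
  le_card : ∀ Λ, F Λ ≤ Λ.card * C
  translate : ∀ Λ (v : Fin ν → ℤ), F (translateSet Λ (l • v)) = F Λ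

variable {l : ℕ} {C : ℝ} {F : Finset (Fin ν → ℤ) → ℝ}

theorem IsLatticeSubadditive.biUnion_le (hF : IsLatticeSubadditive l C F) {ι : Type*}
    [DecidableEq ι] (s : Finset ι) (t : ι → Finset (Fin ν → ℤ))
    (ht : (s : Set ι).PairwiseDisjoint t) : F (s.biUnion t) ≤ ∑ i ∈ s, F (t i) := by
  induction s using Finset.induction_on with
  | empty => simpa using hF.le_card ∅
  | insert i s hi ih =>
    rw [Finset.biUnion_insert, Finset.sum_insert hi]
    refine (hF.union_le _ _ ?_).trans (by
      gcongr
      exact ih (ht.subset (by simp)))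
    rw [Finset.disjoint_biUnion_right]
    intro j hj
    exact ht (by simp) (by simp [hj]) (fun h => hi (h ▸ hj))

theorem card_translateSet (Λ : Finset (Fin ν → ℤ)) (v : Fin ν → ℤ) :
    (translateSet Λ v).card = Λ.card := by
  simp [translateSet]

/-- The estimate obtained by filling a translate of a large box with translates of a fixed box. -/
theorem IsLatticeSubadditive.box_le (hF : IsLatticeSubadditive l C F) (hl : 0 < l)
    (v : Fin ν → ℤ) (n m : Fin ν → ℕ) (hn : ∀ j, 0 < n j) (hm : ∀ j, 0 < m j) :
    F (translateSet (box fun j => l * n j) v) ≤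
      (∏ j, (((n j - 1) / m j : ℕ) : ℝ)) * F (box fun j => l * m j) +
        (l : ℝ) ^ ν * ((∏ j, (n j : ℝ)) -
          ∏ j, ((((n j - 1) / m j : ℕ) : ℝ) * (m j : ℝ))) * C := by
  -- The tiles must sit at points of l ℤ^ν, while v is arbitrary. Rounding the corner up to
  -- l(⌊v_j/l⌋ + 1) wastes at most one cell per direction, whence n_j - 1.
  set q : Fin ν → ℕ := fun j => (n j - 1) / m j with hq
  set Λ := translateSet (box fun j => l * n j) v with hΛ
  set t : (Fin ν → ℤ) → Finset (Fin ν → ℤ) := fun z =>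
    translateSet (box fun j => l * m j) (l • fun j => v j / l + 1 + m j * z j) with ht
  have hl' : (0 : ℤ) < l := by exact_mod_cast hl
  have hmem : ∀ z x, x ∈ t z ↔ ∀ j, (l : ℤ) * (v j / l + 1 + m j * z j) ≤ x j ∧
      x j < (l : ℤ) * (v j / l + 1 + m j * z j) + l * m j := by
    intro z x
    rw [ht, mem_translateSet, mem_box]
    refine forall_congr' fun j => ?_
    simp only [Pi.sub_apply, Pi.smul_apply]
    simp only [nsmul_eq_mul]
    push_cast
    constructor <;> rintro ⟨h1, h2⟩ <;> constructor <;> linarith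
  have hdisj : ((box q : Finset (Fin ν → ℤ)) : Set (Fin ν → ℤ)).PairwiseDisjoint t := by
    intro z _ z' _ hzz
    rw [Function.onFun, Finset.disjoint_left]
    intro x hx hx'
    refine hzz (funext fun j => ?_)
    have h1 := (hmem z x).1 hx j
    have h2 := (hmem z' x).1 hx' j
    have hlm : (0 : ℤ) < l * m j := mul_pos hl' (by exact_mod_cast hm j)
    -- The index of a tile is recovered from any of its points by integer division, so the tiles are
    -- disjoint.
    have key : ∀ y : ℤ, (l : ℤ) * (v j / l + 1 + m j * y) ≤ x j →
        x j < (l : ℤ) * (v j / l + 1 + m j * y) + l * m j →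
        (x j - l * (v j / l + 1)) / (l * m j) = y := by
      intro y h3 h4
      rw [Int.ediv_eq_iff_of_pos hlm]
      constructor <;> linarith
    rw [← key _ h1.1 h1.2, key _ h2.1 h2.2]
  have hsub : (box q).biUnion t ⊆ Λ := by
    intro x hx
    obtain ⟨z, hz, hxz⟩ := Finset.mem_biUnion.1 hx
    rw [hΛ, mem_translateSet, mem_box]
    intro j
    have h1 := (hmem z x).1 hxz j
    have h2 := mem_box.1 hz j
    have h3 := Int.emod_add_mul_ediv (v j) l
    have h4 := Int.emod_nonneg (v j) hl'.ne'
    have h5 := Int.emod_lt_of_pos (v j) hl'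
    have h6 : (m j : ℤ) * (z j + 1) ≤ n j - 1 := by
      have h7 : m j * q j ≤ n j - 1 := Nat.mul_div_le _ _
      have h8 : (m j : ℤ) * q j ≤ n j - 1 := by
        have := hn j
        have h9 : ((m j * q j : ℕ) : ℤ) ≤ ((n j - 1 : ℕ) : ℤ) := by exact_mod_cast h7
        rw [Nat.cast_sub (by omega)] at h9
        exact_mod_cast h9
      refine le_trans (mul_le_mul_of_nonneg_left (by linarith [h2.2]) (by positivity)) h8
    have h10 : (0 : ℤ) ≤ l * (m j * z j) :=
      mul_nonneg hl'.le (mul_nonneg (by positivity) h2.1)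
    have h11 := mul_le_mul_of_nonneg_left h6 hl'.le
    simp only [Pi.sub_apply]
    push_cast
    constructor
    · linarith [h1.1]
    · linarith [h1.2]
  have hcardU : ((box q).biUnion t).card = (∏ j, q j) * ∏ j, l * m j := by
    rw [Finset.card_biUnion hdisj, Finset.sum_congr rfl fun z _ => card_translateSet _ _,
      Finset.sum_const, card_box, card_box, smul_eq_mul]
  have h1 : F ((box q).biUnion t) ≤ (∏ j, (q j : ℝ)) * F (box fun j => l * m j) := by
    refine (hF.biUnion_le _ t hdisj).trans (le_of_eq ?_)
    rw [Finset.sum_congr rfl fun z _ => hF.translate _ _, Finset.sum_const, card_box,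
      nsmul_eq_mul, Nat.cast_prod]
  have h2 := hF.union_le _ _ (Finset.disjoint_sdiff (s := (box q).biUnion t) (t := Λ))
  rw [Finset.union_sdiff_of_subset hsub] at h2
  have h3 := hF.le_card (Λ \ (box q).biUnion t)
  -- The uncovered sites, each of cost at most C, give the second term of the bound.
  have h4 : ((Λ \ (box q).biUnion t).card : ℝ) =
      (l : ℝ) ^ ν * ((∏ j, (n j : ℝ)) - ∏ j, ((q j : ℝ) * (m j : ℝ))) := by
    rw [Finset.cast_card_sdiff hsub, hcardU, hΛ, card_translateSet, card_box]
    push_cast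
    simp only [Finset.prod_mul_distrib, Finset.prod_const, Finset.card_univ, Fintype.card_fin]
    ring
  rw [h4] at h3
  linarith

theorem tendsto_sub_one_div_div {m : ℕ} (hm : 0 < m) :
    Tendsto (fun n : ℕ => (((n - 1) / m : ℕ) : ℝ) / n) atTop (𝓝 (m : ℝ)⁻¹) := by
  have hm' : (0 : ℝ) < m := by exact_mod_cast hm
  have h1 : Tendsto (fun n : ℕ => (m : ℝ)⁻¹ - 1 / (n : ℝ)) atTop (𝓝 ((m : ℝ)⁻¹ - 0)) :=
    tendsto_one_div_atTop_nhds_zero_nat.const_sub _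
  rw [sub_zero] at h1
  refine tendsto_of_tendsto_of_tendsto_of_le_of_le' h1 tendsto_const_nhds ?_ ?_
  · filter_upwards [eventually_gt_atTop 0] with n hn
    have hn' : (0 : ℝ) < n := by exact_mod_cast hn
    have h2 : n ≤ m * ((n - 1) / m) + m := by
      have h3 := Nat.mod_add_div (n - 1) m
      have h4 := Nat.mod_lt (n - 1) hm
      omega
    have h5 : (n : ℝ) ≤ m * ((n - 1) / m : ℕ) + m := by exact_mod_cast h2
    rw [inv_eq_one_div, div_sub_div _ _ hm'.ne' hn'.ne', div_le_div_iff₀ (by positivity) hn']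
    nlinarith
  · filter_upwards [eventually_gt_atTop 0] with n hn
    have hn' : (0 : ℝ) < n := by exact_mod_cast hn
    have h2 : m * ((n - 1) / m) ≤ n := (Nat.mul_div_le _ _).trans (Nat.sub_le _ _)
    have h5 : (m : ℝ) * ((n - 1) / m : ℕ) ≤ n := by exact_mod_cast h2
    rw [inv_eq_one_div, div_le_div_iff₀ hn' hm']
    linarith

theorem tendsto_eval_atTop (j : Fin ν) :
    Tendsto (fun n : Fin ν → ℕ => n j) atTop atTop :=
  tendsto_atTop_atTop.2 fun b => ⟨fun _ => b, fun _ h => h j⟩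

theorem eventually_forall_pos : ∀ᶠ n : Fin ν → ℕ in atTop, ∀ j, 0 < n j :=
  eventually_all.2 fun j => (tendsto_eval_atTop j).eventually_gt_atTop 0

/-- The multidimensional version of Fekete's lemma. -/
theorem IsLatticeSubadditive.exists_tendsto (hF : IsLatticeSubadditive l C F) (hl : 0 < l) :
    ∃ s : ℝ, Tendsto (fun n : Fin ν → ℕ => F (box fun j => l * n j) / (box n).card) atTop (𝓝 s) ∧
      ∀ (v : Fin ν → ℤ) (ε : ℝ), 0 < ε → ∀ᶠ n : Fin ν → ℕ in atTop,
        F (translateSet (box fun j => l * n j) v) / (box n).card ≤ s + ε := by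
  set R : (Fin ν → ℕ) → ℝ := fun n => F (box fun j => l * n j) / (box n).card with hR
  -- As in Fekete's lemma the limit is the infimum of the rates. The lower bound is then immediate,
  -- and the upper bound is proved for every corner v, as needed for translates of states.
  set s := sInf (R '' {m | ∀ j, 0 < m j}) with hs
  have hbdd : BddBelow (R '' {m | ∀ j, 0 < m j}) :=
    ⟨0, by rintro _ ⟨m, -, rfl⟩; exact div_nonneg (hF.nonneg _) (by positivity)⟩
  have hupper : ∀ (v : Fin ν → ℤ) (ε : ℝ), 0 < ε → ∀ᶠ n : Fin ν → ℕ in atTop,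
      F (translateSet (box fun j => l * n j) v) / (box n).card ≤ s + ε := by
    intro v ε hε
    obtain ⟨_, ⟨m, hm, rfl⟩, hmε⟩ := exists_lt_of_csInf_lt
      (Set.Nonempty.image R (s := {m : Fin ν → ℕ | ∀ j, 0 < m j}) ⟨fun _ => 1, fun _ => one_pos⟩)
      (lt_add_of_pos_right s hε)
    have hm : ∀ j, 0 < m j := hm
    have hm0 : ∀ j, (m j : ℝ) ≠ 0 := fun j => by exact_mod_cast (hm j).ne'
    have hq : ∀ j, Tendsto (fun n : Fin ν → ℕ => (((n j - 1) / m j : ℕ) : ℝ) / n j) atTop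
        (𝓝 (m j : ℝ)⁻¹) := fun j =>
      (tendsto_sub_one_div_div (hm j)).comp (tendsto_eval_atTop j)
    -- For fixed m the tiling bound per cell tends to R m: the uncovered fraction vanishes in the
    -- limit.
    have hlim : Tendsto (fun n : Fin ν → ℕ =>
        (∏ j, (((n j - 1) / m j : ℕ) : ℝ) / n j) * F (box fun j => l * m j) +
          (l : ℝ) ^ ν * (1 - ∏ j, (((n j - 1) / m j : ℕ) : ℝ) / n j * (m j : ℝ)) * C) atTop
        (𝓝 ((∏ j, (m j : ℝ)⁻¹) * F (box fun j => l * m j) +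
          (l : ℝ) ^ ν * (1 - ∏ j, (m j : ℝ)⁻¹ * (m j : ℝ)) * C)) :=
      ((tendsto_finsetProd _ fun j _ => hq j).mul_const _).add
        ((((tendsto_finsetProd _ fun j _ => (hq j).mul_const _).const_sub 1).const_mul _).mul_const
          C)
    have hval : (∏ j, (m j : ℝ)⁻¹) * F (box fun j => l * m j) +
        (l : ℝ) ^ ν * (1 - ∏ j, (m j : ℝ)⁻¹ * (m j : ℝ)) * C = R m := by
      rw [Finset.prod_congr rfl fun j _ => inv_mul_cancel₀ (hm0 j), Finset.prod_const_one, sub_self,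
        mul_zero, zero_mul, add_zero, Finset.prod_inv_distrib, inv_mul_eq_div, ← Nat.cast_prod, ← card_box]
    rw [hval] at hlim
    filter_upwards [hlim.eventually (gt_mem_nhds hmε), eventually_forall_pos] with n hn hpos
    refine le_trans ?_ hn.le
    have hn0 : ∀ j, (n j : ℝ) ≠ 0 := fun j => by exact_mod_cast (hpos j).ne'
    have hprod : (0 : ℝ) < ∏ j, (n j : ℝ) := Finset.prod_pos fun j _ => by exact_mod_cast hpos j
    rw [card_box, Nat.cast_prod, div_le_iff₀ hprod]
    refine (hF.box_le hl v n m hpos hm).trans (le_of_eq ?_)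
    simp only [Finset.prod_mul_distrib, Finset.prod_div_distrib]
    field_simp
  refine ⟨s, ?_, hupper⟩
  rw [Metric.tendsto_nhds]
  intro ε hε
  filter_upwards [hupper 0 (ε / 2) (half_pos hε), eventually_forall_pos] with n hn hpos
  have h0 : translateSet (box fun j => l * n j) (0 : Fin ν → ℤ) = box fun j => l * n j := by
    ext x
    rw [mem_translateSet, sub_zero]
  rw [h0] at hn
  have h1 : s ≤ R n := csInf_le hbdd ⟨n, hpos, rfl⟩
  rw [Real.dist_eq, abs_lt]
  change R n ≤ s + ε / 2 at hn
  constructor <;> linarith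

/-- For ν = 0 every box is a single point and nothing decays, so the constant has to vanish there.
-/
theorem tendsto_const_div_card_box {K : ℝ} (hK : ν = 0 → K = 0) :
    Tendsto (fun n : Fin ν → ℕ => K / (box n).card) atTop (𝓝 0) := by
  rcases Nat.eq_zero_or_pos ν with rfl | hν
  · simp [hK rfl]
  · refine tendsto_const_nhds.div_atTop (tendsto_natCast_atTop_atTop.comp ?_)
    refine tendsto_atTop_mono' _ ?_ (tendsto_eval_atTop (⟨0, hν⟩ : Fin ν))
    filter_upwards [eventually_forall_pos] with n hn
    rw [card_box]
    exact Finset.single_le_prod' (f := n) (fun j _ => hn j) (Finset.mem_univ _)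

end Fekete

/-! ### Mean entropy -/

section MeanEntropy

variable {A : Type*} [CStarAlgebra A] [FiniteDimensional ℂ A] {ν : ℕ}
  {Ψ : QuasiLocal A ν →ₗ[ℂ] ℂ} {l : ℕ}

theorem isLatticeSubadditive_entropy (hΨ : Ψ ∈ invariantStates A ν (scaledLattice ν l)) :
    IsLatticeSubadditive l (Real.log (Fintype.card (Idx A))) (entropy Ψ) where
  union_le _ _ h := entropy_union_le hΨ.1 h
  nonneg _ := entropy_nonneg hΨ.1
  le_card _ := entropy_le_card_mul hΨ.1
  translate Λ v := by
    have h : translate Ψ (l • v) = Ψ := hΨ.2 (l • v) ⟨v, rfl⟩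
    rw [entropy_translateSet hΨ.1, h]

theorem exists_hasMeanEntropy (hl : 0 < l)
    (hΨ : Ψ ∈ invariantStates A ν (scaledLattice ν l)) : ∃ s, HasMeanEntropy Ψ l s := by
  obtain ⟨s, hs, -⟩ := (isLatticeSubadditive_entropy hΨ).exists_tendsto hl
  exact ⟨s, hs⟩

/-- The entropy of the translate in a box is that of Ψ in the shifted box, and the Fekete bound
holds for every shift v, not only for those in l ℤ^ν. -/
theorem hasMeanEntropy_translate_le (hl : 0 < l)
    (hΨ : Ψ ∈ invariantStates A ν (scaledLattice ν l)) {s t : ℝ} (hs : HasMeanEntropy Ψ l s)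
    {v : Fin ν → ℤ} (ht : HasMeanEntropy (translate Ψ v) l t) : t ≤ s := by
  obtain ⟨s', hs', hle⟩ := (isLatticeSubadditive_entropy hΨ).exists_tendsto hl
  obtain rfl : s' = s := tendsto_nhds_unique hs' hs
  refine le_of_forall_pos_le_add fun ε hε => ?_
  refine le_of_tendsto ht ((hle v ε hε).mono fun n hn => ?_)
  rwa [entropy_translateSet hΨ.1] at hn

theorem translate_mem_invariantStates {G : AddSubgroup (Fin ν → ℤ)}
    (hΨ : Ψ ∈ invariantStates A ν G) (v : Fin ν → ℤ) : translate Ψ v ∈ invariantStates A ν G := by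
  have := isClosed_quasiLocalAlgebra (A := A) (ν := ν)
  exact shift_mem_invStates isAction_translation hΨ v

/-- Translates of a state have the same mean entropy. -/
theorem hasMeanEntropy_translate (hl : 0 < l)
    (hΨ : Ψ ∈ invariantStates A ν (scaledLattice ν l)) {s : ℝ} (hs : HasMeanEntropy Ψ l s)
    (v : Fin ν → ℤ) : HasMeanEntropy (translate Ψ v) l s := by
  have hΨ' : translate Ψ v ∈ invariantStates A ν (scaledLattice ν l) :=
    translate_mem_invariantStates hΨ v
  obtain ⟨t, ht⟩ := exists_hasMeanEntropy hl hΨ'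
  have h1 : t ≤ s := hasMeanEntropy_translate_le hl hΨ hs ht
  have h3 : HasMeanEntropy (translate (translate Ψ v) (-v)) l s :=
    (congrArg (HasMeanEntropy · l s) (translate_translate_neg Ψ v)).mpr hs
  have h2 : s ≤ t := hasMeanEntropy_translate_le hl hΨ' ht h3
  exact le_antisymm h1 h2 ▸ ht

/-- A uniform mixture of states with the same mean entropy has the same mean entropy. -/
theorem hasMeanEntropy_average {ι : Type*} {S : Finset ι} (hS : S.Nonempty)
    (hν : ν = 0 → S.card = 1) {Φ : ι → QuasiLocal A ν →ₗ[ℂ] ℂ}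
    (hΦ : ∀ i ∈ S, Φ i ∈ states A ν) (hΨ : Ψ ∈ states A ν)
    (h : Ψ = (S.card : ℝ)⁻¹ • ∑ i ∈ S, Φ i) {s : ℝ} (hs : ∀ i ∈ S, HasMeanEntropy (Φ i) l s) :
    HasMeanEntropy Ψ l s := by
  have hcard : (S.card : ℝ) ≠ 0 := by exact_mod_cast hS.card_pos.ne'
  have hlim : Tendsto (fun n => (S.card : ℝ)⁻¹ * ∑ i ∈ S, entropyRate (Φ i) l n) atTop (𝓝 s) := by
    have h1 := (tendsto_finsetSum S fun i hi => hs i hi).const_mul (S.card : ℝ)⁻¹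
    rwa [Finset.sum_const, nsmul_eq_mul, inv_mul_cancel_left₀ hcard] at h1
  -- The mixing term log N is killed by the volume; for ν = 0 there is one summand and log 1 = 0.
  have hlim' := hlim.add (tendsto_const_div_card_box (ν := ν) (K := Real.log S.card)
    (fun h0 => by rw [hν h0]; simp))
  rw [add_zero] at hlim'
  have hsum : ∀ n : Fin ν → ℕ, (S.card : ℝ)⁻¹ * ∑ i ∈ S, entropyRate (Φ i) l n =
      (S.card : ℝ)⁻¹ * (∑ i ∈ S, entropy (Φ i) (box fun j => l * n j)) / (box n).card := by
    intro n
    rw [mul_div_assoc, Finset.sum_div]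
    rfl
  refine tendsto_of_tendsto_of_tendsto_of_le_of_le hlim hlim' (fun n => ?_) (fun n => ?_)
  · simp only [hsum]
    exact div_le_div_of_nonneg_right (entropy_average_bounds hS hΦ hΨ h).1 (Nat.cast_nonneg _)
  · simp only [hsum]
    rw [← add_div]
    exact div_le_div_of_nonneg_right (entropy_average_bounds hS hΦ hΨ h).2 (Nat.cast_nonneg _)

end MeanEntropy

/-! ### Uniqueness of the ergodic decomposition -/

section Uniqueness

variable {A : Type*} [CStarAlgebra A] [FiniteDimensional ℂ A] {ν : ℕ}
  {Ψ : QuasiLocal A ν →ₗ[ℂ] ℂ}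

theorem translate_mem_ergodicStates {G : AddSubgroup (Fin ν → ℤ)}
    (hΨ : Ψ ∈ ergodicStates A ν G) (v : Fin ν → ℤ) : translate Ψ v ∈ ergodicStates A ν G := by
  have := isClosed_quasiLocalAlgebra (A := A) (ν := ν)
  exact shift_mem_extremePoints isAction_translation hΨ v

/-- Over a lattice of positive dimension an ergodic decomposition is determined by its
barycenter. -/
theorem eq_of_linearCombination_eq {l : ℕ} (hl : 0 < l) (hν : 0 < ν)
    {w w' : (QuasiLocal A ν →ₗ[ℂ] ℂ) →₀ ℝ}
    (hw : ∀ Φ ∈ w.support, Φ ∈ ergodicStates A ν (scaledLattice ν l))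
    (hw' : ∀ Φ ∈ w'.support, Φ ∈ ergodicStates A ν (scaledLattice ν l))
    (h : ∑ Φ ∈ w.support, w Φ • Φ = ∑ Φ ∈ w'.support, w' Φ • Φ) : w = w' := by
  have := isClosed_quasiLocalAlgebra (A := A) (ν := ν)
  have hind : LinearIndepOn ℝ id (ergodicStates A ν (scaledLattice ν l)) :=
    linearIndependent_extremePoints isAction_translation isAsymptoticallyAbelian_translation
      (isFolner_scaledBox hl hν)
  refine sub_eq_zero.1 (linearIndepOn_iff.1 hind (w - w') ?_ ?_)
  · exact sub_mem ((Finsupp.mem_supported ℝ w).2 fun Φ hΦ => hw Φ hΦ)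
      ((Finsupp.mem_supported ℝ w').2 fun Φ hΦ => hw' Φ hΦ)
  · rw [map_sub, sub_eq_zero]
    exact h

/-- An ergodic state dominates multiples of no other invariant state. -/
theorem eq_of_dominated_of_ergodic {G : AddSubgroup (Fin ν → ℤ)} (hΨ : Ψ ∈ ergodicStates A ν G)
    {Φ : QuasiLocal A ν →ₗ[ℂ] ℂ} (hΦ : Φ ∈ invariantStates A ν G) {c : ℝ}
    (h : ∀ a, Φ (star a * a) ≤ (c : ℂ) * Ψ (star a * a)) : Φ = Ψ := by
  have := isClosed_quasiLocalAlgebra (A := A) (ν := ν)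
  exact eq_of_dominated (B := QuasiLocal A ν) (τ := translation A) hΨ hΦ h

/-- An ergodic state has only the trivial ergodic decomposition. -/
theorem IsErgodicDecomposition.eq_single {G : AddSubgroup (Fin ν → ℤ)}
    (hΨ : Ψ ∈ ergodicStates A ν G) {w : (QuasiLocal A ν →ₗ[ℂ] ℂ) →₀ ℝ}
    (hw : IsErgodicDecomposition G Ψ w) : w = Finsupp.single Ψ 1 := by
  have hsub : ∀ Φ ∈ w.support, Φ = Ψ := by
    intro Φ hΦ
    -- All terms of the combination are positive, so w(Φ) Φ ≤ Ψ, and the constant is 1 / w(Φ).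
    refine eq_of_dominated_of_ergodic hΨ (hw.ergodic Φ hΦ).1 (c := (w Φ)⁻¹) fun a => ?_
    have h1 : Ψ (star a * a) = ∑ Φ' ∈ w.support, (w Φ' : ℂ) * Φ' (star a * a) := by
      conv_lhs => rw [← hw.sum_smul_eq]
      rw [LinearMap.sum_apply]
      exact Finset.sum_congr rfl fun _ _ => rfl
    have h2 : (w Φ : ℂ) * Φ (star a * a) ≤ Ψ (star a * a) := by
      rw [h1]
      exact Finset.single_le_sum (f := fun Φ' => (w Φ' : ℂ) * Φ' (star a * a))
        (fun Φ' hΦ' => mul_nonneg (Complex.zero_le_real.2 (hw.pos Φ' hΦ').le)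
          ((hw.ergodic Φ' hΦ').1.1.1 a)) hΦ
    have h3 := mul_le_mul_of_nonneg_left h2
      (Complex.zero_le_real.2 (inv_nonneg.2 (hw.pos Φ hΦ).le))
    have h4 : (w Φ : ℂ) ≠ 0 := Complex.ofReal_ne_zero.2 (hw.pos Φ hΦ).ne'
    rwa [Complex.ofReal_inv, inv_mul_cancel_left₀ h4, ← Complex.ofReal_inv] at h3
  have h1 : w = Finsupp.single Ψ (w Ψ) := by
    rw [Finsupp.eq_single_iff]
    exact ⟨fun Φ hΦ => Finset.mem_singleton.2 (hsub Φ hΦ), rfl⟩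
  have h2 := hw.sum_eq_one
  have h3 : w Ψ = 1 := by
    rw [← h2]
    refine (Finset.sum_subset (fun Φ hΦ => Finset.mem_singleton.2 (hsub Φ hΦ))
      (fun Φ _ hΦ => Finsupp.notMem_support_iff.1 hΦ)).trans (Finset.sum_singleton _ _) |>.symm
  rw [h1, h3]

end Uniqueness

/-! ### Decomposition of an ergodic state into translates -/

section Decomposition

variable {A : Type*} [CStarAlgebra A] [FiniteDimensional ℂ A] {ν : ℕ}
  {Φ : QuasiLocal A ν →ₗ[ℂ] ℂ}

/-- The translations that leave a functional invariant. -/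
def stabilizer (Φ : QuasiLocal A ν →ₗ[ℂ] ℂ) : AddSubgroup (Fin ν → ℤ) where
  carrier := {x | translate Φ x = Φ}
  zero_mem' := translate_zero Φ
  add_mem' {x y} hx hy := by
    change translate Φ (x + y) = Φ
    rw [← translate_translate]
    exact (congrArg (translate · y) hx).trans hy
  neg_mem' {x} hx := by
    change translate Φ (-x) = Φ
    have h := translate_translate Φ x (-x)
    rw [add_neg_cancel, translate_zero] at h
    exact (congrArg (translate · (-x)) hx).symm.trans h

/-- For ν > 0 this is linear independence of the ergodic states. For ν = 0 there is no Følner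
sequence of growing cardinality, but l ℤ^0 is the whole group, so Ψ is itself ergodic for it and its
decomposition is trivial. -/
theorem isErgodicDecomposition_unique {l : ℕ} (hl : 0 < l) {Ψ : QuasiLocal A ν →ₗ[ℂ] ℂ}
    (hΨ : Ψ ∈ ergodicStates A ν ⊤) {ι : Type*} {S : Finset ι} (hν : ν = 0 → S.card = 1)
    {Φ : ι → QuasiLocal A ν →ₗ[ℂ] ℂ}
    (hΦ : ∀ i ∈ S, Φ i ∈ ergodicStates A ν (scaledLattice ν l))
    (h : Ψ = (S.card : ℝ)⁻¹ • ∑ i ∈ S, Φ i) {w : (QuasiLocal A ν →ₗ[ℂ] ℂ) →₀ ℝ}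
    (hw : IsErgodicDecomposition (scaledLattice ν l) Ψ w) :
    w = ∑ i ∈ S, Finsupp.single (Φ i) (S.card : ℝ)⁻¹ := by
  rcases Nat.eq_zero_or_pos ν with h0 | hpos
  · subst h0
    have hG : scaledLattice 0 l = ⊤ := by
      refine AddSubgroup.ext fun x => ⟨fun _ => trivial, fun _ => ?_⟩
      rw [Subsingleton.elim x 0]
      exact zero_mem _
    rw [hG] at hw
    obtain ⟨i, rfl⟩ := Finset.card_eq_one.1 (hν rfl)
    have h1 : Ψ = Φ i := by
      rw [h, Finset.sum_singleton, Finset.card_singleton, Nat.cast_one, inv_one, one_smul]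
    rw [hw.eq_single hΨ, Finset.sum_singleton, Finset.card_singleton, Nat.cast_one, inv_one, h1]
  · classical
    refine eq_of_linearCombination_eq hl hpos hw.ergodic (fun Φ' hΦ' => ?_) ?_
    · obtain ⟨i, hi, hi'⟩ := Finset.mem_biUnion.1 (Finsupp.support_finsetSum hΦ')
      rw [Finset.mem_singleton.1 (Finsupp.support_single_subset hi')]
      exact hΦ i hi
    · rw [hw.sum_smul_eq]
      change Ψ = Finsupp.linearCombination ℝ id (∑ i ∈ S, Finsupp.single (Φ i) (S.card : ℝ)⁻¹)
      rw [map_sum, h, Finset.smul_sum]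
      exact Finset.sum_congr rfl fun i _ => 
        (Finsupp.linearCombination_single ℝ (v := id) (S.card : ℝ)⁻¹ (Φ i)).symm

/-- An ergodic state dominates a multiple of an `l ℤ^ν`-ergodic state. -/
theorem exists_ergodic_dominated {l : ℕ} (hl : 0 < l) {Ψ : QuasiLocal A ν →ₗ[ℂ] ℂ}
    (hΨ : Ψ ∈ ergodicStates A ν ⊤) :
    ∃ Φ ∈ ergodicStates A ν (scaledLattice ν l), ∃ c : ℝ,
      ∀ a, Φ (star a * a) ≤ (c : ℂ) * Ψ (star a * a) := by
  have := isClosed_quasiLocalAlgebra (A := A) (ν := ν)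
  obtain ⟨k, -, hk⟩ := exists_box_isTransversal hl (scaledLattice ν l) fun x => ⟨x, rfl⟩
  obtain ⟨Φ, hΦ, h⟩ := exists_extreme_dominated (isAction_translation (A := A)) hk hΨ
  exact ⟨Φ, hΦ, _, h⟩

/-- An ergodic state is the mean of the distinct translates of any state of which it dominates a
multiple. -/
theorem eq_average_translate {Ψ : QuasiLocal A ν →ₗ[ℂ] ℂ} (hΨ : Ψ ∈ ergodicStates A ν ⊤)
    (hΦ : Φ ∈ states A ν) {c : ℝ} (h : ∀ a, Φ (star a * a) ≤ (c : ℂ) * Ψ (star a * a))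
    {S : Finset (Fin ν → ℤ)} (hS : IsTransversal (stabilizer Φ) S) :
    Ψ = (S.card : ℝ)⁻¹ • ∑ x ∈ S, translate Φ (-x) := by
  have := isClosed_quasiLocalAlgebra (A := A) (ν := ν)
  exact eq_average_of_dominated (isAction_translation (A := A)) hS hΨ ⟨hΦ, fun _ hx => hx⟩ h

theorem injOn_translate_neg {S : Finset (Fin ν → ℤ)} (hS : IsTransversal (stabilizer Φ) S) :
    Set.InjOn (fun x => translate Φ (-x)) S := by
  intro x hx y hy hxy
  have hmem : x - y ∈ stabilizer Φ := by
    have h1 : translate (translate Φ (-x)) x = translate (translate Φ (-y)) x :=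
      congrArg (translate · x) hxy
    rw [translate_translate, translate_translate, neg_add_cancel, translate_zero,
      neg_add_eq_sub] at h1
    exact h1.symm
  exact (hS x).unique ⟨hx, by rw [sub_self]; exact zero_mem _⟩ ⟨hy, hmem⟩

end Decomposition

end QuantumLattice

/-! ### The main theorem. -/

open QuantumLattice in
theorem theorem2 {A : Type*} [CStarAlgebra A] [FiniteDimensional ℂ A] {ν : ℕ}
    (Ψ : QuasiLocal A ν →ₗ[ℂ] ℂ) (hΨ : Ψ ∈ ergodicStates A ν ⊤) (l : ℕ) (hl : 1 < l) :
    ∃ (k : Fin ν → ℕ) (Φ : (Fin ν → ℤ) → (QuasiLocal A ν →ₗ[ℂ] ℂ)),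
      (∀ j, k j ≤ l ∧ k j ∣ l) ∧
      (∀ x ∈ box k, Φ x ∈ ergodicStates A ν (scaledLattice ν l)) ∧
      Set.InjOn Φ (box k) ∧
      Ψ = ((box k).card : ℝ)⁻¹ • ∑ x ∈ box k, Φ x ∧
      (∀ w : (QuasiLocal A ν →ₗ[ℂ] ℂ) →₀ ℝ, IsErgodicDecomposition (scaledLattice ν l) Ψ w →
        w = ∑ x ∈ box k, Finsupp.single (Φ x) ((box k).card : ℝ)⁻¹) ∧
      (∀ x ∈ box k, Φ x = translate (Φ 0) (-x)) ∧
      ∃ s : ℝ, HasMeanEntropy Ψ l s ∧ ∀ x ∈ box k, HasMeanEntropy (Φ x) l s := by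
  have hl0 : 0 < l := zero_lt_one.trans hl
  obtain ⟨φ, hφ, c, hdom⟩ := exists_ergodic_dominated hl0 hΨ
  -- The box represents the cosets of the stabilizer of φ, not those of l ℤ^ν: this makes the
  -- translates pairwise distinct. The sides divide l because φ is invariant under l ℤ^ν.
  obtain ⟨k, hkl, hk⟩ := exists_box_isTransversal hl0 (stabilizer φ) fun x =>
    hφ.1.2 (l • x) ⟨x, rfl⟩
  have hav := eq_average_translate hΨ hφ.1.1 hdom hk
  have herg : ∀ x : Fin ν → ℤ, translate φ (-x) ∈ ergodicStates A ν (scaledLattice ν l) :=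
    fun x => translate_mem_ergodicStates hφ (-x)
  have hν : ν = 0 → (box k).card = 1 := by
    rintro rfl
    rw [card_box, Fin.prod_univ_zero]
  obtain ⟨s, hs⟩ := exists_hasMeanEntropy hl0 hφ.1
  have hs' : ∀ x : Fin ν → ℤ, HasMeanEntropy (translate φ (-x)) l s :=
    fun x => hasMeanEntropy_translate hl0 hφ.1 hs (-x)
  refine ⟨k, fun x => translate φ (-x), fun j => ⟨Nat.le_of_dvd hl0 (hkl j), hkl j⟩,
    fun x _ => herg x, injOn_translate_neg hk, hav,
    fun w hw => isErgodicDecomposition_unique hl0 hΨ hν (fun x _ => herg x) hav hw,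
    fun x _ => ?_, s, ?_, fun x _ => hs' x⟩
  · change translate φ (-x) = translate (translate φ (-0)) (-x)
    rw [neg_zero, QuantumLattice.translate_zero]
  · exact hasMeanEntropy_average (Finset.card_pos.1 hk.card_pos) hν (fun x _ => (herg x).1.1)
      hΨ.1.1 hav fun x _ => hs' x
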